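/- Theorem (cyclic sink equilibria). Consider a normal-form game with players $1,\dots,N$, finite strategy sets $S_1,\dots,S_N$ and utilities $u_i:\prod_j S_j\to\mathbb R$. Its preference graph has the pure profiles as nodes and an arc $p\to q$ whenever $p,q$ differ in the strategy of exactly one player $i$ and $u_i(q)\ge u_i(p)$. Let $c=(c_1,\dots,c_K)$, $K\ge 3$, be a cycle of distinct profiles in this graph that is a sink equilibrium: it has no outgoing arcs, i.e. for each $k$ the only arc leaving $c_k$ is $c_k\to c_{k+1}$ (indices mod $K$). (Then necessarily $K\ge 4$.) For a mixed profile $x$ write $\mathbb U^i_s(x)$ for the expected utility of player $i$ from the pure strategy $s$ when the others play according to $x$. The replicator dynamic (RD) on the strategy space $X=\prod_i\Delta(S_i)$ is $\dot x^i_s=x^i_s\bigl(\mathbb U^i_s(x)-\sum_r x^i_r\,\mathbb U^i_r(x)\bigr)$. In payoff space $\prod_i\mathbb R^{S_i}$, RD is $\dot w^i_s=\mathbb U^i_s(\mathrm{softmax}\,w)$ and the best-response dynamics (BRD) is the differential inclusion $\dot w^i_s=\mathbb U^i_s(y)$, where $y$ is a mixed profile with each $y^j$ supported on $\arg\max w^j$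 (the same $y$ for all $i,s$; solutions are locally absolutely continuous). The cycle $c$ is called stable under one of these two dynamics if there is a nonempty open set $U$ of points of payoff space such that solutions on $[0,\infty)$ exist from every point of $U$, and along every solution from $U$ the pure profile $\arg\max w(t)$ runs through $c_1,c_2,\dots,c_K,c_1,c_2,\dots$ forever (off a sequence of switching times that tends to infinity), and the normalized trajectories $w(t)/\|w(t)\|$ of all these solutions have the same limit set as $t\to\infty$. (i) If $K>4$, then $c$ is stable under BRD and under RD, and the union over $k$ of the strategy spaces of the one-dimensional subgames spanned by the arcs $c_k\to c_{k+1}$ is an attractor of RD on $X$, i.e. a nonempty compact invariant set that is Lyapunov stable and uniformly attracts a neighbourhood of itself in $X$. (ii) If $K=4$, then the strategy space of the $2\times 2$ subgame spanned by $c$ is an attractor of RD on $X$. -/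

import Mathlib

/-!  Games in normal form, their preference graph, and the replicator and best-response dynamics. -/

open Set Filter Topology MeasureTheory

namespace NGame

universe v

section Basic

variable {N : ℕ} {S : Fin N → Type v}

/-- A pure strategy profile. -/
abbrev Profile (S : Fin N → Type v) : Type v := ∀ i, S i

/-- The real vector space that contains both the mixed profiles (strategy space)
and the vectors of accumulated payoffs (payoff space). -/
abbrev Vec (S : Fin N → Type v) : Type v := ∀ i, S i → ℝ

/-- Arcs of the preference graph: `p` and `q` differ in the strategy of exactly one player, and
this player weakly prefers `q` to `p`. -/
def Arc (u : Profile S → Fin N → ℝ) (p q : Profile S) : Prop :=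
  ∃ i, (∀ j, j ≠ i → q j = p j) ∧ q i ≠ p i ∧ u p i ≤ u q i

/-- Sink equilibria: the strongly connected components of the preference graph that no arc
leaves. -/
structure IsSinkEquilibrium (u : Profile S → Fin N → ℝ) (A : Set (Profile S)) : Prop where
  nonempty : A.Nonempty
  connected : ∀ p ∈ A, ∀ q ∈ A, Relation.ReflTransGen (Arc u) p q
  closed : ∀ p ∈ A, ∀ q, Arc u p q → q ∈ A

/-- `c 0 → c 1 → ⋯ → c (K - 1) → c 0` is a cycle of the preference graph without repeated nodes
and without outgoing arcs: the only arc that leaves a node of the cycle is the arc of the cycle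
to the next node. -/
structure IsSinkCycle (u : Profile S → Fin N → ℝ) {K : ℕ} (c : ZMod K → Profile S) : Prop where
  injective : Function.Injective c
  arc : ∀ k, Arc u (c k) (c (k + 1))
  no_outgoing : ∀ k q, Arc u (c k) q → q = c (k + 1)

/-- The set of nodes of such a cycle is a sink equilibrium. -/
theorem IsSinkCycle.isSinkEquilibrium {u : Profile S → Fin N → ℝ} {K : ℕ} [NeZero K]
    {c : ZMod K → Profile S} (hc : IsSinkCycle u c) : IsSinkEquilibrium u (range c) := by
  refine ⟨⟨c 0, mem_range_self 0⟩, ?_, ?_⟩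
  · rintro _ ⟨k, rfl⟩ _ ⟨l, rfl⟩
    have step : ∀ n : ℕ, Relation.ReflTransGen (Arc u) (c k) (c (k + n)) := by
      intro n
      induction n with
      | zero => simpa using Relation.ReflTransGen.refl
      | succ n ih =>
        have h := ih.tail (hc.arc (k + n))
        rwa [add_assoc, ← Nat.cast_succ] at h
    have h := step (l - k).val
    rwa [ZMod.natCast_zmod_val, add_sub_cancel] at h
  · rintro _ ⟨k, rfl⟩ q hq
    exact ⟨k + 1, (hc.no_outgoing k q hq).symm⟩

/-- The set of maximal coordinates of player `i` at the point `w` of payoff space. -/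
def argmaxSet (w : Vec S) (i : Fin N) : Set (S i) := {s | ∀ r, w i r ≤ w i s}

/-- The sequence of play along the path `w : [0, ∞) → Vec S` is the sequence of pure profiles
`c 0, c 1, …, c (K - 1), c 0, c 1, …`, repeated forever, with switching times
`0 = θ 0 < θ 1 < ⋯`. -/
def FollowsPlay {K : ℕ} (c : ZMod K → Profile S) (w : ℝ → Vec S) : Prop :=
  ∃ θ : ℕ → ℝ, θ 0 = 0 ∧ StrictMono θ ∧ Tendsto θ atTop atTop ∧
    ∀ n : ℕ, ∀ t ∈ Ioo (θ n) (θ (n + 1)), ∀ i, argmaxSet (w t) i = {c (n : ZMod K) i}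

end Basic

section Dynamics

variable {N : ℕ} {S : Fin N → Type v} [∀ i, Fintype (S i)]

/-- The expected utility of the players under the mixed profile `x`. -/
noncomputable def expUtility (u : Profile S → Fin N → ℝ) (x : Vec S) (i : Fin N) : ℝ :=
  open Classical in ∑ p : Profile S, (∏ j, x j (p j)) * u p i

/-- The expected utility of player `i` from the pure strategy `s` when the other players play
according to `x`. -/
noncomputable def stratUtility (u : Profile S → Fin N → ℝ) (x : Vec S) (i : Fin N) (s : S i) : ℝ :=
  open Classical in expUtility u (Function.update x i (Pi.single s 1)) i

/-- The strategy space of the subgame in which player `i` is restricted to the pure strategies in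
`T i`. -/
def subgameSpace (T : ∀ i, Set (S i)) : Set (Vec S) :=
  {x | ∀ i, x i ∈ stdSimplex ℝ (S i) ∧ ∀ s, s ∉ T i → x i s = 0}

/-- The strategy space of the game. -/
def strategySpace (S : Fin N → Type v) [∀ i, Fintype (S i)] : Set (Vec S) :=
  subgameSpace fun _ => univ

/-- The vector field of the replicator dynamic on strategy space. -/
noncomputable def replicatorField (u : Profile S → Fin N → ℝ) (x : Vec S) (i : Fin N) (s : S i) : ℝ :=
  x i s * (stratUtility u x i s - ∑ r, x i r * stratUtility u x i r)

/-- `x` is a solution on `[0, ∞)` of the replicator equation in strategy space. -/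
def IsReplicatorSolution (u : Profile S → Fin N → ℝ) (x : ℝ → Vec S) : Prop :=
  (∀ t, 0 ≤ t → x t ∈ strategySpace S) ∧
  ∀ t, 0 ≤ t → ∀ i s, HasDerivWithinAt (fun τ => x τ i s) (replicatorField u (x t) i s) (Ici 0) t

/-- The image of the set `B` of initial points under the replicator dynamic at time `t`. -/
def replicatorImage (u : Profile S → Fin N → ℝ) (t : ℝ) (B : Set (Vec S)) : Set (Vec S) :=
  {y | ∃ x, IsReplicatorSolution u x ∧ x 0 ∈ B ∧ x t = y}

/-- Attractors (asymptotically stable sets) of the replicator dynamic on strategy space: nonempty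
compact invariant sets that are Lyapunov stable and attract a neighbourhood (relative to strategy
space) uniformly. -/
structure IsReplicatorAttractor (u : Profile S → Fin N → ℝ) (A : Set (Vec S)) : Prop where
  nonempty : A.Nonempty
  compact : IsCompact A
  subset : A ⊆ strategySpace S
  invariant : ∀ t, 0 ≤ t → replicatorImage u t A = A
  lyapunov : ∀ ε > 0, ∃ δ > 0, ∀ t, 0 ≤ t →
    replicatorImage u t (Metric.thickening δ A) ⊆ Metric.thickening ε A
  attracting : ∃ U : Set (Vec S), IsOpen U ∧ A ⊆ U ∧
    (∀ y ∈ U ∩ strategySpace S, ∃ x, IsReplicatorSolution u x ∧ x 0 = y) ∧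
    ∀ ε > 0, ∃ t₀, 0 ≤ t₀ ∧ ∀ t, t₀ ≤ t → replicatorImage u t U ⊆ Metric.thickening ε A

/-- Softmax, applied to every player. -/
noncomputable def softmax (w : Vec S) : Vec S :=
  fun i s => Real.exp (w i s) / ∑ r, Real.exp (w i r)

/-- `w` is a solution on `[0, ∞)` of the replicator dynamic in payoff space. -/
def IsPayoffRDSolution (u : Profile S → Fin N → ℝ) (w : ℝ → Vec S) : Prop :=
  ∀ t, 0 ≤ t → ∀ i s,
    HasDerivWithinAt (fun τ => w τ i s) (stratUtility u (softmax (w t)) i s) (Ici 0) t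

/-- `w` is a solution on `[0, ∞)` of the best-response dynamics in payoff space: a locally
absolutely continuous solution of the differential inclusion in which, at almost every time, all
payoffs grow at the rates given by a mixed profile of best responses, that is, by a mixed profile
that is supported on the maximal coordinates of `w t`. -/
def IsPayoffBRDSolution (u : Profile S → Fin N → ℝ) (w : ℝ → Vec S) : Prop :=
  (∀ t, 0 ≤ t → AbsolutelyContinuousOnInterval w 0 t) ∧
  ∀ᵐ t ∂(volume.restrict (Ici (0 : ℝ))), ∃ y ∈ subgameSpace (argmaxSet (w t)),
    ∀ i s, HasDerivAt (fun τ => w τ i s) (stratUtility u y i s) t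

/-- The limit set, as time tends to infinity, of the normalized path `w / ‖w‖` in payoff space,
with the Euclidean norm. -/
def normalizedLimitSet (w : ℝ → Vec S) : Set (Vec S) :=
  {y | MapClusterPt y atTop fun t => (Real.sqrt (∑ i, ∑ s, w t i s ^ 2))⁻¹ • w t}

/-- Let a dynamic in payoff space be given by its solutions on `[0, ∞)`. The periodic sequence `c`
of pure profiles is persistent on `U` if `U` is nonempty and open and the sequence of play from
every point of `U` is `c`. -/
structure PersistentOn (Sol : (ℝ → Vec S) → Prop) {K : ℕ} (c : ZMod K → Profile S)
    (U : Set (Vec S)) : Prop where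
  isOpen : IsOpen U
  nonempty : U.Nonempty
  exists_solution : ∀ w₀ ∈ U, ∃ w, Sol w ∧ w 0 = w₀
  follows : ∀ w, Sol w → w 0 ∈ U → FollowsPlay c w

/-- The play from `U` is isolated if all normalized trajectories from `U` have the same limit
set. -/
def IsolatedOn (Sol : (ℝ → Vec S) → Prop) (U : Set (Vec S)) : Prop :=
  ∃ L : Set (Vec S), ∀ w, Sol w → w 0 ∈ U → normalizedLimitSet w = L

/-- The periodic sequence `c` is stable under a dynamic in payoff space. -/
def IsStablePlay (Sol : (ℝ → Vec S) → Prop) {K : ℕ} (c : ZMod K → Profile S) : Prop :=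
  ∃ U : Set (Vec S), PersistentOn Sol c U ∧ IsolatedOn Sol U

/-- The union of the strategy spaces of the one-dimensional subgames that are spanned by the arcs
of the cycle `c`. -/
def edgeUnion {K : ℕ} (c : ZMod K → Profile S) : Set (Vec S) :=
  ⋃ k, subgameSpace fun i => {c k i, c (k + 1) i}

/-- The strategy space of the smallest subgame that contains all profiles of the cycle `c`. -/
def spannedSubgame {K : ℕ} (c : ZMod K → Profile S) : Set (Vec S) :=
  subgameSpace fun i => range fun k => c k i

end Dynamics

end NGame

/-! Write e_p for the vector of payoffs of all pure strategies against the pure profile p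
(`payoffVec`). Against a mixed profile y, payoffs in payoff space grow at the rate Σ y(p) e_p. Both
dynamics are soft play (`IsSoftPlay`): y puts weight at most exp(w_s - w_r) on s. Logarithms of
interior RD solutions on X also have this form up to a normalization, so one analysis covers all
three statements for K > 4.

Suppose c(k+1) is played after arrival from c(k). The next mover's target catches up at rate `gain`,
while any other strategy s falls behind at rate `loss`. If the gaps on arrival are at least
m·α(k,i,s), then the phase lasts at least m·α(k,target)/gain, and the gaps on the next arrival are
at least m·(α(k,i,s) + α(k,target)·loss/gain). The core of the proof is the existence of weights α
for which this exceeds m·α(k+1,i,s), so that the level m grows along the cycle (`exists_weights`).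
By Gordan's theorem it suffices that the dual system has only the zero solution (`dual_eq_zero`). A
nonzero solution would yield a cyclic chain of inequalities whose product is an equality, because
following each player to its next move permutes the nodes. Then every link is an equality: two
players alternate, and each undoes its last move. That happens only on a cycle of length four, and K
> 4 excludes it.

The strictness of these inequalities leaves room for soft play. A `LevelSystem` consists of
functionals that grow at both ends of an edge and that pass to the next edge with a gain in level.
Hence soft play starting near an edge stays near the edges, and its distance in payoff space from
all other strategies grows at least linearly in time (`exists_growth`). In strategy space this is
exponential attraction to the union of the edges.

For stability in payoff space, linear growth forces the profiles to be played in cyclic order, in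
phases at least proportional to elapsed time. Deviations from exact play of one profile are
exponentially small away from the two ends of a phase, so each phase deviates from a straight
segment by a bounded error (`IsCyclicPath`). A strategy that returns after one period must make up
exactly what it lost since its last use. Thus the phase durations satisfy, up to bounded errors, a
linear recurrence with nonnegative coefficients. Compare with the durations of one exact
best-response path, which satisfy it exactly: the ratios are averages of earlier ratios up to
summable errors, hence they converge to a positive limit. Every path is then asymptotically a
positive multiple of the exact one, after a change of time, and all normalized limit sets agree.

For K = 4 the cycle exhausts the 2×2 subgame that it spans, so the absence of outgoing arcs says
that every strategy outside is strictly dominated there. The corresponding coordinates then decay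
exponentially. -/

namespace NGame

universe v

/-! ### Combinatorics of a cycle without outgoing arcs -/

section Combinatorics

variable {N : ℕ} {S : Fin N → Type v} {u : Profile S → Fin N → ℝ} {K : ℕ} {c : ZMod K → Profile S}

/-- The player who moves along the arc from `c k` to `c (k + 1)`. -/
noncomputable def IsSinkCycle.mover (hc : IsSinkCycle u c) (k : ZMod K) : Fin N :=
  (hc.arc k).choose

namespace IsSinkCycle

theorem succ_of_ne (hc : IsSinkCycle u c) {k : ZMod K} {j : Fin N} (hj : j ≠ hc.mover k) :
    c (k + 1) j = c k j :=
  (hc.arc k).choose_spec.1 j hj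

theorem succ_mover_ne (hc : IsSinkCycle u c) (k : ZMod K) :
    c (k + 1) (hc.mover k) ≠ c k (hc.mover k) :=
  (hc.arc k).choose_spec.2.1

theorem le_succ (hc : IsSinkCycle u c) (k : ZMod K) :
    u (c k) (hc.mover k) ≤ u (c (k + 1)) (hc.mover k) :=
  (hc.arc k).choose_spec.2.2

theorem eq_mover (hc : IsSinkCycle u c) {k : ZMod K} {j : Fin N} (hj : c (k + 1) j ≠ c k j) :
    j = hc.mover k := by
  by_contra h
  exact hj (hc.succ_of_ne h)

theorem update_mover (hc : IsSinkCycle u c) (k : ZMod K) :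
    Function.update (c k) (hc.mover k) (c (k + 1) (hc.mover k)) = c (k + 1) := by
  ext j
  by_cases h : j = hc.mover k
  · subst h; simp
  · simp [h, hc.succ_of_ne h]

theorem update_succ (hc : IsSinkCycle u c) (k : ZMod K) (s : S (hc.mover k)) :
    Function.update (c (k + 1)) (hc.mover k) s = Function.update (c k) (hc.mover k) s := by
  rw [← hc.update_mover k, Function.update_idem]

theorem lt_of_ne (hc : IsSinkCycle u c) {k : ZMod K} {i : Fin N} {s : S i} (h₀ : s ≠ c k i)
    (h₁ : s ≠ c (k + 1) i) : u (Function.update (c k) i s) i < u (c k) i := by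
  by_contra! h
  have : Function.update (c k) i s = c (k + 1) :=
    hc.no_outgoing k _ ⟨i, fun j hj => by simp [hj], by simpa using h₀, h⟩
  exact h₁ (by rw [← this]; simp)

theorem two_ne_zero_of_lt (hK : 2 < K) : (1 + 1 : ZMod K) ≠ 0 := by
  intro h
  have h2 : ((2 : ℕ) : ZMod K) = 0 := by push_cast; rw [← h]; norm_num
  rw [ZMod.natCast_eq_zero_iff] at h2
  exact absurd (Nat.le_of_dvd (by norm_num) h2) (by omega)

/-- Without strict improvement the reversed arc would also leave `c (k + 1)`, and uniqueness of the
outgoing arc would give `c k = c (k + 2)`. -/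
theorem lt_succ (hc : IsSinkCycle u c) (hK : 2 < K) (k : ZMod K) :
    u (c k) (hc.mover k) < u (c (k + 1)) (hc.mover k) := by
  by_contra! h
  have : c k = c (k + 1 + 1) :=
    hc.no_outgoing (k + 1) _ ⟨hc.mover k, fun j hj => (hc.succ_of_ne hj).symm,
      (hc.succ_mover_ne k).symm, h⟩
  have := hc.injective this
  rw [add_assoc, left_eq_add] at this
  exact two_ne_zero_of_lt hK this

/-- The strategy of player `i` in `c (k + 1)` is the unique best reply to `c k`. -/
theorem best_reply (hc : IsSinkCycle u c) (hK : 2 < K) {k : ZMod K} {i : Fin N} {s : S i}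
    (hs : s ≠ c (k + 1) i) :
    u (Function.update (c k) i s) i < u (Function.update (c k) i (c (k + 1) i)) i := by
  have key : s ≠ c k i → u (Function.update (c k) i s) i < u (c k) i := fun h => hc.lt_of_ne h hs
  by_cases hi : i = hc.mover k
  · subst hi
    rw [hc.update_mover]
    by_cases h : s = c k (hc.mover k)
    · subst h; simpa using hc.lt_succ hK k
    · exact (key h).trans (hc.lt_succ hK k)
  · rw [hc.succ_of_ne hi] at hs ⊢
    simpa using key hs

/-- After its move the mover already plays its unique best reply, and the opponents have not
changed, so it cannot move again at once. -/
theorem mover_succ_ne (hc : IsSinkCycle u c) (hK : 2 < K) (k : ZMod K) :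
    hc.mover (k + 1) ≠ hc.mover k := by
  intro h
  have h1 := hc.succ_mover_ne (k + 1)
  have h2 := hc.le_succ (k + 1)
  have h4 := hc.update_mover (k + 1)
  rw [h] at h1 h2 h4
  have h3 := hc.best_reply hK h1
  rw [hc.update_mover, ← hc.update_succ, h4] at h3
  exact absurd h3 (not_lt.2 h2)

theorem mover_succ_eq (hc : IsSinkCycle u c) (hK : 2 < K) (k : ZMod K) :
    c (k + 1) (hc.mover (k + 1)) = c k (hc.mover (k + 1)) :=
  hc.succ_of_ne (hc.mover_succ_ne hK k)

theorem succ_succ_mover (hc : IsSinkCycle u c) (hK : 2 < K) (k : ZMod K) :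
    c (k + 1 + 1) (hc.mover k) = c (k + 1) (hc.mover k) :=
  hc.succ_of_ne (hc.mover_succ_ne hK k).symm

/-- Two players alternate, and each undoes its previous move at its next one. After four moves
everybody is back. This is the equality case of the duality argument below. -/
theorem add_four_eq (hc : IsSinkCycle u c) (hK : 2 < K) (k : ZMod K)
    (hm : ∀ k, hc.mover (k + 1 + 1) = hc.mover k)
    (hs : ∀ k, c (k + 1 + 1 + 1) (hc.mover k) = c k (hc.mover k)) :
    c (k + 1 + 1 + 1 + 1) = c k := by
  ext i
  by_cases h0 : i = hc.mover k
  · subst h0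
    have : hc.mover k ≠ hc.mover (k + 1 + 1 + 1) := by
      rw [hm]; exact (hc.mover_succ_ne hK k).symm
    rw [hc.succ_of_ne this, hs]
  · by_cases h1 : i = hc.mover (k + 1)
    · subst h1
      rw [hs, hc.mover_succ_eq hK]
    · rw [hc.succ_of_ne (by rwa [hm]), hc.succ_of_ne (by rwa [hm]), hc.succ_of_ne h1,
        hc.succ_of_ne h0]

theorem not_alternating (hc : IsSinkCycle u c) (hK : 4 < K)
    (hm : ∀ k, hc.mover (k + 1 + 1) = hc.mover k)
    (hs : ∀ k, c (k + 1 + 1 + 1) (hc.mover k) = c k (hc.mover k)) : False := by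
  have h := hc.injective (hc.add_four_eq (by omega) 0 hm hs)
  have h2 : ((4 : ℕ) : ZMod K) = 0 := by push_cast; rw [← h]; norm_num
  rw [ZMod.natCast_eq_zero_iff] at h2
  exact absurd (Nat.le_of_dvd (by norm_num) h2) (by omega)

end IsSinkCycle

/-! ### Cycles of length four span a dominating 2×2 subgame -/

section Four

variable {c : ZMod 4 → Profile S}

/-- The player who leaves its strategy at `c k` must return to it within the period. It cannot move
at the two nodes adjacent to `c k`, so only the opposite node remains. -/
theorem IsSinkCycle.mover_add_two (hc : IsSinkCycle u c) (k : ZMod 4) :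
    hc.mover (k + 1 + 1) = hc.mover k := by
  by_contra h
  have e : k + 1 + 1 + 1 + 1 = k := (by decide : ∀ k : ZMod 4, k + 1 + 1 + 1 + 1 = k) k
  have h3 : hc.mover k ≠ hc.mover (k + 1 + 1 + 1) := by
    have := hc.mover_succ_ne (by norm_num) (k + 1 + 1 + 1)
    rwa [e] at this
  have := hc.succ_of_ne h3
  rw [e, hc.succ_of_ne (Ne.symm h), hc.succ_succ_mover (by norm_num)] at this
  exact hc.succ_mover_ne k this.symm

/-- A cycle of length four runs through all profiles of the subgame that it spans. -/
theorem IsSinkCycle.mem_range_of_forall (hc : IsSinkCycle u c) {p : Profile S}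
    (hp : ∀ i, p i ∈ range fun k => c k i) : p ∈ range c := by
  have hK : 2 < 4 := by norm_num
  have m2 : hc.mover (0 + 1 + 1) = hc.mover 0 := hc.mover_add_two 0
  have m3 : hc.mover (0 + 1 + 1 + 1) = hc.mover (0 + 1) := hc.mover_add_two (0 + 1)
  have all : ∀ k : ZMod 4, k = 0 ∨ k = 0 + 1 ∨ k = 0 + 1 + 1 ∨ k = 0 + 1 + 1 + 1 := by decide
  have e : (0 + 1 + 1 + 1 + 1 : ZMod 4) = 0 := by decide
  have hne := hc.mover_succ_ne hK 0
  have r1 : c (0 + 1 + 1) (hc.mover 0) = c (0 + 1) (hc.mover 0) := hc.succ_of_ne hne.symm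
  have r2 : c (0 + 1 + 1 + 1) (hc.mover 0) = c 0 (hc.mover 0) := by
    have := hc.succ_of_ne (k := 0 + 1 + 1 + 1) (j := hc.mover 0) (by rw [m3]; exact hne.symm)
    rw [e] at this; exact this.symm
  have s1 : c (0 + 1) (hc.mover (0 + 1)) = c 0 (hc.mover (0 + 1)) := hc.succ_of_ne hne
  have s2 : c (0 + 1 + 1 + 1) (hc.mover (0 + 1)) = c (0 + 1 + 1) (hc.mover (0 + 1)) :=
    hc.succ_of_ne (by rw [m2]; exact hne)
  have t : ∀ i, i ≠ hc.mover 0 → i ≠ hc.mover (0 + 1) → ∀ k, c k i = c 0 i := by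
    intro i h0 h1 k
    have t1 := hc.succ_of_ne h0
    have t2 := hc.succ_of_ne h1
    have t3 := hc.succ_of_ne (k := 0 + 1 + 1) (j := i) (by rwa [m2])
    rcases all k with rfl | rfl | rfl | rfl
    · rfl
    · exact t1
    · rw [t2, t1]
    · rw [t3, t2, t1]
  have key : ∀ k, p (hc.mover 0) = c k (hc.mover 0) → p (hc.mover (0 + 1)) = c k (hc.mover (0 + 1)) →
      p = c k := by
    intro k h0 h1
    ext i
    by_cases g0 : i = hc.mover 0
    · subst g0; exact h0
    by_cases g1 : i = hc.mover (0 + 1)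
    · subst g1; exact h1
    obtain ⟨l, hl⟩ := hp i
    simp only at hl
    rw [← hl, t i g0 g1 l, t i g0 g1 k]
  have p0 : p (hc.mover 0) = c 0 (hc.mover 0) ∨ p (hc.mover 0) = c (0 + 1) (hc.mover 0) := by
    obtain ⟨l, hl⟩ := hp (hc.mover 0)
    simp only at hl
    rcases all l with rfl | rfl | rfl | rfl <;> simp only [← hl, r1, r2, true_or, or_true]
  have p1 : p (hc.mover (0 + 1)) = c 0 (hc.mover (0 + 1)) ∨
      p (hc.mover (0 + 1)) = c (0 + 1 + 1) (hc.mover (0 + 1)) := by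
    obtain ⟨l, hl⟩ := hp (hc.mover (0 + 1))
    simp only at hl
    rcases all l with rfl | rfl | rfl | rfl <;> simp only [← hl, s1, s2, true_or, or_true]
  rcases p0 with h0 | h0 <;> rcases p1 with h1 | h1
  · exact ⟨_, (key 0 h0 h1).symm⟩
  · exact ⟨_, (key (0 + 1 + 1 + 1) (h0.trans r2.symm) (h1.trans s2.symm)).symm⟩
  · exact ⟨_, (key (0 + 1) h0 (h1.trans s1.symm)).symm⟩
  · exact ⟨_, (key (0 + 1 + 1) (h0.trans r1.symm) h1).symm⟩

/-- In the subgame spanned by a cycle of length four every other strategy is strictly dominated by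
every strategy of the subgame. -/
theorem IsSinkCycle.lt_of_notMem_range (hc : IsSinkCycle u c) {p : Profile S}
    (hp : ∀ i, p i ∈ range fun k => c k i) {i : Fin N} {r s : S i}
    (hr : r ∈ range fun k => c k i) (hs : s ∉ range fun k => c k i) :
    u (Function.update p i s) i < u (Function.update p i r) i := by
  obtain ⟨k, hk⟩ := hc.mem_range_of_forall (p := Function.update p i r) (fun j => by
    by_cases h : j = i
    · subst h; simpa using hr
    · simpa [h] using hp j)
  rw [← hk]
  have : Function.update p i s = Function.update (c k) i s := by rw [hk, Function.update_idem]
  rw [this]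
  exact hc.lt_of_ne (fun h => hs ⟨k, h.symm⟩) (fun h => hs ⟨k + 1, h.symm⟩)

end Four

end Combinatorics

/-! ### Payoff rates as means over pure profiles -/

section Mean

variable {N : ℕ} {S : Fin N → Type v}

/-- The payoffs of all pure strategies of all players against the pure profile `p`. -/
def payoffVec (u : Profile S → Fin N → ℝ) (p : Profile S) : Vec S :=
  fun i s => u (Function.update p i s) i

theorem payoffVec_congr (u : Profile S → Fin N → ℝ) {p q : Profile S} {i : Fin N}
    (h : ∀ j, j ≠ i → p j = q j) (s : S i) : payoffVec u p i s = payoffVec u q i s := by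
  unfold payoffVec
  congr 1
  ext j
  by_cases hj : j = i
  · subst hj; simp
  · simp [hj, h j hj]

/-- The functional `w ↦ w i r - w i s`. -/
noncomputable def gap (i : Fin N) (r s : S i) : Vec S →L[ℝ] ℝ :=
  ContinuousLinearMap.comp
    (ContinuousLinearMap.proj (R := ℝ) (φ := fun _ : S i => ℝ) r - ContinuousLinearMap.proj s)
    (ContinuousLinearMap.proj (R := ℝ) (φ := fun i => S i → ℝ) i)

@[simp]
theorem gap_apply (i : Fin N) (r s : S i) (w : Vec S) : gap i r s w = w i r - w i s := rfl

variable [∀ i, Fintype (S i)]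

/-- The probability of the pure profile `p` under the mixed profile `y`. -/
def profileProb (y : Vec S) (p : Profile S) : ℝ := ∏ j, y j (p j)

/-- Split off coordinate `i`: on both sides its probabilities sum to one, and what remains is the
same mean over the opponents. -/
theorem sum_profileProb_update (y : Vec S) (i : Fin N) (s : S i) (f : Profile S → ℝ)
    [∀ i, DecidableEq (S i)] (hy : ∑ r, y i r = 1) :
    ∑ p, profileProb (Function.update y i (Pi.single s 1)) p * f p
      = ∑ p, profileProb y p * f (Function.update p i s) := by
  have key : ∀ (y : Vec S) (f : Profile S → ℝ), ∑ p, profileProb y p * f p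
      = ∑ q : (∀ j : {j // j ≠ i}, S j), ∑ r : S i,
        (y i r * ∏ j : {j // j ≠ i}, y j (q j)) * f ((Equiv.piSplitAt i S).symm (r, q)) := by
    intro y f
    rw [← (Equiv.piSplitAt i S).symm.sum_comp, Fintype.sum_prod_type_right]
    refine Finset.sum_congr rfl fun q _ => Finset.sum_congr rfl fun r _ => ?_
    congr 1
    unfold profileProb
    rw [Fintype.prod_eq_mul_prod_subtype_ne _ i]
    congr 1
    · simp
    · refine Finset.prod_congr rfl fun j _ => ?_
      simp [Equiv.piSplitAt, j.2]
  rw [key, key]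
  refine Finset.sum_congr rfl fun q _ => ?_
  have hu : ∀ r, Function.update ((Equiv.piSplitAt i S).symm (r, q)) i s
      = (Equiv.piSplitAt i S).symm (s, q) := by
    intro r
    ext j
    by_cases hj : j = i
    · subst hj; simp
    · simp [Equiv.piSplitAt, hj]
  have hprod : ∀ a : S i → ℝ, ∏ j : {j // j ≠ i}, Function.update y i a j (q j)
      = ∏ j : {j // j ≠ i}, y j (q j) := fun a =>
    Finset.prod_congr rfl fun j _ => by rw [Function.update_of_ne j.2]
  simp only [hu, hprod, Function.update_self]
  rw [Finset.sum_eq_single s]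
  · rw [← Finset.sum_mul, ← Finset.sum_mul, hy]; simp
  · intro r _ hr; simp [hr]
  · simp

theorem stratUtility_eq (u : Profile S → Fin N → ℝ) {y : Vec S} {i : Fin N}
    (hy : ∑ r, y i r = 1) (s : S i) :
    stratUtility u y i s = ∑ p, profileProb y p * payoffVec u p i s := by
  classical
  unfold stratUtility expUtility
  have := sum_profileProb_update y i s (fun p => u p i) hy
  unfold profileProb payoffVec at *
  convert this

theorem mem_strategySpace {y : Vec S} :
    y ∈ strategySpace S ↔ ∀ i, (∀ s, 0 ≤ y i s) ∧ ∑ s, y i s = 1 := by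
  simp [strategySpace, subgameSpace, stdSimplex]

theorem subgameSpace_subset (T : ∀ i, Set (S i)) : subgameSpace T ⊆ strategySpace S :=
  fun _ hx i => ⟨(hx i).1, fun _ h => absurd (mem_univ _) h⟩

/-- The velocity in payoff space is a convex combination of finitely many vectors. Later estimates
of rates therefore reduce to pure profiles. -/
theorem stratUtility_eq_sum (u : Profile S → Fin N → ℝ) {y : Vec S} (hy : y ∈ strategySpace S) :
    stratUtility u y = ∑ p, profileProb y p • payoffVec u p := by
  ext i s
  rw [stratUtility_eq u (mem_strategySpace.1 hy i).2]
  simp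

theorem profileProb_nonneg {y : Vec S} (hy : y ∈ strategySpace S) (p : Profile S) :
    0 ≤ profileProb y p :=
  Finset.prod_nonneg fun j _ => (mem_strategySpace.1 hy j).1 _

theorem sum_profileProb {y : Vec S} (hy : y ∈ strategySpace S) : ∑ p, profileProb y p = 1 := by
  classical
  have := (Finset.prod_univ_sum (fun j => (Finset.univ : Finset (S j))) fun j s => y j s).symm
  simp only [(mem_strategySpace.1 hy _).2, Finset.prod_const_one] at this
  rw [← this, Fintype.piFinset_univ]
  rfl

theorem le_one_of_mem {y : Vec S} (hy : y ∈ strategySpace S) (i : Fin N) (s : S i) : y i s ≤ 1 := by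
  rw [← (mem_strategySpace.1 hy i).2]
  exact Finset.single_le_sum (fun r _ => (mem_strategySpace.1 hy i).1 r) (Finset.mem_univ s)

theorem profileProb_le {y : Vec S} (hy : y ∈ strategySpace S) (p : Profile S) (i : Fin N) :
    profileProb y p ≤ y i (p i) := by
  unfold profileProb
  rw [← Finset.mul_prod_erase _ _ (Finset.mem_univ i)]
  refine mul_le_of_le_one_right ((mem_strategySpace.1 hy i).1 _) ?_
  exact Finset.prod_le_one (fun j _ => (mem_strategySpace.1 hy j).1 _)
    fun j _ => le_one_of_mem hy j _

/-- A mixed profile that puts at most `ε` on every strategy outside of the sets `A i`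
is close in mean to the profiles in `∏ i, A i`. -/
theorem mean_ge {y : Vec S} (hy : y ∈ strategySpace S) {A : ∀ i, Set (S i)} {ε r D : ℝ}
    (hε : 0 ≤ ε) (hA : ∀ i, ∀ s ∉ A i, y i s ≤ ε) {φ : Profile S → ℝ} (hD : 0 ≤ D)
    (h₁ : ∀ p, (∀ i, p i ∈ A i) → r ≤ φ p) (h₂ : ∀ p, r - D ≤ φ p) :
    r - Fintype.card (Profile S) * (D * ε) ≤ ∑ p, profileProb y p * φ p := by
  have : ∑ p, (profileProb y p * r - D * ε) ≤ ∑ p, profileProb y p * φ p := by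
    refine Finset.sum_le_sum fun p _ => ?_
    have h0 := profileProb_nonneg hy p
    by_cases hp : ∀ i, p i ∈ A i
    · have := mul_le_mul_of_nonneg_left (h₁ p hp) h0
      have := mul_nonneg hD hε
      linarith
    -- A profile with a coordinate outside of `A` has probability at most `ε`, and it costs at most
    -- `D` per unit of mass.
    · push Not at hp
      obtain ⟨i, hi⟩ := hp
      have h3 := (profileProb_le hy p i).trans (hA i _ hi)
      have := mul_le_mul_of_nonneg_left (h₂ p) h0
      nlinarith
  rw [Finset.sum_sub_distrib, ← Finset.sum_mul, sum_profileProb hy] at this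
  simpa using this

/-- A bound for the payoffs of a game. -/
noncomputable def payoffBound (u : Profile S → Fin N → ℝ) : ℝ := ∑ p, ‖payoffVec u p‖

theorem payoffBound_nonneg (u : Profile S → Fin N → ℝ) : 0 ≤ payoffBound u :=
  Finset.sum_nonneg fun _ _ => norm_nonneg _

theorem norm_payoffVec_le (u : Profile S → Fin N → ℝ) (p : Profile S) :
    ‖payoffVec u p‖ ≤ payoffBound u :=
  Finset.single_le_sum (f := fun p => ‖payoffVec u p‖) (fun _ _ => norm_nonneg _)
    (Finset.mem_univ p)

theorem norm_stratUtility_le (u : Profile S → Fin N → ℝ) {y : Vec S} (hy : y ∈ strategySpace S) :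
    ‖stratUtility u y‖ ≤ payoffBound u := by
  rw [stratUtility_eq_sum u hy]
  refine (norm_sum_le _ _).trans (Finset.sum_le_sum fun p _ => ?_)
  rw [norm_smul, Real.norm_of_nonneg (profileProb_nonneg hy p)]
  refine mul_le_of_le_one_left (norm_nonneg _) ?_
  rw [← sum_profileProb hy]
  exact Finset.single_le_sum (fun p _ => profileProb_nonneg hy p) (Finset.mem_univ p)

/-- The mixed profile in which everyone plays the pure profile `p`. -/
noncomputable def pureVec (p : Profile S) : Vec S := open Classical in fun i => Pi.single (p i) 1

theorem pureVec_mem {T : ∀ i, Set (S i)} {p : Profile S} (hp : ∀ i, p i ∈ T i) :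
    pureVec p ∈ subgameSpace T := by
  classical
  intro i
  refine ⟨?_, fun s hs => ?_⟩
  · unfold pureVec; convert! single_mem_stdSimplex ℝ (p i)
  · unfold pureVec
    rw [Pi.single_eq_of_ne]
    rintro rfl
    exact hs (hp i)

theorem stratUtility_pureVec (u : Profile S → Fin N → ℝ) (p : Profile S) :
    stratUtility u (pureVec p) = payoffVec u p := by
  classical
  rw [stratUtility_eq_sum u (subgameSpace_subset _ (pureVec_mem (T := fun i => {p i}) (by simp)))]
  rw [Finset.sum_eq_single p]
  · simp [profileProb, pureVec]
  · intro q _ hq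
    obtain ⟨i, hi⟩ := Function.ne_iff.1 hq
    have : profileProb (pureVec p) q = 0 :=
      Finset.prod_eq_zero (Finset.mem_univ i) (by simp [pureVec, hi])
    simp [this]
  · simp

end Mean

/-! ### Soft play: a common relaxation of both dynamics -/

section SoftPlay

variable {N : ℕ} {S : Fin N → Type v} [∀ i, Fintype (S i)]

/-- Absolutely continuous paths in payoff space along which the payoffs grow at the rates given by
mixed profiles that put weight at most `exp (w i s - w i r)` on the strategy `s`. Solutions of the
replicator and of the best-response dynamics are of this kind. -/
structure IsSoftPlay (u : Profile S → Fin N → ℝ) (T : ℝ) (w : ℝ → Vec S) : Prop where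
  abscont : AbsolutelyContinuousOnInterval w 0 T
  deriv : ∀ᵐ t, t ∈ Icc 0 T → ∃ y ∈ strategySpace S,
    (∀ i s r, y i s ≤ Real.exp (w t i s - w t i r)) ∧ HasDerivAt w (stratUtility u y) t

theorem AbsolutelyContinuousOnInterval.clm_comp {E : Type*} [NormedAddCommGroup E]
    [NormedSpace ℝ E] {w : ℝ → E} {a b : ℝ} (hw : AbsolutelyContinuousOnInterval w a b)
    (L : E →L[ℝ] ℝ) : AbsolutelyContinuousOnInterval (fun t => L (w t)) a b := by
  rw [absolutelyContinuousOnInterval_iff] at *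
  intro ε hε
  obtain ⟨δ, hδ, h⟩ := hw (ε / (‖L‖ + 1)) (by positivity)
  refine ⟨δ, hδ, fun E hE hE' => ?_⟩
  have h1 := h E hE hE'
  have h2 : ∑ i ∈ Finset.range E.1, dist (L (w (E.2 i).1)) (L (w (E.2 i).2))
      ≤ ‖L‖ * ∑ i ∈ Finset.range E.1, dist (w (E.2 i).1) (w (E.2 i).2) := by
    rw [Finset.mul_sum]
    exact Finset.sum_le_sum fun i _ => L.lipschitz.dist_le_mul _ _
  rw [lt_div_iff₀ (by positivity)] at h1
  have h3 : 0 ≤ ∑ i ∈ Finset.range E.1, dist (w (E.2 i).1) (w (E.2 i).2) :=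
    Finset.sum_nonneg fun _ _ => dist_nonneg
  nlinarith

/-- A lower bound for the increment of an absolutely continuous function. -/
theorem AbsolutelyContinuousOnInterval.integral_le_sub {f g : ℝ → ℝ} {a b : ℝ} (hab : a ≤ b)
    (hf : AbsolutelyContinuousOnInterval f a b) (hg : IntervalIntegrable g volume a b)
    (h : ∀ᵐ t, t ∈ Icc a b → ∃ d, HasDerivAt f d t ∧ g t ≤ d) :
    ∫ t in a..b, g t ≤ f b - f a := by
  rw [← hf.integral_deriv_eq_sub]
  refine intervalIntegral.integral_mono_ae_restrict hab hg hf.intervalIntegrable_deriv ?_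
  rw [Filter.EventuallyLE, ae_restrict_iff' measurableSet_Icc]
  filter_upwards [h] with t ht htI
  obtain ⟨d, hd, hgd⟩ := ht htI
  rwa [hd.deriv]

namespace IsSoftPlay

variable {u : Profile S → Fin N → ℝ} {T : ℝ} {w : ℝ → Vec S}

theorem continuousOn (hw : IsSoftPlay u T w) (hT : 0 ≤ T) : ContinuousOn w (Icc 0 T) := by
  have := hw.abscont.continuousOn
  rwa [uIcc_of_le hT] at this

/-- Lower bounds for the increments of linear functionals along soft play. -/
theorem integral_le (hw : IsSoftPlay u T w) {a b : ℝ} (ha : 0 ≤ a) (hab : a ≤ b) (hb : b ≤ T)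
    (L : Vec S →L[ℝ] ℝ) {g : ℝ → ℝ} (hg : IntervalIntegrable g volume a b)
    (h : ∀ t ∈ Icc a b, ∀ y ∈ strategySpace S,
      (∀ i s r, y i s ≤ Real.exp (w t i s - w t i r)) → g t ≤ L (stratUtility u y)) :
    ∫ t in a..b, g t ≤ L (w b) - L (w a) := by
  have hf : AbsolutelyContinuousOnInterval (fun t => L (w t)) a b :=
    AbsolutelyContinuousOnInterval.clm_comp (hw.abscont.mono (by
      rw [uIcc_of_le hab, uIcc_of_le (ha.trans (hab.trans hb))]
      exact Icc_subset_Icc ha hb)) L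
  refine AbsolutelyContinuousOnInterval.integral_le_sub hab hf hg ?_
  filter_upwards [hw.deriv] with t ht htI
  obtain ⟨y, hy, hsoft, hd⟩ := ht ⟨ha.trans htI.1, htI.2.trans hb⟩
  exact ⟨_, L.hasFDerivAt.comp_hasDerivAt t hd, h t htI y hy hsoft⟩

theorem mul_le (hw : IsSoftPlay u T w) {a b r : ℝ} (ha : 0 ≤ a) (hab : a ≤ b) (hb : b ≤ T)
    (L : Vec S →L[ℝ] ℝ)
    (h : ∀ t ∈ Icc a b, ∀ y ∈ strategySpace S,
      (∀ i s r, y i s ≤ Real.exp (w t i s - w t i r)) → r ≤ L (stratUtility u y)) :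
    r * (b - a) ≤ L (w b) - L (w a) := by
  have := hw.integral_le ha hab hb L (g := fun _ => r) (by simp) h
  simpa [mul_comm] using this

/-- Every linear functional is Lipschitz along soft play. -/
theorem abs_sub_le (hw : IsSoftPlay u T w) {a b : ℝ} (ha : 0 ≤ a) (hab : a ≤ b) (hb : b ≤ T)
    (L : Vec S →L[ℝ] ℝ) : |L (w b) - L (w a)| ≤ ‖L‖ * payoffBound u * (b - a) := by
  have key : ∀ L : Vec S →L[ℝ] ℝ, -(‖L‖ * payoffBound u) * (b - a) ≤ L (w b) - L (w a) := by
    intro L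
    refine hw.mul_le ha hab hb L fun t _ y hy _ => ?_
    have := (L.le_opNorm (stratUtility u y)).trans
      (mul_le_mul_of_nonneg_left (norm_stratUtility_le u hy) (norm_nonneg _))
    rw [Real.norm_eq_abs] at this
    exact (abs_le.1 this).1
  have h1 := key L
  have h2 := key (-L)
  simp only [norm_neg, neg_apply] at h2
  rw [abs_le]
  constructor <;> linarith

end IsSoftPlay

theorem apply_stratUtility (u : Profile S → Fin N → ℝ) {y : Vec S} (hy : y ∈ strategySpace S)
    (L : Vec S →L[ℝ] ℝ) :
    L (stratUtility u y) = ∑ p, profileProb y p * L (payoffVec u p) := by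
  rw [stratUtility_eq_sum u hy, map_sum]
  simp

theorem abs_apply_payoffVec_le (u : Profile S → Fin N → ℝ) (L : Vec S →L[ℝ] ℝ) (p : Profile S) :
    |L (payoffVec u p)| ≤ ‖L‖ * payoffBound u := by
  rw [← Real.norm_eq_abs]
  exact (L.le_opNorm _).trans (mul_le_mul_of_nonneg_left (norm_payoffVec_le u p) (norm_nonneg _))

/-- If the mixed profile `y` puts at most `ε` on every strategy outside of the sets `A i`, then
the rates of the payoffs under `y` are close to convex combinations of the rates at the pure
profiles in `∏ i, A i`. -/
theorem le_apply_stratUtility (u : Profile S → Fin N → ℝ) {y : Vec S} (hy : y ∈ strategySpace S)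
    {A : ∀ i, Set (S i)} {ε r : ℝ} (hε : 0 ≤ ε) (hA : ∀ i, ∀ s ∉ A i, y i s ≤ ε)
    (L : Vec S →L[ℝ] ℝ) (h : ∀ p, (∀ i, p i ∈ A i) → r ≤ L (payoffVec u p))
    (hne : ∃ p : Profile S, ∀ i, p i ∈ A i) :
    r - 2 * Fintype.card (Profile S) * ‖L‖ * payoffBound u * ε ≤ L (stratUtility u y) := by
  rw [apply_stratUtility u hy]
  have hD : 0 ≤ 2 * ‖L‖ * payoffBound u := by have := payoffBound_nonneg u; positivity
  obtain ⟨q, hq⟩ := hne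
  have := mean_ge hy hε hA (φ := fun p => L (payoffVec u p)) hD h (fun p => by
    have h1 := abs_le.1 (abs_apply_payoffVec_le u L p)
    have h2 := abs_le.1 (abs_apply_payoffVec_le u L q)
    have h3 := h q hq
    linarith)
  linarith

end SoftPlay

/-! ### Gordan's theorem of the alternative -/

section Gordan

/-- Gordan's theorem of the alternative. -/
theorem gordan_alternative {E J : Type*} [AddCommGroup E] [Module ℝ E] [Fintype J]
    (L : J → E →ₗ[ℝ] ℝ) :
    (∃ x, ∀ j, 0 < L j x) ∨
      ∃ β : J → ℝ, (∀ j, 0 ≤ β j) ∧ β ≠ 0 ∧ ∀ x, ∑ j, β j * L j x = 0 := by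
  classical
  by_cases hx : ∃ x, ∀ j, 0 < L j x
  · exact Or.inl hx
  right
  have hne : Nonempty J := by
    by_contra h
    rw [not_nonempty_iff] at h
    exact hx ⟨0, fun j => (h.false j).elim⟩
  have hP : Convex ℝ (Set.pi univ fun _ : J => Ioi (0 : ℝ)) := convex_pi fun _ _ => convex_Ioi 0
  have hO : IsOpen (Set.pi univ fun _ : J => Ioi (0 : ℝ)) :=
    isOpen_set_pi finite_univ fun _ _ => isOpen_Ioi
  have hV : Convex ℝ ((LinearMap.range (LinearMap.pi L) : Submodule ℝ (J → ℝ)) : Set (J → ℝ)) :=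
    Submodule.convex _
  -- If no `x` works, the open positive orthant misses the range of the joint map. The separating
  -- functional is bounded below on this linear subspace and hence vanishes there; its negated
  -- coordinates are the multipliers.
  obtain ⟨f, r, h₁, h₂⟩ := geometric_hahn_banach_open hP hO hV (by
    rw [Set.disjoint_left]
    rintro _ hv ⟨x, rfl⟩
    exact hx ⟨x, fun j => hv j (mem_univ j)⟩)
  have hr : r ≤ 0 := by simpa using h₂ 0 (Submodule.zero_mem _)
  have hf : ∀ x, f (LinearMap.pi L x) = 0 := by
    intro x
    by_contra h0
    have := h₂ (((r - 1) / f (LinearMap.pi L x)) • LinearMap.pi L x)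
      (Submodule.smul_mem _ _ ⟨x, rfl⟩)
    rw [map_smul, smul_eq_mul, div_mul_cancel₀ _ h0] at this
    linarith
  have hsum : ∀ v : J → ℝ, f v = ∑ j, v j * f (Pi.single j 1) := by
    intro v
    conv_lhs => rw [pi_eq_sum_univ' v]
    rw [map_sum]
    simp only [map_smul, smul_eq_mul]
  refine ⟨fun j => -f (Pi.single j 1), fun j => ?_, fun h => ?_, fun x => ?_⟩
  · rw [neg_nonneg]
    refine le_of_forall_pos_lt_add fun ε hε => ?_
    -- The basis vector lies only on the boundary of the orthant, so it is pushed inside by an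
    -- amount that changes `f` by less than `ε`.
    have h1 := h₁ (Pi.single j 1 + (ε / (|f 1| + 1)) • 1) (fun i _ => by
      have : (0 : J → ℝ) i ≤ Pi.single (M := fun _ => ℝ) j 1 i :=
        (Pi.single_nonneg.2 zero_le_one : (0 : J → ℝ) ≤ Pi.single j 1) i
      simp only [Pi.zero_apply] at this
      have h3 : 0 < ε / (|f 1| + 1) := by positivity
      simp only [mem_Ioi, Pi.add_apply, Pi.smul_apply, Pi.one_apply, smul_eq_mul, mul_one]
      linarith)
    rw [map_add, map_smul, smul_eq_mul] at h1
    have h2 : -ε < ε / (|f 1| + 1) * f 1 := by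
      rw [div_mul_eq_mul_div, lt_div_iff₀ (by positivity)]
      have := neg_abs_le (f 1)
      nlinarith
    linarith
  · have h1 := h₁ 1 (fun i _ => by simp)
    rw [hsum] at h1
    have : ∀ j, f (Pi.single j 1) = 0 := fun j => by simpa using congrFun h j
    simp only [this, mul_zero, Finset.sum_const_zero] at h1
    linarith
  · have := hf x
    rw [hsum] at this
    simp only [LinearMap.pi_apply] at this
    rw [← neg_eq_zero, ← Finset.sum_neg_distrib, ← this]
    exact Finset.sum_congr rfl fun j _ => by ring

theorem gordan_alternative_of_pred {E J : Type*} [AddCommGroup E] [Module ℝ E] [Fintype J]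
    (D : J → Prop) (L : J → E →ₗ[ℝ] ℝ) :
    (∃ x, ∀ j, D j → 0 < L j x) ∨
      ∃ β : J → ℝ, (∀ j, 0 ≤ β j) ∧ (∀ j, ¬ D j → β j = 0) ∧ β ≠ 0 ∧
        ∀ x, ∑ j, β j * L j x = 0 := by
  classical
  rcases gordan_alternative (fun j : {j // D j} => L j) with ⟨x, hx⟩ | ⟨β, h0, hne, hs⟩
  · exact Or.inl ⟨x, fun j hj => hx ⟨j, hj⟩⟩
  refine Or.inr ⟨fun j => if h : D j then β ⟨j, h⟩ else 0, fun j => ?_, fun j hj => by simp [hj],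
    fun h => hne ?_, fun x => ?_⟩
  · dsimp only
    split_ifs
    · exact h0 _
    · exact le_rfl
  · ext j
    simpa [j.2] using congrFun h j
  · rw [← Fintype.sum_subtype_add_sum_subtype D, Fintype.sum_eq_zero
      (fun j : {j // ¬ D j} => (if h : D j then β ⟨j, h⟩ else 0) * L j x) fun j => by simp [j.2],
      add_zero]
    refine Eq.trans (Finset.sum_congr rfl fun j _ => ?_) (hs x)
    simp [j.2]

end Gordan

/-! ### Gains, losses, return times, and the dual system -/

section Weights

variable {N : ℕ} {S : Fin N → Type v} {u : Profile S → Fin N → ℝ} {K : ℕ} {c : ZMod K → Profile S}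

/-- The loss of player `i` at the profile `p` from switching to the strategy `s`. -/
def loss (u : Profile S → Fin N → ℝ) (p : Profile S) (i : Fin N) (s : S i) : ℝ :=
  u p i - u (Function.update p i s) i

namespace IsSinkCycle

/-- The gain of the mover along the arc from `c k` to `c (k + 1)`. -/
noncomputable def gain (hc : IsSinkCycle u c) (k : ZMod K) : ℝ :=
  u (c (k + 1)) (hc.mover k) - u (c k) (hc.mover k)

theorem gain_pos (hc : IsSinkCycle u c) (hK : 2 < K) (k : ZMod K) : 0 < hc.gain k :=
  sub_pos.2 (hc.lt_succ hK k)

theorem loss_pos (hc : IsSinkCycle u c) {k : ZMod K} {i : Fin N} {s : S i} (h₀ : s ≠ c k i)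
    (h₁ : s ≠ c (k + 1) i) : 0 < loss u (c k) i s :=
  sub_pos.2 (hc.lt_of_ne h₀ h₁)

theorem loss_mover (hc : IsSinkCycle u c) (k : ZMod K) :
    loss u (c k) (hc.mover k) (c (k + 1) (hc.mover k)) = -hc.gain k := by
  rw [loss, hc.update_mover, gain]; ring

theorem loss_succ_mover (hc : IsSinkCycle u c) (k : ZMod K) :
    loss u (c (k + 1)) (hc.mover k) (c k (hc.mover k)) = hc.gain k := by
  rw [loss, hc.update_succ, Function.update_eq_self, gain]

theorem gain_lt_loss (hc : IsSinkCycle u c) {k : ZMod K} {s : S (hc.mover k)}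
    (h₀ : s ≠ c k (hc.mover k)) (h₁ : s ≠ c (k + 1) (hc.mover k)) :
    hc.gain k < loss u (c (k + 1)) (hc.mover k) s := by
  rw [loss, hc.update_succ, gain]
  have := hc.lt_of_ne h₀ h₁
  linarith

theorem gain_le_loss (hc : IsSinkCycle u c) {k : ZMod K} {s : S (hc.mover k)}
    (h₁ : s ≠ c (k + 1) (hc.mover k)) :
    hc.gain k ≤ loss u (c (k + 1)) (hc.mover k) s := by
  by_cases h₀ : s = c k (hc.mover k)
  · subst h₀; exact (hc.loss_succ_mover k).ge
  · exact (hc.gain_lt_loss h₀ h₁).le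

theorem exists_return (hc : IsSinkCycle u c) (hK : K ≠ 0) (k : ZMod K) :
    ∃ n : ℕ, hc.mover (k + 1 + n + 1) = hc.mover (k + 1) := by
  refine ⟨K - 1, ?_⟩
  have : k + 1 + ((K - 1 : ℕ) : ZMod K) + 1 = k + 1 := by
    rw [add_assoc (k + 1), ← Nat.cast_succ, Nat.succ_eq_add_one,
      Nat.sub_add_cancel (Nat.one_le_iff_ne_zero.2 hK), ZMod.natCast_self, add_zero]
  rw [this]

open Classical in
/-- After the move at `c (k + 1)`, the same player moves next at
`c (k + 1 + hc.returnTime hK k + 1)`. -/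
noncomputable def returnTime (hc : IsSinkCycle u c) (hK : K ≠ 0) (k : ZMod K) : ℕ :=
  Nat.find (hc.exists_return hK k)

theorem mover_returnTime (hc : IsSinkCycle u c) (hK : K ≠ 0) (k : ZMod K) :
    hc.mover (k + 1 + hc.returnTime hK k + 1) = hc.mover (k + 1) := by
  classical
  exact Nat.find_spec (hc.exists_return hK k)

theorem mover_ne_of_lt_returnTime (hc : IsSinkCycle u c) (hK : K ≠ 0) (k : ZMod K) {n : ℕ}
    (hn : n < hc.returnTime hK k) : hc.mover (k + 1 + n + 1) ≠ hc.mover (k + 1) := by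
  classical
  exact Nat.find_min (hc.exists_return hK k) hn

theorem returnTime_pos (hc : IsSinkCycle u c) (hK : 2 < K) (k : ZMod K) :
    0 < hc.returnTime (by omega) k := by
  rw [Nat.pos_iff_ne_zero]
  intro h
  have := hc.mover_returnTime (by omega) k
  rw [h, Nat.cast_zero, add_zero] at this
  exact hc.mover_succ_ne hK (k + 1) this

theorem apply_eq_of_le_returnTime (hc : IsSinkCycle u c) (hK : K ≠ 0) (k : ZMod K) :
    ∀ n : ℕ, n ≤ hc.returnTime hK k →
      c (k + 1 + n + 1) (hc.mover (k + 1)) = c (k + 1 + 1) (hc.mover (k + 1)) := by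
  intro n
  induction n with
  | zero => intro _; simp
  | succ n ih =>
    intro hn
    rw [← ih (by omega), Nat.cast_succ, ← add_assoc]
    exact hc.succ_of_ne (hc.mover_ne_of_lt_returnTime hK k (by omega)).symm

/-- If two starting points lead to the same return move, then both belong to the same player. The
one with the shorter waiting time is then a move within the waiting time of the other, against
minimality. -/
theorem returnTime_injective (hc : IsSinkCycle u c) (hK : K ≠ 0) :
    Function.Injective fun k : ZMod K => k + (hc.returnTime hK k : ZMod K) := by
  have key : ∀ k l : ZMod K, k + (hc.returnTime hK k : ZMod K) = l + hc.returnTime hK l →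
      hc.returnTime hK k < hc.returnTime hK l → False := by
    intro k l h hlt
    obtain ⟨n, hn⟩ := Nat.exists_eq_add_of_lt hlt
    have hk : k = l + (n : ℕ) + 1 := by
      rw [hn] at h
      push_cast at h
      have := add_right_cancel (b := (hc.returnTime hK k : ZMod K)) (a := k)
        (c := l + (n : ℕ) + 1) (by rw [h]; ring)
      exact this
    have h1 := hc.mover_returnTime hK k
    have h2 := hc.mover_returnTime hK l
    have e : k + 1 + (hc.returnTime hK k : ZMod K) = l + 1 + hc.returnTime hK l := by
      rw [add_right_comm, h, add_right_comm]
    rw [e, h2] at h1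
    refine hc.mover_ne_of_lt_returnTime hK l (n := n) (by omega) ?_
    rw [h1, hk]
    congr 1
    ring
  intro k l h
  dsimp only at h
  rcases lt_trichotomy (hc.returnTime hK k) (hc.returnTime hK l) with hlt | heq | hlt
  · exact (key k l h hlt).elim
  · rw [heq] at h; exact add_right_cancel h
  · exact (key l k h.symm hlt).elim

end IsSinkCycle

theorem eq_of_prod_eq {ι : Type*} [Fintype ι] {A B : ι → ℝ} (h : ∀ k, 0 < B k)
    (hle : ∀ k, B k ≤ A k) (hprod : ∏ k, A k = ∏ k, B k) (k : ι) : A k = B k := by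
  by_contra hne
  have := Finset.prod_lt_prod (s := Finset.univ) (fun i _ => h i) (fun i _ => hle i)
    ⟨k, Finset.mem_univ k, lt_of_le_of_ne (hle k) (Ne.symm hne)⟩
  exact this.ne hprod.symm

namespace IsSinkCycle

/-- A solution of the system of inequalities that is dual to the one in `exists_weights`
vanishes. -/
theorem dual_eq_zero [∀ i, Fintype (S i)] [NeZero K] (hc : IsSinkCycle u c) (hK : 4 < K)
    {β : ZMod K → ∀ i, S i → ℝ} (hβ : ∀ k i s, 0 ≤ β k i s)
    (hD : ∀ k i s, s = c (k + 1) i ∨ s = c (k + 1 + 1) i → β k i s = 0)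
    (h₁ : ∀ k i s, s ≠ c (k + 1) i → β (k + 1) i s * hc.gain (k + 1 + 1) ≤ β k i s * hc.gain (k + 1))
    (h₂ : ∀ k, ∑ i, ∑ s, β (k + 1) i s * loss u (c (k + 1 + 1)) i s ≤
      β k (hc.mover (k + 1 + 1)) (c (k + 1 + 1 + 1) (hc.mover (k + 1 + 1))) * hc.gain (k + 1)) :
    ∀ k i s, β k i s = 0 := by
  have hK0 : K ≠ 0 := by omega
  have hK2 : 2 < K := by omega
  -- This is the right-hand side of `h₂`: the multiplier of the strategy that the mover at `c (k +
  -- 2)` is about to adopt. If it vanishes for one `k`, then by `h₂` it vanishes for all, and with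
  -- it every `β`.
  set y : ZMod K → ℝ := fun k =>
    β k (hc.mover (k + 1 + 1)) (c (k + 1 + 1 + 1) (hc.mover (k + 1 + 1))) * hc.gain (k + 1) with hy
  have hpos : ∀ k i s, 0 ≤ β k i s * loss u (c (k + 1)) i s := by
    intro k i s
    by_cases h : s = c (k + 1) i ∨ s = c (k + 1 + 1) i
    · rw [hD k i s h, zero_mul]
    · push Not at h
      exact mul_nonneg (hβ k i s) (hc.loss_pos h.1 h.2).le
  have hy0 : ∀ k, 0 ≤ y k := fun k => mul_nonneg (hβ _ _ _) (hc.gain_pos hK2 _).le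
  -- a single term of the sum
  have hterm : ∀ k i s, β (k + 1) i s * loss u (c (k + 1 + 1)) i s ≤ y k := fun k i s =>
    ((Finset.single_le_sum (f := fun s => β (k + 1) i s * loss u (c (k + 1 + 1)) i s)
      (fun s _ => hpos _ i s) (Finset.mem_univ s)).trans
    (Finset.single_le_sum (f := fun i => ∑ s, β (k + 1) i s * loss u (c (k + 1 + 1)) i s)
      (fun i _ => Finset.sum_nonneg fun s _ => hpos _ i s) (Finset.mem_univ i))).trans (h₂ k)
  have hallowed : ∀ k, c (k + 1 + 1) (hc.mover (k + 1)) ≠ c k (hc.mover (k + 1)) ∧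
      c (k + 1 + 1) (hc.mover (k + 1)) ≠ c (k + 1) (hc.mover (k + 1)) := fun k =>
    ⟨by rw [← hc.mover_succ_eq hK2 k]; exact hc.succ_mover_ne (k + 1), hc.succ_mover_ne (k + 1)⟩
  have hloss : ∀ k, 0 < loss u (c (k + 1)) (hc.mover (k + 1 + 1))
      (c (k + 1 + 1 + 1) (hc.mover (k + 1 + 1))) := fun k =>
    hc.loss_pos (hallowed (k + 1)).1 (hallowed (k + 1)).2
  have hstep : ∀ k, y k = 0 → y (k + 1) = 0 := by
    intro k h
    have h3 := hterm k (hc.mover (k + 1 + 1 + 1)) (c (k + 1 + 1 + 1 + 1) (hc.mover (k + 1 + 1 + 1)))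
    rw [h] at h3
    have h4 := hloss (k + 1)
    have h5 := hβ (k + 1) (hc.mover (k + 1 + 1 + 1)) (c (k + 1 + 1 + 1 + 1) (hc.mover (k + 1 + 1 + 1)))
    have h6 : β (k + 1) (hc.mover (k + 1 + 1 + 1))
        (c (k + 1 + 1 + 1 + 1) (hc.mover (k + 1 + 1 + 1))) = 0 := by
      by_contra hne
      exact absurd h3 (not_le.2 (mul_pos (lt_of_le_of_ne h5 (Ne.symm hne)) h4))
    simp only [hy, h6, zero_mul]
  have hall : ∀ k, y k = 0 → ∀ l, y l = 0 := by
    intro k h l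
    have : ∀ n : ℕ, y (k + n) = 0 := by
      intro n
      induction n with
      | zero => simpa using h
      | succ n ih => rw [Nat.cast_succ, ← add_assoc]; exact hstep _ ih
    have h3 := this (l - k).val
    rwa [ZMod.natCast_zmod_val, add_sub_cancel] at h3
  by_cases hzero : ∃ k, y k = 0
  · obtain ⟨k₀, hk₀⟩ := hzero
    intro k i s
    by_cases h : s = c (k + 1) i ∨ s = c (k + 1 + 1) i
    · exact hD k i s h
    push Not at h
    have h3 := hterm (k - 1) i s
    rw [sub_add_cancel, hall k₀ hk₀] at h3
    by_contra hne
    exact absurd h3 (not_le.2 (mul_pos (lt_of_le_of_ne (hβ k i s) (Ne.symm hne))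
      (hc.loss_pos h.1 h.2)))
  exfalso
  push Not at hzero
  have hypos : ∀ k, 0 < y k := fun k => lt_of_le_of_ne (hy0 k) (Ne.symm (hzero k))
  -- the next target of the player who moves at `c (k + 1)`
  set q : ∀ k, S (hc.mover (k + 1)) := fun k =>
    c (k + 1 + hc.returnTime hK0 k + 1 + 1) (hc.mover (k + 1)) with hq
  have hqne : ∀ k, q k ≠ c (k + 1 + 1) (hc.mover (k + 1)) := by
    intro k
    have h3 := hc.succ_mover_ne (k + 1 + hc.returnTime hK0 k + 1)
    rw [hc.mover_returnTime hK0 k, hc.apply_eq_of_le_returnTime hK0 k _ le_rfl] at h3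
    exact h3
  have hmono : ∀ k, ∀ n : ℕ, n + 1 ≤ hc.returnTime hK0 k →
      β (k + 1 + n) (hc.mover (k + 1)) (q k) * hc.gain (k + 1 + n + 1) ≤
        β (k + 1) (hc.mover (k + 1)) (q k) * hc.gain (k + 1 + 1) := by
    intro k n
    induction n with
    | zero => intro _; simp
    | succ n ih =>
      intro hn
      refine le_trans ?_ (ih (by omega))
      rw [Nat.cast_succ, ← add_assoc]
      refine h₁ _ _ _ ?_
      rw [hc.apply_eq_of_le_returnTime hK0 k n (by omega)]
      exact hqne k
  -- Follow the next target `q k` of the mover at `c (k + 1)` until that player moves again.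
  -- Meanwhile the player stays at `c (k + 2)`, whose strategy differs from `q k`, so `h₁` applies
  -- at every step.
  have hlast : ∀ k, y (k + hc.returnTime hK0 k) ≤
      β (k + 1) (hc.mover (k + 1)) (q k) * hc.gain (k + 1 + 1) := by
    intro k
    obtain ⟨n, hn⟩ := Nat.exists_eq_succ_of_ne_zero (hc.returnTime_pos hK2 k).ne'
    have h3 := hmono k n hn.ge
    have e : k + (hc.returnTime hK0 k : ZMod K) = k + 1 + n := by
      rw [hn, Nat.cast_succ]; ring
    have e' : k + 1 + (n : ZMod K) + 1 + 1 = k + 1 + (hc.returnTime hK0 k : ZMod K) + 1 := by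
      rw [hn, Nat.cast_succ]; ring
    rw [e]
    simp only [hy]
    rw [e', hc.mover_returnTime hK0 k]
    exact h3
  -- Two losses are thrown away here: `loss` is replaced by the smaller `gain`, and all terms of the
  -- sum in `h₂` but that of `q k` are dropped. Both must turn out to be no loss at all.
  have hchain : ∀ k, hc.gain (k + 1) * y (k + hc.returnTime hK0 k) ≤ hc.gain (k + 1 + 1) * y k := by
    intro k
    have h3 := hterm k _ (q k)
    have h4 := hc.gain_le_loss (hqne k)
    have h5 := hlast k
    have h6 := hβ (k + 1) _ (q k)
    have h7 := hc.gain_pos hK2 (k + 1)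
    have h8 := hc.gain_pos hK2 (k + 1 + 1)
    calc _ ≤ hc.gain (k + 1) * (β (k + 1) (hc.mover (k + 1)) (q k) * hc.gain (k + 1 + 1)) := by gcongr
      _ = hc.gain (k + 1 + 1) * (β (k + 1) (hc.mover (k + 1)) (q k) * hc.gain (k + 1)) := by ring
      _ ≤ hc.gain (k + 1 + 1) * (β (k + 1) (hc.mover (k + 1)) (q k) *
          loss u (c (k + 1 + 1)) (hc.mover (k + 1)) (q k)) := by gcongr
      _ ≤ _ := by gcongr
  -- Both sides contain the same gains and the same values of `y`, permuted by a shift and by the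
  -- return map.
  have hprod : ∏ k, hc.gain (k + 1 + 1) * y k
      = ∏ k, hc.gain (k + 1) * y (k + hc.returnTime hK0 k) := by
    have e₁ : ∏ k : ZMod K, hc.gain (k + 1 + 1) = ∏ k : ZMod K, hc.gain (k + 1) :=
      Equiv.prod_comp (Equiv.addRight (1 : ZMod K)) fun k => hc.gain (k + 1)
    have e₂ : ∏ k, y (k + hc.returnTime hK0 k) = ∏ k, y k :=
      (Finite.injective_iff_bijective.1 (hc.returnTime_injective hK0)).prod_comp y
    rw [Finset.prod_mul_distrib (f := fun k => hc.gain (k + 1 + 1)) (g := y),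
      Finset.prod_mul_distrib (f := fun k => hc.gain (k + 1)), e₁, e₂]
  have heq := eq_of_prod_eq (fun k => mul_pos (hc.gain_pos hK2 _) (hypos _)) hchain hprod
  -- Equality of `loss` and `gain` means that the next target is the strategy just left.
  have hqeq : ∀ k, q k = c (k + 1) (hc.mover (k + 1)) := by
    intro k
    by_contra hne
    have h4 := hc.gain_lt_loss hne (hqne k)
    have h3 := hterm k _ (q k)
    have h5 := hlast k
    have h7 := hc.gain_pos hK2 (k + 1)
    have h8 := hc.gain_pos hK2 (k + 1 + 1)
    have h6 : 0 < β (k + 1) _ (q k) := by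
      by_contra! h
      have := hypos (k + hc.returnTime hK0 k)
      nlinarith
    have := heq k
    nlinarith [mul_lt_mul_of_pos_left h4 (mul_pos h8 h6), mul_le_mul_of_nonneg_left h5 h7.le,
      mul_le_mul_of_nonneg_left h3 h8.le]
  -- The term of the target at `c (k + 3)` is positive because `y (k + 1)` is. As `q k` already
  -- exhausts the sum, the two must be the same strategy of the same player.
  have htarget : ∀ k, (⟨hc.mover (k + 1 + 1 + 1), c (k + 1 + 1 + 1 + 1) (hc.mover (k + 1 + 1 + 1))⟩ :
      Σ i, S i) = ⟨hc.mover (k + 1), q k⟩ := by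
    intro k
    by_contra hne
    classical
    have h2 : β (k + 1) (hc.mover (k + 1 + 1 + 1))
          (c (k + 1 + 1 + 1 + 1) (hc.mover (k + 1 + 1 + 1))) * loss u (c (k + 1 + 1))
            (hc.mover (k + 1 + 1 + 1)) (c (k + 1 + 1 + 1 + 1) (hc.mover (k + 1 + 1 + 1))) +
        β (k + 1) (hc.mover (k + 1)) (q k) * loss u (c (k + 1 + 1)) (hc.mover (k + 1)) (q k)
          ≤ y k := by
      refine le_trans ?_ (h₂ k)
      rw [← Fintype.sum_sigma' (f := fun i s => β (k + 1) i s * loss u (c (k + 1 + 1)) i s)]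
      rw [← Finset.sum_pair (f := fun p : Σ i, S i =>
        β (k + 1) p.1 p.2 * loss u (c (k + 1 + 1)) p.1 p.2) hne]
      exact Finset.sum_le_sum_of_subset_of_nonneg (Finset.subset_univ _) fun p _ _ => hpos _ _ _
    have h3 := hypos (k + 1)
    have h4 := hc.gain_le_loss (hqne k)
    have h5 := hlast k
    have h7 := hc.gain_pos hK2 (k + 1)
    have h8 := hc.gain_pos hK2 (k + 1 + 1)
    have h6 := hβ (k + 1) _ (q k)
    have h9 := hloss (k + 1)
    have h10 : 0 < β (k + 1) (hc.mover (k + 1 + 1 + 1))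
          (c (k + 1 + 1 + 1 + 1) (hc.mover (k + 1 + 1 + 1))) := pos_of_mul_pos_left h3 h8.le
    have h11 := mul_pos h10 h9
    have := heq k
    nlinarith [mul_le_mul_of_nonneg_left h4 (mul_nonneg h8.le h6),
      mul_le_mul_of_nonneg_left h5 h7.le, mul_le_mul_of_nonneg_left h2 h8.le, mul_pos h8 h11]
  have hm : ∀ k, hc.mover (k + 1 + 1) = hc.mover k := by
    intro k
    have := congrArg Sigma.fst (htarget (k - 1))
    simpa using this
  refine hc.not_alternating hK hm fun k => ?_
  have h3 := htarget (k - 1)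
  rw [hqeq, sub_add_cancel, hm] at h3
  exact eq_of_heq (Sigma.mk.inj h3).2

end IsSinkCycle

end Weights

/-! ### Weights for the gaps, by duality -/

section Weights

variable {N : ℕ} {S : Fin N → Type v} {u : Profile S → Fin N → ℝ} {K : ℕ} {c : ZMod K → Profile S}

namespace IsSinkCycle

open Classical in
/-- The coordinate `(k, i, s)`, set to zero if `s` is the strategy of `i` in `c k`. -/
noncomputable def coordMap (c : ZMod K → Profile S) (k : ZMod K) (i : Fin N) (s : S i) :
    (ZMod K → (Σ i, S i) → ℝ) →ₗ[ℝ] ℝ :=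
  if s = c k i then 0 else
    (LinearMap.proj (R := ℝ) (φ := fun _ : Σ i, S i => ℝ) ⟨i, s⟩).comp
      (LinearMap.proj (R := ℝ) (φ := fun _ : ZMod K => (Σ i, S i) → ℝ) k)

/-- Weights for the gaps between the payoffs of the strategies at the profile `c (k + 1)`, upon
arrival from `c k`, that are improved by the play of `c (k + 1)` until the next move. -/
theorem exists_weights [∀ i, Fintype (S i)] (hc : IsSinkCycle u c) (hK : 4 < K) :
    ∃ α : ZMod K → ∀ i, S i → ℝ,
      (∀ k i s, s ≠ c k i → s ≠ c (k + 1) i → 0 < α k i s) ∧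
      (∀ k i, α k i (c k i) = 0) ∧
      ∀ k i s, s ≠ c (k + 1) i → s ≠ c (k + 1 + 1) i →
        α (k + 1) i s < α k i s + loss u (c (k + 1)) i s / hc.gain (k + 1) *
          α k (hc.mover (k + 1)) (c (k + 1 + 1) (hc.mover (k + 1))) := by
  classical
  have : NeZero K := ⟨by omega⟩
  have hK2 : 2 < K := by omega
  -- The left summand indexes the inequalities between consecutive weights, multiplied by the gain;
  -- the right one indexes positivity. `D` selects the required constraints, and the normalization
  -- of some weights to zero is built into `coordMap`.
  let J := (ZMod K × Σ i, S i) ⊕ (ZMod K × Σ i, S i)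
  let D : J → Prop := Sum.elim
    (fun j => j.2.2 ≠ c (j.1 + 1) j.2.1 ∧ j.2.2 ≠ c (j.1 + 1 + 1) j.2.1)
    (fun j => j.2.2 ≠ c j.1 j.2.1 ∧ j.2.2 ≠ c (j.1 + 1) j.2.1)
  let L : J → (ZMod K → (Σ i, S i) → ℝ) →ₗ[ℝ] ℝ := Sum.elim
    (fun j => hc.gain (j.1 + 1) • (coordMap c j.1 j.2.1 j.2.2 - coordMap c (j.1 + 1) j.2.1 j.2.2) +
      loss u (c (j.1 + 1)) j.2.1 j.2.2 •
        coordMap c j.1 (hc.mover (j.1 + 1)) (c (j.1 + 1 + 1) (hc.mover (j.1 + 1))))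
    (fun j => coordMap c j.1 j.2.1 j.2.2)
  rcases gordan_alternative_of_pred D L with ⟨x, hx⟩ | ⟨β, hβ, hD, hne, hs⟩
  · refine ⟨fun k i s => coordMap c k i s x, fun k i s h₀ h₁ => ?_, fun k i => ?_,
      fun k i s h₀ h₁ => ?_⟩
    · exact hx (Sum.inr (k, ⟨i, s⟩)) ⟨h₀, h₁⟩
    · simp [coordMap]
    · have := hx (Sum.inl (k, ⟨i, s⟩)) ⟨h₀, h₁⟩
      simp only [L, Sum.elim_inl, LinearMap.add_apply, LinearMap.smul_apply, LinearMap.sub_apply,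
        smul_eq_mul] at this
      have hg := hc.gain_pos hK2 (k + 1)
      rw [div_mul_eq_mul_div, ← sub_lt_iff_lt_add', lt_div_iff₀ hg]
      linarith
  exfalso
  have hval : ∀ k i s l (q : Σ i, S i), q.2 ≠ c l q.1 →
      coordMap c k i s (Pi.single l (Pi.single q 1)) =
        if k = l ∧ (⟨i, s⟩ : Σ i, S i) = q then 1 else 0 := by
    intro k i s l q hq
    unfold coordMap
    split_ifs with h₁ h₂ h₂
    · obtain ⟨rfl, rfl⟩ := h₂
      exact absurd h₁ hq
    · rfl
    · obtain ⟨rfl, rfl⟩ := h₂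
      simp
    · simp only [LinearMap.comp_apply, LinearMap.proj_apply, Pi.single_apply]
      by_cases hk : k = l
      · have : (⟨i, s⟩ : Σ i, S i) ≠ q := fun h => h₂ ⟨hk, h⟩
        simp [hk, this]
      · simp [hk]
  have hsingle : ∀ (f : ZMod K → (Σ i, S i) → ℝ) l q,
      ∑ k, ∑ p, f k p * (if k = l ∧ p = q then 1 else 0) = f l q := by
    intro f l q
    rw [Finset.sum_eq_single l, Finset.sum_eq_single q]
    · simp
    · intro p _ hp; simp [hp]
    · simp
    · intro k _ hk; simp [hk]
    · simp
  -- The coefficient of the weight at `(l + 1, i, s)` in the dual identity. The weight occurs with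
  -- its own index, as the successor of index `l`, and possibly as the weight of the next target.
  have heqn : ∀ l i s, s ≠ c (l + 1) i →
      β (Sum.inl (l + 1, ⟨i, s⟩)) * hc.gain (l + 1 + 1) - β (Sum.inl (l, ⟨i, s⟩)) * hc.gain (l + 1)
      + (if (⟨hc.mover (l + 1 + 1), c (l + 1 + 1 + 1) (hc.mover (l + 1 + 1))⟩ : Σ i, S i) = ⟨i, s⟩
          then ∑ p : Σ i, S i, β (Sum.inl (l + 1, p)) * loss u (c (l + 1 + 1)) p.1 p.2 else 0)
      + β (Sum.inr (l + 1, ⟨i, s⟩)) = 0 := by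
    intro l i s h
    have h0 := hs (Pi.single (l + 1) (Pi.single ⟨i, s⟩ 1))
    rw [Fintype.sum_sum_type, Fintype.sum_prod_type, Fintype.sum_prod_type] at h0
    simp only [L, Sum.elim_inl, Sum.elim_inr, LinearMap.add_apply, LinearMap.smul_apply,
      LinearMap.sub_apply, smul_eq_mul] at h0
    simp only [hval _ _ _ (l + 1) ⟨i, s⟩ h] at h0
    rw [hsingle (fun k p => β (Sum.inr (k, p)))] at h0
    refine Eq.trans ?_ h0
    congr 1
    have e : ∀ k (p : Σ i, S i), β (Sum.inl (k, p)) * (hc.gain (k + 1) *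
        ((if k = l + 1 ∧ (⟨p.1, p.2⟩ : Σ i, S i) = ⟨i, s⟩ then 1 else 0) -
          (if k + 1 = l + 1 ∧ (⟨p.1, p.2⟩ : Σ i, S i) = ⟨i, s⟩ then 1 else 0)) +
        loss u (c (k + 1)) p.1 p.2 * (if k = l + 1 ∧ (⟨hc.mover (k + 1),
          c (k + 1 + 1) (hc.mover (k + 1))⟩ : Σ i, S i) = ⟨i, s⟩ then 1 else 0))
        = (β (Sum.inl (k, p)) * hc.gain (k + 1)) * (if k = l + 1 ∧ p = ⟨i, s⟩ then 1 else 0)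
        - (β (Sum.inl (k, p)) * hc.gain (k + 1)) * (if k = l ∧ p = ⟨i, s⟩ then 1 else 0)
        + (if k = l + 1 then (if (⟨hc.mover (k + 1), c (k + 1 + 1) (hc.mover (k + 1))⟩ :
          Σ i, S i) = ⟨i, s⟩ then β (Sum.inl (k, p)) * loss u (c (k + 1)) p.1 p.2 else 0)
          else 0) := by
      intro k p
      simp only [add_left_inj, Sigma.eta]
      by_cases hk : k = l + 1
      · simp only [hk, true_and, if_true]
        split_ifs <;> ring
      · simp only [hk, false_and, if_false]
        ring
    rw [Finset.sum_congr rfl fun k _ => Finset.sum_congr rfl fun p _ => e k p]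
    simp only [Finset.sum_add_distrib, Finset.sum_sub_distrib]
    rw [hsingle (fun k p => β (Sum.inl (k, p)) * hc.gain (k + 1)),
      hsingle (fun k p => β (Sum.inl (k, p)) * hc.gain (k + 1))]
    congr 1
    rw [Finset.sum_eq_single (l + 1)]
    · simp only [if_true]
      split_ifs
      · rfl
      · simp
    · intro k _ hk; simp [hk]
    · simp
  have hinl : ∀ k i s, β (Sum.inl (k, ⟨i, s⟩)) = 0 := by
    refine hc.dual_eq_zero hK (β := fun k i s => β (Sum.inl (k, ⟨i, s⟩))) (fun k i s => hβ _)
      (fun k i s h => hD _ fun h' => ?_) (fun k i s h => ?_) fun k => ?_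
    · rcases h with h | h
      · exact h'.1 h
      · exact h'.2 h
    · have h1 := heqn k i s h
      have h2 := hβ (Sum.inr (k + 1, ⟨i, s⟩))
      have h3 : 0 ≤ (if (⟨hc.mover (k + 1 + 1), c (k + 1 + 1 + 1) (hc.mover (k + 1 + 1))⟩ :
          Σ i, S i) = ⟨i, s⟩ then ∑ p : Σ i, S i, β (Sum.inl (k + 1, p)) *
            loss u (c (k + 1 + 1)) p.1 p.2 else 0) := by
        split_ifs
        · refine Finset.sum_nonneg fun p _ => ?_
          by_cases hp : D (Sum.inl (k + 1, p))
          · exact mul_nonneg (hβ _) (hc.loss_pos hp.1 hp.2).le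
          · rw [hD _ hp, zero_mul]
        · exact le_rfl
      linarith
    · have h1 := heqn k (hc.mover (k + 1 + 1)) (c (k + 1 + 1 + 1) (hc.mover (k + 1 + 1))) (by
        rw [← hc.mover_succ_eq hK2 (k + 1)]; exact hc.succ_mover_ne (k + 1 + 1))
      rw [if_pos rfl] at h1
      have h2 := hβ (Sum.inr (k + 1, ⟨hc.mover (k + 1 + 1), c (k + 1 + 1 + 1) (hc.mover (k + 1 + 1))⟩))
      have h3 : 0 ≤ β (Sum.inl (k + 1, ⟨hc.mover (k + 1 + 1),
          c (k + 1 + 1 + 1) (hc.mover (k + 1 + 1))⟩)) * hc.gain (k + 1 + 1) :=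
        mul_nonneg (hβ _) (hc.gain_pos hK2 _).le
      rw [Fintype.sum_sigma] at h1
      dsimp only at h1 ⊢
      linarith
  refine hne (funext fun j => ?_)
  rcases j with ⟨k, ⟨i, s⟩⟩ | ⟨k, ⟨i, s⟩⟩
  · exact hinl k i s
  · by_cases hj : D (Sum.inr (k, ⟨i, s⟩))
    · have h1 := heqn (k - 1) i s (by rw [sub_add_cancel]; exact hj.1)
      simpa [hinl] using h1
    · exact hD _ hj

end IsSinkCycle

end Weights

/-! ### Level systems: functionals that grow along the edges -/

section Levels

variable {N : ℕ} {S : Fin N → Type v} {u : Profile S → Fin N → ℝ} {K : ℕ} {c : ZMod K → Profile S}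

/-- At the point `w` of payoff space, all strategies that are not used in the profiles `c k` and
`c (k + 1)` are worse than the better one of those by at least `h`. -/
def NearEdge (c : ZMod K → Profile S) (k : ZMod K) (h : ℝ) (w : Vec S) : Prop :=
  ∀ i s, s ≠ c k i → s ≠ c (k + 1) i → h ≤ max (w i (c k i)) (w i (c (k + 1) i)) - w i s

/-- The sets of points of payoff space at which the functionals `x.2`, `x ∈ I`, take values of at
least `m * x.1`. -/
def HasLevel (I : Set (ℝ × (Vec S →L[ℝ] ℝ))) (m : ℝ) (w : Vec S) : Prop :=
  ∀ x ∈ I, m * x.1 ≤ x.2 w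

namespace IsSinkCycle

/-- The gap between the strategies of the mover at `c (k + 1)` before and after the move. -/
noncomputable def moveGap (hc : IsSinkCycle u c) (k : ZMod K) : Vec S →L[ℝ] ℝ :=
  gap (hc.mover (k + 1)) (c (k + 1) (hc.mover (k + 1))) (c (k + 1 + 1) (hc.mover (k + 1)))

theorem gap_payoffVec_pos (hc : IsSinkCycle u c) (hK : 2 < K) {k : ZMod K} {i : Fin N} {s : S i}
    (hs : s ≠ c (k + 1) i) : 0 < gap i (c (k + 1) i) s (payoffVec u (c k)) :=
  sub_pos.2 (hc.best_reply hK hs)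

theorem gap_payoffVec_self (u : Profile S → Fin N → ℝ) (p : Profile S) (i : Fin N) (s : S i) :
    gap i (p i) s (payoffVec u p) = loss u p i s := by
  simp [payoffVec, loss]

theorem moveGap_payoffVec_self (hc : IsSinkCycle u c) (k : ZMod K) :
    hc.moveGap k (payoffVec u (c (k + 1))) = -hc.gain (k + 1) := by
  rw [moveGap, gap_payoffVec_self, hc.loss_mover]

theorem ne_of_succ_mover (hc : IsSinkCycle u c) (hK : 2 < K) (k : ZMod K) :
    c (k + 1 + 1) (hc.mover (k + 1)) ≠ c k (hc.mover (k + 1)) := by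
  rw [← hc.mover_succ_eq hK k]; exact hc.succ_mover_ne (k + 1)

/-- Systems of functionals on payoff space whose levels increase along the cycle. -/
structure LevelSystem (hc : IsSinkCycle u c) where
  /-- thresholds and functionals -/
  I : ZMod K → Set (ℝ × (Vec S →L[ℝ] ℝ))
  /-- the fraction of the level that bounds the gaps -/
  δ : ℝ
  δ_pos : 0 < δ
  finite : ∀ k, (I k).Finite
  nonneg : ∀ k, ∀ x ∈ I k, 0 ≤ x.1
  exists_pos : ∀ k, ∃ x ∈ I k, 0 < x.1
  rate_pos : ∀ k, ∀ x ∈ I k, 0 < x.2 (payoffVec u (c k)) ∧ 0 < x.2 (payoffVec u (c (k + 1)))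
  step : ∀ k m w, 0 < m → HasLevel (I k) m w → hc.moveGap k w < δ * m →
    HasLevel (I (k + 1)) ((1 + δ) * m) w
  nearEdge : ∀ k m w, 0 < m → HasLevel (I k) m w → δ * m ≤ hc.moveGap k w →
    NearEdge c k (δ * m) w
  of_nearEdge : ∀ k m w, 0 < m → NearEdge c k m w → ∃ l, HasLevel (I l) (δ * m) w
  moveGap_of_level : ∀ k m w, 0 < m → HasLevel (I k) m w →
    w (hc.mover k) (c (k + 1) (hc.mover k)) = w (hc.mover k) (c k (hc.mover k)) →
    δ * m ≤ hc.moveGap k w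
  of_gaps : ∀ k m w, 0 < m → (∀ i s, s ≠ c (k + 1) i → m ≤ w i (c (k + 1) i) - w i s) →
    HasLevel (I k) (δ * m) w

/-- The inequality for the weights is strict, so it survives when the slope `loss / gain` is
replaced by a slightly smaller `κ`. With this slope the sum of a gap and `κ` times `moveGap` still
strictly increases at `c (k + 1)`, where `moveGap` decreases at rate `gain`. -/
theorem exists_slopes [∀ i, Fintype (S i)] (hc : IsSinkCycle u c) (hK : 4 < K) :
    ∃ α κ : ZMod K → ∀ i, S i → ℝ,
      (∀ k i s, s ≠ c k i → s ≠ c (k + 1) i → 0 < α k i s) ∧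
      (∀ k i, α k i (c k i) = 0) ∧
      (∀ k i s, 0 < κ k i s) ∧
      ∀ k i s, s ≠ c (k + 1) i → s ≠ c (k + 1 + 1) i →
        κ k i s * hc.gain (k + 1) < loss u (c (k + 1)) i s ∧
        α (k + 1) i s < α k i s + κ k i s *
          α k (hc.mover (k + 1)) (c (k + 1 + 1) (hc.mover (k + 1))) := by
  obtain ⟨α, h₁, h₂, h₃⟩ := hc.exists_weights hK
  have hK2 : 2 < K := by omega
  have : ∀ k i s, ∃ κ : ℝ, 0 < κ ∧ (s ≠ c (k + 1) i → s ≠ c (k + 1 + 1) i →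
        κ * hc.gain (k + 1) < loss u (c (k + 1)) i s ∧
        α (k + 1) i s < α k i s + κ *
          α k (hc.mover (k + 1)) (c (k + 1 + 1) (hc.mover (k + 1)))) := by
    intro k i s
    by_cases hs : s ≠ c (k + 1) i ∧ s ≠ c (k + 1 + 1) i
    · have hR : 0 < loss u (c (k + 1)) i s / hc.gain (k + 1) :=
        div_pos (hc.loss_pos hs.1 hs.2) (hc.gain_pos hK2 _)
      have hlt := h₃ k i s hs.1 hs.2
      have hg := hc.gain_pos hK2 (k + 1)
      have hτ : 0 < α k (hc.mover (k + 1)) (c (k + 1 + 1) (hc.mover (k + 1))) :=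
        h₁ _ _ _ (hc.ne_of_succ_mover hK2 k) (hc.succ_mover_ne _)
      set R := loss u (c (k + 1)) i s / hc.gain (k + 1) with hRdef
      have hloss : loss u (c (k + 1)) i s = R * hc.gain (k + 1) := by
        rw [hRdef, div_mul_cancel₀ _ hg.ne']
      set A := α k (hc.mover (k + 1)) (c (k + 1 + 1) (hc.mover (k + 1)))
      have h4 : (α (k + 1) i s - α k i s) / A < R := by
        rw [div_lt_iff₀ hτ]; linarith
      obtain ⟨κ, hκ₁, hκ₂⟩ := exists_between (max_lt hR h4)
      rw [max_lt_iff] at hκ₁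
      refine ⟨κ, hκ₁.1, fun _ _ => ⟨?_, ?_⟩⟩
      · rw [hloss]; exact mul_lt_mul_of_pos_right hκ₂ hg
      · have := hκ₁.2
        rw [div_lt_iff₀ hτ] at this
        linarith
    · exact ⟨1, one_pos, fun h h' => absurd ⟨h, h'⟩ hs⟩
  choose κ hκ₁ hκ₂ using this
  exact ⟨α, κ, h₁, h₂, hκ₁, hκ₂⟩

/-- Two kinds of functionals are used: the gap of `s` below `c (k + 1)` with threshold `α`, and this
gap plus `κ * moveGap` with threshold `α + κ * A`, where `A` is the weight of the next target. The
second kind predicts the gap at the moment when `moveGap` reaches zero, which makes it possible to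
pass to the next index. A small `δ` absorbs the error of passing when `moveGap` is small but not
zero. -/
theorem exists_levelSystem [∀ i, Fintype (S i)] (hc : IsSinkCycle u c) (hK : 4 < K) :
    Nonempty hc.LevelSystem := by
  obtain ⟨α, κ, h₁, h₂, hκ, h₃⟩ := hc.exists_slopes hK
  have hK2 : 2 < K := by omega
  have : NeZero K := ⟨by omega⟩
  set A : ZMod K → ℝ := fun k => α k (hc.mover (k + 1)) (c (k + 1 + 1) (hc.mover (k + 1))) with hA
  have hτ₁ := hc.ne_of_succ_mover hK2
  have hτ₂ := fun k : ZMod K => hc.succ_mover_ne (k + 1)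
  have hApos : ∀ k, 0 < A k := fun k => h₁ _ _ _ (hτ₁ k) (hτ₂ k)
  -- all requirements on the small parameter `δ`
  have hδ : ∀ᶠ δ in 𝓝[>] (0 : ℝ), ∀ k i s,
      (s ≠ c (k + 1) i → s ≠ c (k + 1 + 1) i →
        (1 + δ) * α (k + 1) i s ≤ α k i s + κ k i s * A k - (κ k i s + 1) * δ) ∧
      ((1 + δ) * (κ (k + 1) i s * A (k + 1)) + δ ≤ κ (k + 1) i s *
        ((α k (hc.mover (k + 1 + 1)) (c (k + 1 + 1 + 1) (hc.mover (k + 1 + 1))) +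
          κ k (hc.mover (k + 1 + 1)) (c (k + 1 + 1 + 1) (hc.mover (k + 1 + 1))) * A k) -
          (κ k (hc.mover (k + 1 + 1)) (c (k + 1 + 1 + 1) (hc.mover (k + 1 + 1))) + 1) * δ)) ∧
      (s ≠ c k i → s ≠ c (k + 1) i → δ ≤ α k i s) ∧
      δ * (α k i s + κ k i s * A k) ≤ 1 ∧ δ * α k i s ≤ 1 ∧ δ * A k ≤ 1 ∧ δ ≤ A k := by
    simp only [eventually_all, eventually_and]
    have key : ∀ f g : ℝ → ℝ, Continuous f → Continuous g → f 0 < g 0 →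
        ∀ᶠ δ in 𝓝[>] (0 : ℝ), f δ ≤ g δ := by
      intro f g hf hg h
      exact (((hf.tendsto 0).eventually_lt (hg.tendsto 0) h).filter_mono
        nhdsWithin_le_nhds).mono fun _ h => h.le
    intro k i s
    refine ⟨fun ha hb => key _ _ (by fun_prop) (by fun_prop) ?_,
      key _ _ (by fun_prop) (by fun_prop) ?_,
      fun ha hb => key _ _ (by fun_prop) (by fun_prop) (h₁ k i s ha hb),
      key _ _ (by fun_prop) (by fun_prop) (by simp), key _ _ (by fun_prop) (by fun_prop) (by simp),
      key _ _ (by fun_prop) (by fun_prop) (by simp),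
      key _ _ (by fun_prop) (by fun_prop) (hApos k)⟩
    · simpa using (h₃ k i s ha hb).2
    · have := (h₃ k _ _ (hτ₁ (k + 1)) (hτ₂ (k + 1))).2
      simp only [add_zero, one_mul, mul_zero, sub_zero]
      exact mul_lt_mul_of_pos_left this (hκ _ _ _)
  obtain ⟨δ, hδ', hδ0⟩ := (hδ.and self_mem_nhdsWithin).exists
  replace hδ0 : 0 < δ := hδ0
  set J₁ : ZMod K → (Σ i, S i) → ℝ × (Vec S →L[ℝ] ℝ) := fun k p =>
    (α k p.1 p.2 + κ k p.1 p.2 * A k, gap p.1 (c (k + 1) p.1) p.2 + κ k p.1 p.2 • hc.moveGap k)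
    with hJ₁
  set J₂ : ZMod K → (Σ i, S i) → ℝ × (Vec S →L[ℝ] ℝ) := fun k p =>
    (α k p.1 p.2, gap p.1 (c (k + 1) p.1) p.2) with hJ₂
  set I : ZMod K → Set (ℝ × (Vec S →L[ℝ] ℝ)) := fun k =>
    J₁ k '' {p | p.2 ≠ c (k + 1) p.1 ∧ p.2 ≠ c (k + 1 + 1) p.1} ∪
    J₂ k '' {p | p.2 ≠ c k p.1 ∧ p.2 ≠ c (k + 1) p.1 ∧ p.2 ≠ c (k + 1 + 1) p.1} with hI
  have hlevel : ∀ k m w, HasLevel (I k) m w ↔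
      (∀ i s, s ≠ c (k + 1) i → s ≠ c (k + 1 + 1) i → m * (α k i s + κ k i s * A k) ≤
        w i (c (k + 1) i) - w i s + κ k i s * hc.moveGap k w) ∧
      ∀ i s, s ≠ c k i → s ≠ c (k + 1) i → s ≠ c (k + 1 + 1) i →
        m * α k i s ≤ w i (c (k + 1) i) - w i s := by
    intro k m w
    constructor
    · intro h
      exact ⟨fun i s ha hb => h _ (Or.inl ⟨⟨i, s⟩, ⟨ha, hb⟩, rfl⟩),
        fun i s ha hb hd => h _ (Or.inr ⟨⟨i, s⟩, ⟨ha, hb, hd⟩, rfl⟩)⟩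
    · rintro ⟨ha, hb⟩ x (⟨p, hp, rfl⟩ | ⟨p, hp, rfl⟩)
      · exact ha _ _ hp.1 hp.2
      · exact hb _ _ hp.1 hp.2.1 hp.2.2
  -- the gaps with respect to consecutive profiles
  have hgap : ∀ k i s (w : Vec S), w i (c (k + 1 + 1) i) - w i s = w i (c (k + 1) i) - w i s ∨
      w i (c (k + 1 + 1) i) - w i s = w i (c (k + 1) i) - w i s - hc.moveGap k w := by
    intro k i s w
    by_cases hi : i = hc.mover (k + 1)
    · right; subst hi; simp [moveGap]
    · left; rw [hc.succ_of_ne hi]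
  have hsuff : ∀ k m w, 0 < m → (∀ i s, s ≠ c (k + 1) i → m ≤ w i (c (k + 1) i) - w i s) →
      HasLevel (I k) (δ * m) w := by
    intro k m w hm h
    have hmove : m ≤ hc.moveGap k w := h _ _ (hτ₂ k)
    rw [hlevel]
    refine ⟨fun i s ha hb => ?_, fun i s ha hb hd => ?_⟩
    · have h5 := (hδ' k i s).2.2.2.1
      have h6 := h i s ha
      have h7 := mul_nonneg (hκ k i s).le (hm.le.trans hmove)
      nlinarith
    · have h5 := (hδ' k i s).2.2.2.2.1
      have h6 := h i s hb
      nlinarith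
  refine ⟨⟨I, δ, hδ0, ?_, ?_, ?_, ?_, ?_, ?_, ?_, ?_, hsuff⟩⟩
  · exact fun k => ((Set.toFinite _).image _).union ((Set.toFinite _).image _)
  · have hα : ∀ k i s, s ≠ c (k + 1) i → 0 ≤ α k i s := by
      intro k i s hs
      by_cases h : s = c k i
      · subst h; rw [h₂]
      · exact (h₁ k i s h hs).le
    rintro k x (⟨p, hp, rfl⟩ | ⟨p, hp, rfl⟩)
    · exact add_nonneg (hα _ _ _ hp.1) (mul_pos (hκ _ _ _) (hApos k)).le
    · exact hα _ _ _ hp.2.1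
  · intro k
    refine ⟨J₁ k ⟨hc.mover k, c k (hc.mover k)⟩, Or.inl ⟨_, ⟨(hc.succ_mover_ne k).symm, ?_⟩, rfl⟩, ?_⟩
    · dsimp only
      rw [hc.succ_succ_mover hK2]; exact (hc.succ_mover_ne k).symm
    · simp only [hJ₁, h₂, zero_add]
      exact mul_pos (hκ _ _ _) (hApos k)
  · have hm1 : ∀ k, 0 < hc.moveGap k (payoffVec u (c k)) := fun k =>
      hc.gap_payoffVec_pos hK2 (hτ₂ k)
    rintro k x (⟨p, hp, rfl⟩ | ⟨p, hp, rfl⟩)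
    · constructor
      · exact add_pos (hc.gap_payoffVec_pos hK2 hp.1) (mul_pos (hκ _ _ _) (hm1 k))
      · have h5 : J₁ k p = (α k p.1 p.2 + κ k p.1 p.2 * A k,
          gap p.1 (c (k + 1) p.1) p.2 + κ k p.1 p.2 • hc.moveGap k) := rfl
        rw [h5]
        simp only [add_apply, smul_apply, smul_eq_mul, hc.moveGap_payoffVec_self,
          gap_payoffVec_self]
        have := (h₃ k p.1 p.2 hp.1 hp.2).1
        linarith
    · refine ⟨hc.gap_payoffVec_pos hK2 hp.2.1, ?_⟩
      have h5 : (J₂ k p).2 = gap p.1 (c (k + 1) p.1) p.2 := rfl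
      rw [h5, gap_payoffVec_self]
      exact hc.loss_pos hp.2.1 hp.2.2
  · intro k m w hm h ht
    rw [hlevel] at h ⊢
    -- Dropping `κ * moveGap` costs at most `κ * δ * m`, and replacing the reference profile by the
    -- next one costs at most another `δ * m`.
    have hQ : ∀ i s, s ≠ c (k + 1) i → s ≠ c (k + 1 + 1) i →
        m * (α k i s + κ k i s * A k - (κ k i s + 1) * δ) ≤ w i (c (k + 1 + 1) i) - w i s := by
      intro i s ha hb
      have h5 := h.1 i s ha hb
      have h6 := hκ k i s
      rcases le_total 0 (hc.moveGap k w) with h7 | h7 <;>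
        rcases hgap k i s w with h8 | h8 <;> nlinarith [mul_pos hm hδ0, mul_pos h6 (mul_pos hm hδ0)]
    refine ⟨fun i s ha hb => ?_, fun i s ha hb hd => ?_⟩
    · have h5 := hQ _ _ (hτ₁ (k + 1)) (hτ₂ (k + 1))
      have h5' : m * (α k (hc.mover (k + 1 + 1)) (c (k + 1 + 1 + 1) (hc.mover (k + 1 + 1))) +
          κ k (hc.mover (k + 1 + 1)) (c (k + 1 + 1 + 1) (hc.mover (k + 1 + 1))) * A k -
          (κ k (hc.mover (k + 1 + 1)) (c (k + 1 + 1 + 1) (hc.mover (k + 1 + 1))) + 1) * δ) ≤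
          hc.moveGap (k + 1) w := h5
      have h6 := hκ (k + 1) i s
      -- The strategy just left has weight zero at the new index. Its gap is `-moveGap`, which can
      -- be slightly negative; the contribution of the new `moveGap` makes up for this.
      by_cases hs : s = c (k + 1) i
      · have hi : i = hc.mover (k + 1) := hc.eq_mover (by rw [← hs]; exact ha.symm)
        have h7 : w i (c (k + 1 + 1) i) - w i s = -hc.moveGap k w := by
          subst hs; subst hi; simp [moveGap]
        have h8 := (hδ' k i s).2.1
        rw [h7, hs, h₂, zero_add, ← hs]
        nlinarith [mul_le_mul_of_nonneg_left h5' h6.le, mul_le_mul_of_nonneg_left h8 hm.le]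
      · have h7 := hQ i s hs ha
        have h8 := (hδ' k i s).1 hs ha
        have h9 := (hδ' k _ _).1 (hτ₁ (k + 1)) (hτ₂ (k + 1))
        nlinarith [mul_le_mul_of_nonneg_left h5' h6.le, mul_le_mul_of_nonneg_left h8 hm.le,
          mul_le_mul_of_nonneg_left (mul_le_mul_of_nonneg_left h9 hm.le) h6.le]
    · have h7 := hQ i s ha hb
      have h8 := (hδ' k i s).1 ha hb
      nlinarith [mul_le_mul_of_nonneg_left h8 hm.le]
  · intro k m w hm h ht i s ha hb
    rw [hlevel] at h
    refine le_trans ?_ (sub_le_sub_right (le_max_right _ _) _)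
    by_cases hs : s = c (k + 1 + 1) i
    · have hi : i = hc.mover (k + 1) := hc.eq_mover (by rw [← hs]; exact hb)
      subst hs; subst hi; exact ht
    · have h7 := h.2 i s ha hb hs
      have h8 := (hδ' k i s).2.2.1 ha hb
      nlinarith
  · intro k m w hm h
    rcases le_total 0 (w (hc.mover k) (c (k + 1) (hc.mover k)) - w (hc.mover k) (c k (hc.mover k)))
      with h0 | h0
    · refine ⟨k, ?_⟩
      have hmax : ∀ i, max (w i (c k i)) (w i (c (k + 1) i)) = w i (c (k + 1) i) := by
        intro i
        by_cases hi : i = hc.mover k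
        · subst hi; exact max_eq_right (sub_nonneg.1 h0)
        · rw [hc.succ_of_ne hi, max_self]
      replace h : ∀ i s, s ≠ c k i → s ≠ c (k + 1) i → m ≤ w i (c (k + 1) i) - w i s :=
        fun i s ha hb => hmax i ▸ h i s ha hb
      have hmove : m ≤ hc.moveGap k w := h _ _ (hτ₁ k) (hτ₂ k)
      rw [hlevel]
      refine ⟨fun i s ha hb => ?_, fun i s ha hb hd => ?_⟩
      · have h6 := hκ k i s
        by_cases hs : s = c k i
        · have hi : i = hc.mover k := hc.eq_mover (by rw [← hs]; exact ha.symm)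
          have h7 : 0 ≤ w i (c (k + 1) i) - w i s := by subst hs; subst hi; exact h0
          have h8 := (hδ' k i s).2.2.2.2.2.1
          rw [hs, h₂, zero_add, ← hs]
          nlinarith [mul_le_mul_of_nonneg_left h8 (mul_nonneg hm.le h6.le),
            mul_le_mul_of_nonneg_left hmove h6.le]
        · have h7 := h i s hs ha
          have h8 := (hδ' k i s).2.2.2.1
          nlinarith [mul_nonneg h6.le (hm.le.trans hmove)]
      · have h7 := h i s ha hb
        have h8 := (hδ' k i s).2.2.2.2.1
        nlinarith
    -- When the start of the edge is still the better end, the point counts as a point of the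
    -- preceding index, with the present edge as the coming move.
    · obtain ⟨l, rfl⟩ : ∃ l, k = l + 1 := ⟨k - 1, by ring⟩
      refine ⟨l, ?_⟩
      have hmove : 0 ≤ hc.moveGap l w := by simp only [moveGap, gap_apply]; linarith
      have hg : ∀ i s, s ≠ c (l + 1) i → s ≠ c (l + 1 + 1) i → m ≤ w i (c (l + 1) i) - w i s := by
        intro i s ha hb
        have h7 := h i s ha hb
        rwa [max_eq_left] at h7
        by_cases hi : i = hc.mover (l + 1)
        · subst hi; exact sub_nonpos.1 h0
        · rw [hc.succ_of_ne hi]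
      rw [hlevel]
      refine ⟨fun i s ha hb => ?_, fun i s ha hb hd => ?_⟩
      · have h6 := hκ l i s
        have h7 := hg i s ha hb
        have h8 := (hδ' l i s).2.2.2.1
        nlinarith [mul_nonneg h6.le hmove]
      · have h7 := hg i s hb hd
        have h8 := (hδ' l i s).2.2.2.2.1
        nlinarith
  · intro k m w hm h h0
    rw [hlevel] at h
    -- At a tie the strategy just left has gap and weight zero, so its predicted-gap inequality
    -- bounds `moveGap` itself from below by `m * A k`.
    have h5 := h.1 (hc.mover k) (c k (hc.mover k)) (hc.succ_mover_ne k).symm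
      (by rw [hc.succ_succ_mover hK2]; exact (hc.succ_mover_ne k).symm)
    rw [h₂, zero_add, h0, sub_self, zero_add] at h5
    have h6 := hκ k (hc.mover k) (c k (hc.mover k))
    have h7 := (hδ' k (hc.mover k) (c k (hc.mover k))).2.2.2.2.2.2
    have h8 : m * A k ≤ hc.moveGap k w := by
      by_contra! hlt
      nlinarith [mul_lt_mul_of_pos_left hlt h6]
    nlinarith

end IsSinkCycle

end Levels

/-! ### Linear growth of the level along soft play -/

section Growth

variable {N : ℕ} {S : Fin N → Type v} {u : Profile S → Fin N → ℝ} {K : ℕ} {c : ZMod K → Profile S}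

theorem NearEdge.mono {k : ZMod K} {h h' : ℝ} {w : Vec S} (hw : NearEdge c k h w) (hh : h' ≤ h) :
    NearEdge c k h' w :=
  fun i s ha hb => hh.trans (hw i s ha hb)

theorem HasLevel.mono {I : Set (ℝ × (Vec S →L[ℝ] ℝ))} {m m' : ℝ} {w : Vec S}
    (hI : ∀ x ∈ I, 0 ≤ x.1) (h : HasLevel I m w) (hm : m' ≤ m) : HasLevel I m' w :=
  fun x hx => (mul_le_mul_of_nonneg_right hm (hI x hx)).trans (h x hx)

theorem IsSinkCycle.eq_or_eq_of_mem (hc : IsSinkCycle u c) {k : ZMod K} {p : Profile S}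
    (hp : ∀ i, p i ∈ ({c k i, c (k + 1) i} : Set (S i))) : p = c k ∨ p = c (k + 1) := by
  have h : ∀ i, i ≠ hc.mover k → p i = c k i := by
    intro i hi
    have := hp i
    rw [hc.succ_of_ne hi] at this
    simpa using this
  rcases hp (hc.mover k) with h0 | h0
  · left
    ext i
    by_cases hi : i = hc.mover k
    · subst hi; exact h0
    · exact h i hi
  · right
    ext i
    by_cases hi : i = hc.mover k
    · subst hi; exact h0
    · rw [h i hi, hc.succ_of_ne hi]

theorem NearEdge.eventually [Finite (Σ i, S i)] {w : ℝ → Vec S} {s : Set ℝ} {t : ℝ} (hw : ContinuousWithinAt w s t)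
    {k : ZMod K} {h h' : ℝ} (hh : h' < h) (hk : NearEdge c k h (w t)) :
    ∀ᶠ t' in 𝓝[s] t, NearEdge c k h' (w t') := by
  have : ∀ p : Σ i, S i, ∀ᶠ t' in 𝓝[s] t, p.2 ≠ c k p.1 → p.2 ≠ c (k + 1) p.1 →
      h' ≤ max (w t' p.1 (c k p.1)) (w t' p.1 (c (k + 1) p.1)) - w t' p.1 p.2 := by
    intro p
    by_cases hp : p.2 ≠ c k p.1 ∧ p.2 ≠ c (k + 1) p.1
    · have hcont : ContinuousWithinAt (fun t' => max (w t' p.1 (c k p.1))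
          (w t' p.1 (c (k + 1) p.1)) - w t' p.1 p.2) s t := by
        have h : Continuous fun v : Vec S => max (v p.1 (c k p.1)) (v p.1 (c (k + 1) p.1)) -
          v p.1 p.2 := by fun_prop
        exact h.continuousAt.comp_continuousWithinAt hw
      have h1 : h' < _ := hh.trans_le (hk _ _ hp.1 hp.2)
      filter_upwards [hcont.eventually (eventually_gt_nhds h1)] with t' ht' _ _
      exact ht'.le
    · exact Eventually.of_forall fun _ ha hb => absurd ⟨ha, hb⟩ hp
  filter_upwards [eventually_all.2 this] with t' ht' i s ha hb
  exact ht' ⟨i, s⟩ ha hb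

/-- As long as `moveGap` is small, one can pass to the next index and multiply the level by `1 + δ`.
This cannot continue forever, since finitely many functionals with positive thresholds have bounded
values at `w`. -/
theorem IsSinkCycle.LevelSystem.exists_good [NeZero K] {hc : IsSinkCycle u c}
    (Λ : hc.LevelSystem) {k : ZMod K} {m : ℝ}
    {w : Vec S} (hm : 0 < m) (h : HasLevel (Λ.I k) m w) :
    ∃ l, HasLevel (Λ.I l) m w ∧ Λ.δ * m ≤ hc.moveGap l w := by
  by_contra! hno
  have hδ := Λ.δ_pos
  have hn : ∀ n : ℕ, HasLevel (Λ.I (k + n)) ((1 + Λ.δ) ^ n * m) w := by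
    intro n
    induction n with
    | zero => simpa using h
    | succ n ih =>
      have h1 : 1 ≤ (1 + Λ.δ) ^ n := one_le_pow₀ (by linarith)
      have h2 : m ≤ (1 + Λ.δ) ^ n * m := le_mul_of_one_le_left hm.le h1
      have h3 := hno _ (ih.mono (Λ.nonneg _) h2)
      have h4 := Λ.step _ _ w (hm.trans_le h2) ih
        (h3.trans_le (mul_le_mul_of_nonneg_left h2 hδ.le))
      rw [Nat.cast_succ, ← add_assoc, pow_succ', mul_assoc]
      exact h4
  choose x hx hx0 using Λ.exists_pos
  obtain ⟨C, hC⟩ := (Set.finite_range fun l => (x l).2 w / (x l).1).bddAbove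
  have hb : ∀ n : ℕ, (1 + Λ.δ) ^ n * m ≤ C := fun n =>
    ((le_div_iff₀ (hx0 _)).2 (hn n _ (hx _))).trans (hC ⟨k + n, rfl⟩)
  obtain ⟨n, hn'⟩ := ((tendsto_pow_atTop_atTop_of_one_lt (r := 1 + Λ.δ) (by linarith)).atTop_mul_const
    hm).eventually_gt_atTop C |>.exists
  exact absurd (hb n) (not_le.2 hn')

variable [∀ i, Fintype (S i)]

/-- The rate of growth of a functional near an edge of the cycle. -/
theorem IsSinkCycle.le_apply_of_nearEdge (hc : IsSinkCycle u c) {k : ZMod K} {h r : ℝ} {w : Vec S}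
    (hw : NearEdge c k h w) {y : Vec S} (hy : y ∈ strategySpace S)
    (hsoft : ∀ i s r, y i s ≤ Real.exp (w i s - w i r)) (L : Vec S →L[ℝ] ℝ)
    (h₀ : r ≤ L (payoffVec u (c k))) (h₁ : r ≤ L (payoffVec u (c (k + 1)))) :
    r - 2 * Fintype.card (Profile S) * ‖L‖ * payoffBound u * Real.exp (-h) ≤
      L (stratUtility u y) := by
  refine le_apply_stratUtility u hy (A := fun i => {c k i, c (k + 1) i}) (Real.exp_pos _).le
    (fun i s hs => ?_) L (fun p hp => ?_) ⟨c k, fun i => by simp⟩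
  · simp only [mem_insert_iff, mem_singleton_iff, not_or] at hs
    have := hw i s hs.1 hs.2
    rcases max_choice (w i (c k i)) (w i (c (k + 1) i)) with h | h <;> rw [h] at this
    · exact (hsoft i s (c k i)).trans (Real.exp_le_exp.2 (by linarith))
    · exact (hsoft i s (c (k + 1) i)).trans (Real.exp_le_exp.2 (by linarith))
  · rcases hc.eq_or_eq_of_mem hp with rfl | rfl
    · exact h₀
    · exact h₁

/-- Near an edge only its two ends carry more than exponentially small weight, so a functional that
increases at both ends increases along the whole edge. -/
theorem IsSinkCycle.eventually_rate (hc : IsSinkCycle u c) (k : ZMod K) (L : Vec S →L[ℝ] ℝ)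
    (h₀ : 0 < L (payoffVec u (c k))) (h₁ : 0 < L (payoffVec u (c (k + 1)))) :
    ∀ᶠ r in 𝓝[>] (0 : ℝ), ∀ᶠ h in atTop, ∀ w, NearEdge c k h w → ∀ y ∈ strategySpace S,
      (∀ i s r, y i s ≤ Real.exp (w i s - w i r)) → r ≤ L (stratUtility u y) := by
  set r₀ := min (L (payoffVec u (c k))) (L (payoffVec u (c (k + 1)))) with hr₀
  have hpos : 0 < r₀ := lt_min h₀ h₁
  filter_upwards [nhdsWithin_le_nhds (eventually_lt_nhds hpos)] with r hr
  have : Tendsto (fun h : ℝ => r₀ - 2 * Fintype.card (Profile S) * ‖L‖ * payoffBound u *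
      Real.exp (-h)) atTop (𝓝 (r₀ - 2 * Fintype.card (Profile S) * ‖L‖ * payoffBound u * 0)) :=
    tendsto_const_nhds.sub ((Real.tendsto_exp_neg_atTop_nhds_zero).const_mul _)
  rw [mul_zero, sub_zero] at this
  filter_upwards [this.eventually (eventually_gt_nhds hr)] with h hh w hw y hy hsoft
  exact hh.le.trans (hc.le_apply_of_nearEdge hw hy hsoft L (min_le_left _ _) (min_le_right _ _))

/-- The level along soft play increases at a linear rate. -/
theorem IsSinkCycle.LevelSystem.growth [NeZero K] {hc : IsSinkCycle u c} (Λ : hc.LevelSystem) :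
    ∃ M > 0, ∃ η > 0, ∀ T w, IsSoftPlay u T w → ∀ m₀, M ≤ m₀ → ∀ l, HasLevel (Λ.I l) m₀ (w 0) →
      ∀ t ∈ Icc 0 T, ∃ k, HasLevel (Λ.I k) (m₀ + η * t) (w t) ∧
        Λ.δ * (m₀ + η * t) ≤ hc.moveGap k (w t) := by
  have hδ := Λ.δ_pos
  have h₁ : ∀ᶠ r in 𝓝[>] (0 : ℝ), ∀ k, ∀ x ∈ Λ.I k, ∀ᶠ h in atTop, ∀ w, NearEdge c k h w →
      ∀ y ∈ strategySpace S, (∀ i s r, y i s ≤ Real.exp (w i s - w i r)) →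
        r ≤ x.2 (stratUtility u y) :=
    eventually_all.2 fun k => (eventually_all_finite (Λ.finite k)).2 fun x hx =>
      hc.eventually_rate k x.2 (Λ.rate_pos k x hx).1 (Λ.rate_pos k x hx).2
  obtain ⟨r, hr, hr0⟩ := (h₁.and self_mem_nhdsWithin).exists
  replace hr0 : 0 < r := hr0
  have h₂ : ∀ᶠ h in atTop, ∀ k, ∀ x ∈ Λ.I k, ∀ w, NearEdge c k h w →
      ∀ y ∈ strategySpace S, (∀ i s r, y i s ≤ Real.exp (w i s - w i r)) →
        r ≤ x.2 (stratUtility u y) :=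
    eventually_all.2 fun k => (eventually_all_finite (Λ.finite k)).2 fun x hx => hr k x hx
  obtain ⟨H, hH⟩ := (h₂.and (eventually_gt_atTop 0)).exists
  have h₃ : ∀ᶠ η in 𝓝[>] (0 : ℝ), ∀ k, ∀ x ∈ Λ.I k, η * x.1 ≤ r := by
    refine eventually_all.2 fun k => (eventually_all_finite (Λ.finite k)).2 fun x hx => ?_
    have : Tendsto (fun η : ℝ => η * x.1) (𝓝 0) (𝓝 (0 * x.1)) := tendsto_id.mul_const _
    rw [zero_mul] at this
    exact nhdsWithin_le_nhds ((this.eventually (eventually_lt_nhds hr0)).mono fun _ h => h.le)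
  obtain ⟨η, hη, hη0⟩ := (h₃.and self_mem_nhdsWithin).exists
  replace hη0 : 0 < η := hη0
  -- This makes the distance `δ * m₀` at least `2 * H`, strictly above the `H` at which the rates
  -- are valid, so they persist for a short time.
  refine ⟨2 * H / Λ.δ, div_pos (by linarith) hδ, η, hη0, ?_⟩
  intro T w hw m₀ hm₀ l hl t ht
  have hT : 0 ≤ T := ht.1.trans ht.2
  have hm₀' : 0 < m₀ := (div_pos (by linarith : 0 < 2 * H) hδ).trans_le hm₀
  have hcont := hw.continuousOn hT
  have hpos : ∀ t, 0 ≤ t → 0 < m₀ + η * t := fun t ht => by positivity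
  -- Continuous induction. The index is switched to a good one at each time; for a short while
  -- afterwards all its functionals grow at rate at least `r`, which is at least `η` times each
  -- threshold.
  have hG : Icc 0 T ⊆ {t | ∃ k, HasLevel (Λ.I k) (m₀ + η * t) (w t)} := by
    refine IsClosed.Icc_subset_of_forall_exists_gt ?_ ⟨l, by simpa using hl⟩ ?_
    · have : {t | ∃ k, HasLevel (Λ.I k) (m₀ + η * t) (w t)} ∩ Icc 0 T =
          ⋃ k, Icc 0 T ∩ ⋂ x ∈ Λ.I k, {t ∈ Icc 0 T | (m₀ + η * t) * x.1 ≤ x.2 (w t)} := by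
        ext t
        simp only [HasLevel, mem_inter_iff, mem_ofPred_eq, mem_iUnion, mem_iInter]
        constructor
        · rintro ⟨⟨k, h⟩, ht⟩; exact ⟨k, ht, fun x hx => ⟨ht, h x hx⟩⟩
        · rintro ⟨k, ht, h⟩; exact ⟨⟨k, fun x hx => (h x hx).2⟩, ht⟩
      rw [this]
      refine isClosed_iUnion_of_finite fun k => isClosed_Icc.inter <| isClosed_biInter fun x _ => ?_
      exact isClosed_Icc.isClosed_le (by fun_prop) (x.2.continuous.comp_continuousOn hcont)
    · rintro t ⟨⟨k, hk⟩, htI⟩ y hy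
      obtain ⟨l, hl, hgap⟩ := Λ.exists_good (hpos t htI.1) hk
      have hnear := Λ.nearEdge l _ _ (hpos t htI.1) hl hgap
      have hH' : H < Λ.δ * (m₀ + η * t) := by
        rw [div_le_iff₀ hδ] at hm₀
        have := mul_nonneg hδ.le (mul_nonneg hη0.le htI.1)
        linarith [hH.2]
      have hev := NearEdge.eventually (hcont t ⟨htI.1, htI.2.le⟩) hH' hnear
      obtain ⟨ε, hε, hball⟩ := Metric.mem_nhdsWithin_iff.1 hev
      have hlt : t < min (t + ε / 2) (min y T) := lt_min (by linarith) (lt_min hy htI.2)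
      refine ⟨min (t + ε / 2) (min y T), ⟨l, fun x hx => ?_⟩, hlt,
        (min_le_right _ _).trans (min_le_left _ _)⟩
      set t' := min (t + ε / 2) (min y T)
      have ht'T : t' ≤ T := (min_le_right _ _).trans (min_le_right _ _)
      have ht'ε : t' ≤ t + ε / 2 := min_le_left _ _
      have h6 := hw.mul_le (r := r) htI.1 hlt.le ht'T x.2 (fun τ hτ y hy hsoft =>
        hH.1 l x hx (w τ) (hball ⟨by
          rw [Metric.mem_ball, Real.dist_eq, abs_lt]
          constructor <;> linarith [hτ.1, hτ.2], htI.1.trans hτ.1, hτ.2.trans ht'T⟩) y hy hsoft)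
      have h7 := hl x hx
      have h8 := hη l x hx
      nlinarith [mul_le_mul_of_nonneg_right h8 (sub_nonneg.2 hlt.le)]
  obtain ⟨k, hk⟩ := hG ht
  exact Λ.exists_good (hpos t ht.1) hk

/-- Near the edges of a cycle of length greater than four, soft play approaches the edges at a
linear rate in payoff space. -/
theorem IsSinkCycle.exists_growth (hc : IsSinkCycle u c) (hK : 4 < K) :
    ∃ M > 0, ∃ δ > 0, ∀ T w, IsSoftPlay u T w → ∀ m, M ≤ m → ∀ l, NearEdge c l m (w 0) →
      ∀ t ∈ Icc 0 T, ∃ k, NearEdge c k (δ * (m + t)) (w t) := by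
  have : NeZero K := ⟨by omega⟩
  obtain ⟨Λ⟩ := hc.exists_levelSystem hK
  obtain ⟨M, hM, η, hη, h⟩ := Λ.growth
  have hδ := Λ.δ_pos
  refine ⟨M / Λ.δ, by positivity, Λ.δ * min Λ.δ η, by positivity, ?_⟩
  intro T w hw m hm l hl t ht
  have hm0 : 0 < m := (div_pos hM hδ).trans_le hm
  obtain ⟨l', hl'⟩ := Λ.of_nearEdge l m _ hm0 hl
  obtain ⟨k, hk, hgap⟩ := h T w hw (Λ.δ * m) (by rwa [div_le_iff₀' hδ] at hm) l' hl' t ht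
  have h0 : 0 < Λ.δ * m + η * t := add_pos_of_pos_of_nonneg (by positivity)
    (mul_nonneg hη.le ht.1)
  refine ⟨k, (Λ.nearEdge k _ _ h0 hk hgap).mono ?_⟩
  rw [mul_assoc]
  refine mul_le_mul_of_nonneg_left ?_ hδ.le
  have h1 := mul_le_mul_of_nonneg_right (min_le_left Λ.δ η) hm0.le
  have h2 := mul_le_mul_of_nonneg_right (min_le_right Λ.δ η) ht.1
  linarith

end Growth

/-! ### Global existence for bounded smooth vector fields -/

section GlobalSolutions

/-- A bounded vector field of class `C¹` has global integral curves. -/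
theorem exists_global_integralCurve {E : Type*} [NormedAddCommGroup E] [NormedSpace ℝ E]
    [FiniteDimensional ℝ E] {f : E → E} (hf : ContDiff ℝ 1 f) {C : ℝ} (hC : ∀ x, ‖f x‖ ≤ C)
    (x₀ : E) : ∃ α : ℝ → E, α 0 = x₀ ∧ ∀ t, HasDerivAt α (f (α t)) t := by
  have : ProperSpace E := FiniteDimensional.proper ℝ E
  have hC0 : 0 ≤ C := (norm_nonneg _).trans (hC x₀)
  have hlip : ∀ R : ℝ, ∃ L : NNReal, LipschitzOnWith L f (Metric.closedBall x₀ R) := fun R =>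
    hf.contDiffOn.exists_lipschitzOnWith one_ne_zero (convex_closedBall _ _)
      (isCompact_closedBall _ _)
  have hlocal : ∀ n : ℕ, ∃ α : ℝ → E, α 0 = x₀ ∧
      ∀ t ∈ Icc (-(n + 1 : ℝ)) (n + 1), HasDerivWithinAt α (f (α t)) (Icc (-(n + 1 : ℝ)) (n + 1)) t := by
    intro n
    have hn : (0 : ℝ) ≤ n + 1 := by positivity
    obtain ⟨L, hL⟩ := hlip (C * (n + 1))
    -- A curve with speed at most `C` stays within distance `C * (n + 1)` up to time `n + 1`, so
    -- this ball works with any Lipschitz constant.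
    have hpl : IsPicardLindelof (fun _ => f) (tmin := -(n + 1 : ℝ)) (tmax := n + 1)
        ⟨0, by constructor <;> linarith⟩ x₀ ⟨C * (n + 1), by positivity⟩ 0 ⟨C, hC0⟩ L :=
      IsPicardLindelof.of_time_independent (fun x _ => hC x) hL (by
        show C * max ((n : ℝ) + 1 - 0) (0 - -((n : ℝ) + 1)) ≤ C * (n + 1) - 0
        simp)
    exact hpl.exists_eq_forall_mem_Icc_hasDerivWithinAt₀
  choose α hα₀ hα using hlocal
  have hderiv : ∀ n : ℕ, ∀ t ∈ Ioo (-(n + 1 : ℝ)) (n + 1), HasDerivAt (α n) (f (α n t)) t :=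
    fun n t ht => (hα n t (Ioo_subset_Icc_self ht)).hasDerivAt (Icc_mem_nhds ht.1 ht.2)
  have huniq : ∀ m n : ℕ, m ≤ n → ∀ t ∈ Ioo (-(m + 1 : ℝ)) (m + 1), α m t = α n t := by
    intro m n hmn t ht
    have hmn' : (m : ℝ) ≤ n := Nat.cast_le.2 hmn
    have hsub : Icc (-(m + 1 : ℝ)) (m + 1) ⊆ Icc (-(n + 1 : ℝ)) (n + 1) :=
      Icc_subset_Icc (by linarith) (by linarith)
    have hcm : ContinuousOn (α m) (Icc (-(m + 1 : ℝ)) (m + 1)) :=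
      fun t ht => (hα m t ht).continuousWithinAt
    have hcn : ContinuousOn (α n) (Icc (-(m + 1 : ℝ)) (m + 1)) :=
      fun t ht => ((hα n t (hsub ht)).continuousWithinAt).mono hsub
    obtain ⟨R₁, hR₁⟩ := (isCompact_Icc.image_of_continuousOn hcm).isBounded.subset_closedBall x₀
    obtain ⟨R₂, hR₂⟩ := (isCompact_Icc.image_of_continuousOn hcn).isBounded.subset_closedBall x₀
    obtain ⟨L, hL⟩ := hlip (max R₁ R₂)
    have hm0 : (0 : ℝ) ≤ m := m.cast_nonneg
    refine ODE_solution_unique_of_mem_Ioo (v := fun _ => f) (s := fun _ =>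
      Metric.closedBall x₀ (max R₁ R₂)) (K := L) (t₀ := 0) (fun _ _ => hL)
      ⟨by linarith, by linarith⟩ (fun t ht => ⟨hderiv m t ht, ?_⟩) (fun t ht => ⟨hderiv n t
        ⟨by linarith [ht.1], by linarith [ht.2]⟩, ?_⟩) (by rw [hα₀, hα₀]) ht
    · exact Metric.closedBall_subset_closedBall (le_max_left _ _)
        (hR₁ (mem_image_of_mem _ (Ioo_subset_Icc_self ht)))
    · exact Metric.closedBall_subset_closedBall (le_max_right _ _)
        (hR₂ (mem_image_of_mem _ (Ioo_subset_Icc_self ht)))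
  -- The local solutions agree where both are defined, so near `t` this glued curve is a single
  -- solution on a slightly larger interval.
  refine ⟨fun t => α ⌈|t|⌉₊ t, by simp [hα₀], fun t => ?_⟩
  have hmem : ∀ t : ℝ, t ∈ Ioo (-(⌈|t|⌉₊ + 1 : ℝ)) (⌈|t|⌉₊ + 1) := fun t =>
    abs_lt.1 ((Nat.le_ceil _).trans_lt (lt_add_one _))
  have heq : (fun t => α ⌈|t|⌉₊ t) =ᶠ[𝓝 t] α (⌈|t|⌉₊ + 1) := by
    have h1 : ∀ᶠ t' in 𝓝 t, |t'| < |t| + 1 :=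
      continuous_abs.continuousAt.eventually (eventually_lt_nhds (lt_add_one _))
    filter_upwards [h1] with t' ht'
    refine huniq _ _ ?_ t' (hmem t')
    rw [Nat.ceil_le]
    push_cast
    exact ht'.le.trans (add_le_add_left (Nat.le_ceil _) 1)
  have h2 := hderiv (⌈|t|⌉₊ + 1) t ⟨by push_cast; linarith [(hmem t).1],
    by push_cast; linarith [(hmem t).2]⟩
  have h3 := h2.congr_of_eventuallyEq heq
  rwa [← heq.eq_of_nhds] at h3

end GlobalSolutions

/-! ### Replicator orbits from payoff space, including the boundary -/

section WeightedSoftmax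

variable {N : ℕ} {S : Fin N → Type v} [∀ i, Fintype (S i)]

/-- Softmax with weights `b`. -/
noncomputable def weightedSoftmax (b w : Vec S) : Vec S :=
  fun i s => b i s * Real.exp (w i s) / ∑ r, b i r * Real.exp (w i r)

/-- Nonnegative weights, not all zero for any player. -/
def IsWeight (b : Vec S) : Prop := ∀ i, (∀ s, 0 ≤ b i s) ∧ ∃ s, 0 < b i s

theorem IsWeight.sum_pos {b : Vec S} (hb : IsWeight b) (w : Vec S) (i : Fin N) :
    0 < ∑ r, b i r * Real.exp (w i r) := by
  obtain ⟨s, hs⟩ := (hb i).2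
  exact Finset.sum_pos' (fun r _ => mul_nonneg ((hb i).1 r) (Real.exp_pos _).le)
    ⟨s, Finset.mem_univ s, mul_pos hs (Real.exp_pos _)⟩

theorem weightedSoftmax_mem {b : Vec S} (hb : IsWeight b) (w : Vec S) :
    weightedSoftmax b w ∈ strategySpace S := by
  refine mem_strategySpace.2 fun i => ⟨fun s => ?_, ?_⟩
  · exact div_nonneg (mul_nonneg ((hb i).1 s) (Real.exp_pos _).le) (hb.sum_pos w i).le
  · simp only [weightedSoftmax]
    rw [← Finset.sum_div, div_self (hb.sum_pos w i).ne']

theorem softmax_eq (w : Vec S) : softmax w = weightedSoftmax (fun _ _ => 1) w := by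
  ext i s; simp [softmax, weightedSoftmax]

theorem isWeight_of_mem {x : Vec S} (hx : x ∈ strategySpace S) : IsWeight x := by
  intro i
  have h := mem_strategySpace.1 hx i
  refine ⟨h.1, ?_⟩
  by_contra! hn
  have : ∑ s, x i s ≤ 0 := Finset.sum_nonpos fun s _ => hn s
  linarith [h.2]

theorem contDiff_weightedSoftmax {b : Vec S} (hb : IsWeight b) (i : Fin N) (s : S i) :
    ContDiff ℝ 1 fun w => weightedSoftmax b w i s := by
  unfold weightedSoftmax
  have hc : ∀ r : S i, ContDiff ℝ 1 fun w : Vec S => b i r * Real.exp (w i r) := fun r =>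
    contDiff_const.mul (Real.contDiff_exp.comp
      ((ContinuousLinearMap.proj (R := ℝ) (φ := fun _ : S i => ℝ) r).comp
        (ContinuousLinearMap.proj (R := ℝ) (φ := fun i => S i → ℝ) i)).contDiff)
  exact (hc s).div (ContDiff.sum fun r _ => hc r) fun w => (hb.sum_pos w i).ne'

theorem contDiff_stratUtility_weightedSoftmax (u : Profile S → Fin N → ℝ) {b : Vec S}
    (hb : IsWeight b) : ContDiff ℝ 1 fun w => stratUtility u (weightedSoftmax b w) := by
  have : (fun w => stratUtility u (weightedSoftmax b w)) =
      fun w => ∑ p, profileProb (weightedSoftmax b w) p • payoffVec u p :=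
    funext fun w => stratUtility_eq_sum u (weightedSoftmax_mem hb w)
  rw [this]
  refine ContDiff.sum fun p _ => ContDiff.fun_smul ?_ contDiff_const
  unfold profileProb
  exact contDiff_prod fun j _ => contDiff_weightedSoftmax hb j (p j)

theorem exists_payoff_solution (u : Profile S → Fin N → ℝ) {b : Vec S} (hb : IsWeight b)
    (w₀ : Vec S) : ∃ w : ℝ → Vec S, w 0 = w₀ ∧
      ∀ t, HasDerivAt w (stratUtility u (weightedSoftmax b (w t))) t :=
  exists_global_integralCurve (contDiff_stratUtility_weightedSoftmax u hb)
    (fun w => norm_stratUtility_le u (weightedSoftmax_mem hb w)) w₀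

theorem hasDerivAt_weightedSoftmax (u : Profile S → Fin N → ℝ) {b : Vec S} (hb : IsWeight b)
    {w : ℝ → Vec S} {t : ℝ} (hw : HasDerivAt w (stratUtility u (weightedSoftmax b (w t))) t)
    (i : Fin N) (s : S i) :
    HasDerivAt (fun t => weightedSoftmax b (w t) i s)
      (replicatorField u (weightedSoftmax b (w t)) i s) t := by
  have hws : ∀ r, HasDerivAt (fun t => w t i r) (stratUtility u (weightedSoftmax b (w t)) i r) t :=
    fun r => hasDerivAt_pi.1 (hasDerivAt_pi.1 hw i) r
  have he : ∀ r, HasDerivAt (fun t => b i r * Real.exp (w t i r))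
      (b i r * (Real.exp (w t i r) * stratUtility u (weightedSoftmax b (w t)) i r)) t :=
    fun r => ((hws r).exp).const_mul _
  have h := (he s).div (HasDerivAt.fun_sum fun r _ => he r) (hb.sum_pos (w t) i).ne'
  refine h.congr_deriv ?_
  have hZ := (hb.sum_pos (w t) i).ne'
  have hsum : ∑ r, weightedSoftmax b (w t) i r * stratUtility u (weightedSoftmax b (w t)) i r
      = (∑ r, b i r * (Real.exp (w t i r) * stratUtility u (weightedSoftmax b (w t)) i r)) /
        ∑ r, b i r * Real.exp (w t i r) := by
    rw [Finset.sum_div]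
    refine Finset.sum_congr rfl fun r _ => ?_
    simp only [weightedSoftmax]
    ring
  rw [replicatorField, hsum]
  simp only [weightedSoftmax] at *
  field_simp

theorem weightedSoftmax_zero {x : Vec S} (hx : x ∈ strategySpace S) :
    weightedSoftmax x 0 = x := by
  ext i s
  simp [weightedSoftmax, (mem_strategySpace.1 hx i).2]

/-- Through every point of strategy space there is a complete orbit of the replicator dynamic,
along which zero coordinates remain zero. -/
theorem exists_replicator_orbit (u : Profile S → Fin N → ℝ) {y : Vec S}
    (hy : y ∈ strategySpace S) (t₀ : ℝ) : ∃ x : ℝ → Vec S, IsReplicatorSolution u x ∧ x t₀ = y ∧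
      ∀ t i s, y i s = 0 → x t i s = 0 := by
  have hb := isWeight_of_mem hy
  obtain ⟨w, hw₀, hw⟩ := exists_payoff_solution u hb 0
  -- Using `y` itself as the weights, with initial payoffs zero, also reaches boundary points: zero
  -- weights stay zero. The time shift makes the orbit pass through `y` at `t₀`, as needed for
  -- backward invariance.
  refine ⟨fun t => weightedSoftmax y (w (t - t₀)), ⟨fun t _ => weightedSoftmax_mem hb _,
    fun t _ i s => ?_⟩, ?_, fun t i s h => ?_⟩
  · have h1 := hasDerivAt_weightedSoftmax u hb (hw (t - t₀)) i s
    exact (h1.comp_sub_const t t₀).hasDerivWithinAt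
  · simp [hw₀, weightedSoftmax_zero hy]
  · simp [weightedSoftmax, h]

end WeightedSoftmax

/-! ### Invariance of faces under the replicator dynamic -/

section Faces

/-- Continuous functions on `[0, ∞)` have primitives. -/
theorem exists_primitive {g : ℝ → ℝ} (hg : ContinuousOn g (Ici 0)) :
    ∃ A : ℝ → ℝ, A 0 = 0 ∧ ∀ t, 0 ≤ t → HasDerivWithinAt A (g t) (Ici 0) t := by
  have hc : Continuous fun t => g (max t 0) :=
    hg.comp_continuous (by fun_prop) fun t => mem_Ici.2 (le_max_right _ _)
  refine ⟨fun t => ∫ τ in (0 : ℝ)..t, g (max τ 0), by simp, fun t ht => ?_⟩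
  have := (hc.integral_hasStrictDerivAt 0 t).hasDerivAt.hasDerivWithinAt (s := Ici 0)
  rwa [max_eq_left ht] at this

variable {N : ℕ} {S : Fin N → Type v} [∀ i, Fintype (S i)] {u : Profile S → Fin N → ℝ}

/-- The growth rate of a pure strategy under the replicator dynamic. -/
noncomputable def growthRate (u : Profile S → Fin N → ℝ) (x : Vec S) (i : Fin N) (s : S i) : ℝ :=
  stratUtility u x i s - ∑ r, x i r * stratUtility u x i r

theorem continuous_stratUtility (u : Profile S → Fin N → ℝ) (i : Fin N) (s : S i) :
    ContinuousOn (fun x => stratUtility u x i s) (strategySpace S) := by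
  have : EqOn (fun x : Vec S => stratUtility u x i s)
      (fun x => ∑ p, profileProb x p * payoffVec u p i s) (strategySpace S) := fun x hx =>
    stratUtility_eq u (mem_strategySpace.1 hx i).2 s
  refine ContinuousOn.congr ?_ this
  unfold profileProb
  fun_prop

namespace IsReplicatorSolution

variable {x : ℝ → Vec S}

theorem mem (hx : IsReplicatorSolution u x) {t : ℝ} (ht : 0 ≤ t) : x t ∈ strategySpace S :=
  hx.1 t ht

theorem hasDerivWithinAt (hx : IsReplicatorSolution u x) {t : ℝ} (ht : 0 ≤ t) (i : Fin N)
    (s : S i) : HasDerivWithinAt (fun τ => x τ i s) (x t i s * growthRate u (x t) i s) (Ici 0) t :=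
  hx.2 t ht i s

theorem continuousOn (hx : IsReplicatorSolution u x) : ContinuousOn x (Ici 0) :=
  continuousOn_pi.2 fun i => continuousOn_pi.2 fun s _ ht =>
    (hx.hasDerivWithinAt ht i s).continuousWithinAt

theorem continuousOn_stratUtility (hx : IsReplicatorSolution u x) (i : Fin N) (s : S i) :
    ContinuousOn (fun t => stratUtility u (x t) i s) (Ici 0) :=
  (continuous_stratUtility u i s).comp hx.continuousOn fun _ ht => hx.mem ht

theorem continuousOn_average (hx : IsReplicatorSolution u x) (i : Fin N) :
    ContinuousOn (fun t => ∑ r, x t i r * stratUtility u (x t) i r) (Ici 0) := by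
  refine continuousOn_finsetSum _ fun r _ => ContinuousOn.mul ?_ (hx.continuousOn_stratUtility i r)
  exact continuousOn_pi.1 (continuousOn_pi.1 hx.continuousOn i) r

/-- The replicator equation is linear in each coordinate, given the growth rates. -/
theorem eq_mul_exp (hx : IsReplicatorSolution u x) {t : ℝ} (ht : 0 ≤ t) (i : Fin N) (s : S i)
    {A : ℝ → ℝ} (hA : ∀ t, 0 ≤ t → HasDerivWithinAt A (growthRate u (x t) i s) (Ici 0) t)
    (hA0 : A 0 = 0) : x t i s = x 0 i s * Real.exp (A t) := by
  have hd : ∀ τ ∈ Icc 0 t, HasDerivWithinAt (fun τ => x τ i s * Real.exp (-A τ)) 0 (Icc 0 t) τ := by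
    intro τ hτ
    have h1 := (hx.hasDerivWithinAt hτ.1 i s).mul ((hA τ hτ.1).neg.exp)
    refine (h1.congr_deriv ?_).mono Icc_subset_Ici_self
    simp only [Pi.neg_apply]
    ring
  have h2 := constant_of_has_deriv_right_zero (f := fun τ => x τ i s * Real.exp (-A τ))
    (fun τ hτ => (hd τ hτ).continuousWithinAt)
    (fun τ hτ => (hd τ (Ico_subset_Icc_self hτ)).mono_of_mem_nhdsWithin
      (Icc_mem_nhdsGE_of_mem hτ)) t ⟨ht, le_rfl⟩
  simp only [hA0, neg_zero, Real.exp_zero, mul_one] at h2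
  rw [← h2, mul_assoc, ← Real.exp_add]
  simp

/-- Absent strategies remain absent. -/
theorem eq_zero (hx : IsReplicatorSolution u x) {t : ℝ} (ht : 0 ≤ t) {i : Fin N} {s : S i}
    (h : x 0 i s = 0) : x t i s = 0 := by
  have hg : ContinuousOn (fun t => growthRate u (x t) i s) (Ici 0) :=
    (hx.continuousOn_stratUtility i s).sub (hx.continuousOn_average i)
  obtain ⟨A, hA0, hA⟩ := exists_primitive hg
  rw [hx.eq_mul_exp ht i s hA hA0, h, zero_mul]

end IsReplicatorSolution

end Faces

/-! ### Succession of play and the shape of a single phase -/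

section Phases

variable {N : ℕ} {S : Fin N → Type v} {u : Profile S → Fin N → ℝ} {K : ℕ} {c : ZMod K → Profile S}

/-- The pure profile `p` consists of maximal coordinates of `w`. -/
def IsMaxAt (p : Profile S) (w : Vec S) : Prop := ∀ i s, w i s ≤ w i (p i)

theorem NearEdge.le_sub {k : ZMod K} {h : ℝ} {w : Vec S} (hw : NearEdge c k h w) {p : Profile S}
    (hp : IsMaxAt p w) {i : Fin N} {s : S i} (h₁ : s ≠ c k i) (h₂ : s ≠ c (k + 1) i) :
    h ≤ w i (p i) - w i s :=
  (hw i s h₁ h₂).trans (sub_le_sub_right (max_le (hp _ _) (hp _ _)) _)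

namespace IsSinkCycle

theorem eq_of_isMaxAt (hc : IsSinkCycle u c) {k l : ZMod K} {h : ℝ} {w : Vec S} (hh : 0 < h)
    (hw : NearEdge c l h w) (hk : IsMaxAt (c k) w) : l = k ∨ l + 1 = k := by
  have := hc.eq_or_eq_of_mem (k := l) (p := c k) fun i => by
    by_contra hi
    simp only [mem_insert_iff, mem_singleton_iff, not_or] at hi
    have := hw.le_sub hk hi.1 hi.2
    linarith
  rcases this with h | h
  · exact .inl (hc.injective h).symm
  · exact .inr (hc.injective h).symm

/-- The gap between the strategies of the mover at `c k` after and before the move. -/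
noncomputable def stepGap (hc : IsSinkCycle u c) (k : ZMod K) : Vec S →L[ℝ] ℝ :=
  gap (hc.mover k) (c (k + 1) (hc.mover k)) (c k (hc.mover k))

theorem moveGap_eq (hc : IsSinkCycle u c) (k : ZMod K) (w : Vec S) :
    hc.moveGap k w = -hc.stepGap (k + 1) w := by
  simp [moveGap, stepGap]

theorem le_stepGap (hc : IsSinkCycle u c) (hK : 2 < K) {k : ZMod K} {h : ℝ} {w : Vec S}
    (hw : NearEdge c (k + 1) h w) (hk : IsMaxAt (c (k + 1)) w) : h ≤ hc.stepGap k w := by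
  refine hw.le_sub hk (hc.succ_mover_ne k).symm ?_
  rw [hc.succ_of_ne (hc.mover_succ_ne hK k).symm]
  exact (hc.succ_mover_ne k).symm

theorem le_moveGap (hc : IsSinkCycle u c) (hK : 2 < K) {k : ZMod K} {h : ℝ} {w : Vec S}
    (hw : NearEdge c k h w) (hk : IsMaxAt (c (k + 1)) w) : h ≤ hc.moveGap k w :=
  hw.le_sub hk (hc.ne_of_succ_mover hK k) (hc.succ_mover_ne (k + 1))

/-- Being near some edge, with `c (k + 1)` maximal, leaves the two edges at this node. On the
incoming one, the only other competitor is the strategy just left, and `stepGap` keeps it away. -/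
theorem nearEdge_succ (hc : IsSinkCycle u c) {k : ZMod K} {h B : ℝ} {w : Vec S}
    (hh : 0 < h) (hB : B ≤ h) {l : ZMod K} (hl : NearEdge c l h w) (hk : IsMaxAt (c (k + 1)) w)
    (hs : B ≤ hc.stepGap k w) : NearEdge c (k + 1) B w := by
  rcases hc.eq_of_isMaxAt hh hl hk with rfl | hlk
  · exact hl.mono hB
  · obtain rfl := add_right_cancel hlk
    intro i s h₁ h₂
    rw [max_eq_left (hk _ _)]
    by_cases hs' : s = c l i
    · subst hs'
      obtain rfl := hc.eq_mover h₁.symm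
      exact hs
    · exact hB.trans (hl.le_sub hk hs' h₁)

/-- If two consecutive profiles of the cycle are maximal, the gap of the next move is large. -/
theorem le_moveGap_of_isMaxAt (hc : IsSinkCycle u c) (hK : 2 < K) {k l : ZMod K} {h : ℝ}
    {w : Vec S} (hh : 0 < h) (hw : NearEdge c l h w) (h₀ : IsMaxAt (c k) w)
    (h₁ : IsMaxAt (c (k + 1)) w) : h ≤ hc.moveGap k w := by
  rcases hc.eq_of_isMaxAt hh hw h₁ with rfl | hlk
  · have h2 := hc.le_stepGap hK hw h₁
    have h3 := h₀ (hc.mover k) (c (k + 1) (hc.mover k))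
    rw [stepGap, gap_apply] at h2
    linarith
  · obtain rfl := add_right_cancel hlk
    exact hc.le_moveGap hK hw h₁

theorem isMaxAt_of_tie (hc : IsSinkCycle u c) {k : ZMod K} {w : Vec S}
    (h : IsMaxAt (c k) w) (h0 : w (hc.mover k) (c k (hc.mover k)) =
      w (hc.mover k) (c (k + 1) (hc.mover k))) : IsMaxAt (c (k + 1)) w := by
  intro i s
  by_cases hi : i = hc.mover k
  · subst hi
    rw [← h0]; exact h _ _
  · rw [hc.succ_of_ne hi]; exact h _ _

variable [∀ i, Fintype (S i)]

theorem exists_stepGap_rate [NeZero K] (hc : IsSinkCycle u c) (hK : 2 < K) :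
    ∃ r > 0, ∃ B > 0, ∀ k w, NearEdge c k B w → ∀ y ∈ strategySpace S,
      (∀ i s r, y i s ≤ Real.exp (w i s - w i r)) → r ≤ hc.stepGap k (stratUtility u y) := by
  have h₁ : ∀ᶠ r in 𝓝[>] (0 : ℝ), ∀ k, ∀ᶠ h in atTop, ∀ w, NearEdge c k h w →
      ∀ y ∈ strategySpace S, (∀ i s r, y i s ≤ Real.exp (w i s - w i r)) →
        r ≤ hc.stepGap k (stratUtility u y) := by
    refine eventually_all.2 fun k => ?_
    have h0 : 0 < hc.stepGap k (payoffVec u (c k)) :=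
      hc.gap_payoffVec_pos hK (hc.succ_mover_ne k).symm
    refine hc.eventually_rate k _ h0 ?_
    -- The mover's payoffs do not depend on its own strategy, so the gap has the same positive rate
    -- at both ends of the edge.
    have h1 : hc.stepGap k (payoffVec u (c (k + 1))) = hc.stepGap k (payoffVec u (c k)) := by
      have := fun s => payoffVec_congr u (i := hc.mover k) (p := c (k + 1)) (q := c k)
        (fun j hj => by rw [hc.succ_of_ne hj]) s
      simp only [stepGap, gap_apply, this]
    rwa [h1]
  obtain ⟨r, hr, hr0⟩ := (h₁.and self_mem_nhdsWithin).exists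
  obtain ⟨B, hB, hB0⟩ := ((eventually_all.2 hr).and (eventually_gt_atTop 0)).exists
  exact ⟨r, hr0, B, hB0, hB⟩

end IsSinkCycle

variable [∀ i, Fintype (S i)]

/-- Soft play on `[0, ∞)` that is close to the edges of the cycle at all times. -/
structure IsEdgePlay (hc : IsSinkCycle u c) (r B δ m : ℝ) (w : ℝ → Vec S) : Prop where
  two_lt : 2 < K
  r_pos : 0 < r
  B_pos : 0 < B
  r_le : r ≤ δ
  lt : B < δ * m
  rate : ∀ k w, NearEdge c k B w → ∀ y ∈ strategySpace S,
      (∀ i s r, y i s ≤ Real.exp (w i s - w i r)) → r ≤ hc.stepGap k (stratUtility u y)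
  soft : ∀ T, 0 ≤ T → IsSoftPlay u T w
  near : ∀ t, 0 ≤ t → ∃ k, NearEdge c k (δ * (m + t)) (w t)

namespace IsEdgePlay

variable {hc : IsSinkCycle u c} {r B δ m : ℝ} {w : ℝ → Vec S} {k : ZMod K}

theorem lt' (hw : IsEdgePlay hc r B δ m w) {t : ℝ} (ht : 0 ≤ t) : B < δ * (m + t) := by
  have := mul_nonneg (hw.r_pos.le.trans hw.r_le) ht
  linarith [hw.lt]

theorem continuousOn (hw : IsEdgePlay hc r B δ m w) : ContinuousOn w (Ici 0) := by
  intro t ht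
  have ht' : (0 : ℝ) ≤ t := ht
  refine ((hw.soft (t + 1) (by linarith)).continuousOn (by linarith) t
    ⟨ht, by linarith⟩).mono_of_mem_nhdsWithin ?_
  rw [← Ici_inter_Iic]
  exact inter_mem self_mem_nhdsWithin (mem_nhdsWithin_of_mem_nhds (Iic_mem_nhds (by linarith)))

theorem stepGap_add_le (hw : IsEdgePlay hc r B δ m w) {a b : ℝ} (ha : 0 ≤ a) (hab : a ≤ b)
    (h : ∀ t ∈ Icc a b, NearEdge c k B (w t)) :
    hc.stepGap k (w a) + r * (b - a) ≤ hc.stepGap k (w b) := by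
  have := (hw.soft b (ha.trans hab)).mul_le ha hab le_rfl (hc.stepGap k) (r := r)
    fun t ht y hy hs => hw.rate k (w t) (h t ht) y hy hs
  linarith

/-- A profile of the cycle stays maximal until its mover becomes indifferent. -/
theorem isMaxAt_of_moveGap_pos (hw : IsEdgePlay hc r B δ m w) {a b : ℝ} (ha : 0 ≤ a)
    (hmax : IsMaxAt (c (k + 1)) (w a)) (hpos : ∀ t ∈ Ico a b, 0 < hc.moveGap k (w t)) :
    ∀ t ∈ Icc a b, IsMaxAt (c (k + 1)) (w t) ∧ r * (t - a) ≤ hc.stepGap k (w t) := by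
  have hcont : ContinuousOn w (Icc a b) := hw.continuousOn.mono fun t ht => ha.trans ht.1
  have hcoord : ∀ i s, ContinuousOn (fun t => w t i s) (Icc a b) := fun i s =>
    continuousOn_pi.1 (continuousOn_pi.1 hcont i) s
  have : Icc a b ⊆ {t | IsMaxAt (c (k + 1)) (w t) ∧ r * (t - a) ≤ hc.stepGap k (w t)} := by
    refine IsClosed.Icc_subset_of_forall_exists_gt ?_ ⟨hmax, ?_⟩ ?_
    · have : {t | IsMaxAt (c (k + 1)) (w t) ∧ r * (t - a) ≤ hc.stepGap k (w t)} ∩ Icc a b =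
          (Icc a b ∩ ⋂ i, ⋂ s, {t ∈ Icc a b | w t i s ≤ w t i (c (k + 1) i)}) ∩
            {t ∈ Icc a b | r * (t - a) ≤ hc.stepGap k (w t)} := by
        ext t
        simp only [IsMaxAt, mem_inter_iff, mem_ofPred_eq, mem_iInter]
        constructor
        · rintro ⟨⟨h₁, h₂⟩, ht⟩; exact ⟨⟨ht, fun i s => ⟨ht, h₁ i s⟩⟩, ht, h₂⟩
        · rintro ⟨⟨ht, h₁⟩, -, h₂⟩; exact ⟨⟨fun i s => (h₁ i s).2, h₂⟩, ht⟩
      rw [this]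
      refine (isClosed_Icc.inter <| isClosed_iInter fun i => isClosed_iInter fun s =>
        isClosed_Icc.isClosed_le (hcoord _ _) (hcoord _ _)).inter
        (isClosed_Icc.isClosed_le (by fun_prop)
          ((hc.stepGap k).continuous.comp_continuousOn hcont))
    · have := hmax (hc.mover k) (c k (hc.mover k))
      simp [IsSinkCycle.stepGap, this]
    · rintro t ⟨⟨hmt, hst⟩, htI⟩ y hy
      have ht0 : 0 ≤ t := ha.trans htI.1
      suffices h : ∀ᶠ t' in 𝓝[>] t,
          IsMaxAt (c (k + 1)) (w t') ∧ r * (t' - a) ≤ hc.stepGap k (w t') by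
        obtain ⟨t', h₁, h₂⟩ := (h.and (Ioc_mem_nhdsGT hy)).exists
        exact ⟨t', h₁, h₂⟩
      obtain ⟨l, hl⟩ := hw.near t ht0
      have hh := hw.lt' ht0
      have hh0 : 0 < δ * (m + t) := hw.B_pos.trans hh
      have hct : ContinuousWithinAt w (Ici t) t :=
        (hw.continuousOn t ht0).mono (Ici_subset_Ici.2 ht0)
      have hev : ∀ i s, w t i s < w t i (c (k + 1) i) →
          ∀ᶠ t' in 𝓝[>] t, w t' i s ≤ w t' i (c (k + 1) i) := by
        intro i s his
        have h1 : ∀ r, ContinuousWithinAt (fun t => w t i r) (Ioi t) t := fun r =>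
          (continuousWithinAt_pi.1 (continuousWithinAt_pi.1 hct i) r).mono Ioi_subset_Ici_self
        exact ((h1 s).eventually_lt (h1 _) his).mono fun _ h => h.le
      -- On the outgoing edge only the target of the next move is close, and it is held off by
      -- `hpos`. On the incoming edge only the strategy just left is close, and it falls behind at
      -- rate `r`.
      rcases hc.eq_of_isMaxAt hh0 hl hmt with rfl | hlk
      · refine Eventually.and (eventually_all.2 fun i => eventually_all.2 fun s => ?_) ?_
        · by_cases hs₁ : s = c (k + 1) i
          · subst hs₁; simp
          · refine hev i s ?_
            by_cases hs₂ : s = c (k + 1 + 1) i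
            · subst hs₂
              obtain rfl := hc.eq_mover hs₁
              have := hpos t htI
              rw [IsSinkCycle.moveGap, gap_apply] at this
              linarith
            · have := hl.le_sub hmt hs₁ hs₂
              linarith
        · have h1 := hc.le_stepGap hw.two_lt hl hmt
          have h2 : r * (t - a) < hc.stepGap k (w t) := by
            have := mul_le_mul_of_nonneg_right hw.r_le ht0
            nlinarith [mul_nonneg hw.r_pos.le ha, hw.lt, hw.B_pos]
          have h3 : ContinuousWithinAt (fun t' => r * (t' - a)) (Ioi t) t := by fun_prop
          have h4 : ContinuousWithinAt (fun t' => hc.stepGap k (w t')) (Ioi t) t :=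
            (hc.stepGap k).continuous.continuousAt.comp_continuousWithinAt
              (hct.mono Ioi_subset_Ici_self)
          exact (h3.eventually_lt h4 h2).mono fun _ h => h.le
      · obtain rfl := add_right_cancel hlk
        have hnear := NearEdge.eventually hct hh hl
        obtain ⟨v, hv, hsub⟩ := mem_nhdsGE_iff_exists_Icc_subset.1 hnear
        have hstep : ∀ᶠ t' in 𝓝[>] t, r * (t' - a) ≤ hc.stepGap l (w t') := by
          filter_upwards [Ioc_mem_nhdsGT hv] with t' ht'
          have := hw.stepGap_add_le (k := l) ht0 ht'.1.le
            fun τ hτ => hsub ⟨hτ.1, hτ.2.trans ht'.2⟩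
          linarith
        refine Eventually.and (eventually_all.2 fun i => eventually_all.2 fun s => ?_) hstep
        by_cases hs₁ : s = c (l + 1) i
        · subst hs₁; simp
        · by_cases hs₂ : s = c l i
          · subst hs₂
            obtain rfl := hc.eq_mover (Ne.symm hs₁)
            filter_upwards [hstep, self_mem_nhdsWithin] with t' h1 h2
            rw [IsSinkCycle.stepGap, gap_apply] at h1
            have : 0 ≤ r * (t' - a) := mul_nonneg hw.r_pos.le (by
              have : t < t' := h2
              linarith [htI.1])
            linarith
          · refine hev i s ?_
            have := hl.le_sub hmt hs₂ hs₁
            linarith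
  exact fun t ht => this ht

theorem nearEdge_succ (hw : IsEdgePlay hc r B δ m w) {a t : ℝ} (ha : 0 ≤ a) (hat : a + B / r ≤ t)
    (hmax : IsMaxAt (c (k + 1)) (w t)) (hs : r * (t - a) ≤ hc.stepGap k (w t)) :
    NearEdge c (k + 1) B (w t) := by
  have hBr : B ≤ r * (t - a) := by
    rw [← div_le_iff₀' hw.r_pos]; linarith
  have ht : 0 ≤ t := by
    have := div_pos hw.B_pos hw.r_pos
    linarith
  obtain ⟨l, hl⟩ := hw.near t ht
  exact hc.nearEdge_succ (hw.B_pos.trans (hw.lt' ht)) (hw.lt' ht).le hl hmax (hBr.trans hs)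

/-- The mover becomes indifferent in finite time. -/
theorem exists_moveGap_nonpos (hw : IsEdgePlay hc r B δ m w) {a : ℝ} (ha : 0 ≤ a)
    (hmax : IsMaxAt (c (k + 1)) (w a)) : ∃ t ≥ a, hc.moveGap k (w t) ≤ 0 := by
  by_contra! hno
  have hBr := div_pos hw.B_pos hw.r_pos
  have h1 : ∀ t, a + B / r ≤ t → NearEdge c (k + 1) B (w t) := fun t ht => by
    obtain ⟨h1, h2⟩ := hw.isMaxAt_of_moveGap_pos ha hmax (b := t) (fun t ht => hno t ht.1) t
      ⟨by linarith, le_rfl⟩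
    exact hw.nearEdge_succ ha ht h1 h2
  -- By this time the strategy just left is `B` behind, so play is near the outgoing edge, and
  -- `moveGap` decreases from then on at rate at least `r`.
  set b := a + B / r
  have hb : 0 < hc.moveGap k (w b) := hno b (by simp [b, hBr.le])
  set t := b + hc.moveGap k (w b) / r
  have hbt : b ≤ t := by
    have := div_pos hb hw.r_pos
    simp only [t]; linarith
  have h2 := hw.stepGap_add_le (k := k + 1) (a := b) (by simp only [b]; linarith) hbt
    fun τ hτ => h1 τ hτ.1
  have h3 := hno t (by simp only [b] at *; linarith)
  have h4 : r * (t - b) = hc.moveGap k (w b) := by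
    simp only [t]; rw [add_sub_cancel_left, mul_div_cancel₀ _ hw.r_pos.ne']
  rw [hc.moveGap_eq] at h3 h4
  linarith

/-- The path of payoffs while a profile of the cycle is played. -/
theorem exists_phase (hw : IsEdgePlay hc r B δ m w) {a : ℝ} (ha : 0 ≤ a)
    (hmax : IsMaxAt (c (k + 1)) (w a)) (hmove : δ * (m + a) ≤ hc.moveGap k (w a)) :
    ∃ b > a, IsMaxAt (c (k + 1)) (w b) ∧ IsMaxAt (c (k + 1 + 1)) (w b) ∧
      hc.moveGap k (w b) = 0 ∧
      (∀ t ∈ Ioo a b, ∀ i s, s ≠ c (k + 1) i → w t i s < w t i (c (k + 1) i)) ∧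
      ∀ t ∈ Icc a b, ∀ i s, s ≠ c (k + 1) i →
        w t i s - w t i (c (k + 1) i) ≤ B - min (r * (t - a)) (r * (b - t)) := by
  have hBr := div_pos hw.B_pos hw.r_pos
  -- The phase ends at the first time at which the next mover is indifferent.
  set Z := {t ∈ Ici a | hc.moveGap k (w t) ≤ 0} with hZ
  have hZc : IsClosed Z := isClosed_Ici.isClosed_le ((hc.moveGap k).continuous.comp_continuousOn
    (hw.continuousOn.mono (Ici_subset_Ici.2 ha))) continuousOn_const
  have hZn : Z.Nonempty := hw.exists_moveGap_nonpos ha hmax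
  have hZb : BddBelow Z := ⟨a, fun t ht => ht.1⟩
  have hb := hZc.csInf_mem hZn hZb
  set b := sInf Z with hbdef
  have hh0 : ∀ t, 0 ≤ t → 0 < δ * (m + t) := fun t ht => hw.B_pos.trans (hw.lt' ht)
  have hab : a < b := by
    refine lt_of_le_of_ne hb.1 fun h => ?_
    have := hb.2
    rw [← h] at this
    linarith [hh0 a ha]
  have hpos : ∀ t ∈ Ico a b, 0 < hc.moveGap k (w t) := fun t ht => by
    by_contra! hn
    exact absurd (csInf_le hZb (show t ∈ Z from ⟨ht.1, hn⟩)) (not_le.2 ht.2)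
  have hcore := hw.isMaxAt_of_moveGap_pos ha hmax hpos
  have hbmax := (hcore b ⟨hab.le, le_rfl⟩).1
  have hb0 : hc.moveGap k (w b) = 0 := by
    refine le_antisymm hb.2 ?_
    rw [IsSinkCycle.moveGap, gap_apply]
    linarith [hbmax (hc.mover (k + 1)) (c (k + 1 + 1) (hc.mover (k + 1)))]
  refine ⟨b, hab, hbmax, hc.isMaxAt_of_tie hbmax ?_, hb0, ?_, ?_⟩
  · rw [IsSinkCycle.moveGap, gap_apply] at hb0
    linarith
  · intro t ht i s hs
    obtain ⟨h1, h2⟩ := hcore t (Ioo_subset_Icc_self ht)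
    have ht0 : 0 ≤ t := ha.trans ht.1.le
    obtain ⟨l, hl⟩ := hw.near t ht0
    have hh := hh0 t ht0
    rcases hc.eq_of_isMaxAt hh hl h1 with rfl | hlk
    · by_cases hs₂ : s = c (k + 1 + 1) i
      · subst hs₂
        obtain rfl := hc.eq_mover hs
        have := hpos t (Ioo_subset_Ico_self ht)
        rw [IsSinkCycle.moveGap, gap_apply] at this
        linarith
      · have := hl.le_sub h1 hs hs₂
        linarith
    · obtain rfl := add_right_cancel hlk
      by_cases hs₂ : s = c l i
      · subst hs₂
        obtain rfl := hc.eq_mover (Ne.symm hs)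
        rw [IsSinkCycle.stepGap, gap_apply] at h2
        have := mul_pos hw.r_pos (sub_pos.2 ht.1)
        linarith
      · have := hl.le_sub h1 hs₂ hs
        linarith
  · intro t ht i s hs
    obtain ⟨h1, h2⟩ := hcore t ht
    have ht0 : 0 ≤ t := ha.trans ht.1
    -- Before this time the asserted bound is nonnegative and there is nothing to prove. Later, the
    -- next target is behind by `r * (b - t)`, the strategy just left by `r * (t - a)`, and all
    -- others by `δ * (m + t)`, which is larger because `r ≤ δ`.
    by_cases hlate : a + B / r ≤ t
    · have hnear : ∀ τ ∈ Icc t b, NearEdge c (k + 1) B (w τ) := fun τ hτ => by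
        obtain ⟨h1, h2⟩ := hcore τ ⟨ht.1.trans hτ.1, hτ.2⟩
        exact hw.nearEdge_succ ha (hlate.trans hτ.1) h1 h2
      have h3 := hw.stepGap_add_le ht0 ht.2 hnear
      rw [hc.moveGap_eq] at hb0
      have hB := hw.B_pos
      by_cases hs₂ : s = c (k + 1 + 1) i
      · subst hs₂
        obtain rfl := hc.eq_mover hs
        have := min_le_right (r * (t - a)) (r * (b - t))
        rw [IsSinkCycle.stepGap, gap_apply, gap_apply] at h3
        rw [IsSinkCycle.stepGap, gap_apply] at hb0
        linarith
      · have := min_le_left (r * (t - a)) (r * (b - t))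
        by_cases hs₃ : s = c k i
        · subst hs₃
          obtain rfl := hc.eq_mover (Ne.symm hs)
          rw [IsSinkCycle.stepGap, gap_apply] at h2
          linarith
        · obtain ⟨l, hl⟩ := hw.near t ht0
          have hgap : δ * (m + t) ≤ w t i (c (k + 1) i) - w t i s := by
            rcases hc.eq_of_isMaxAt (hh0 t ht0) hl h1 with rfl | hlk
            · exact hl.le_sub h1 hs hs₂
            · obtain rfl := add_right_cancel hlk
              exact hl.le_sub h1 hs₃ hs
          have := mul_le_mul_of_nonneg_right hw.r_le ht0
          nlinarith [mul_nonneg hw.r_pos.le ha, hw.lt]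
    · have h3 := min_le_left (r * (t - a)) (r * (b - t))
      have h4 : r * (t - a) ≤ B := by
        rw [← le_div_iff₀' hw.r_pos]
        linarith
      linarith [h1 i s]

end IsEdgePlay

end Phases

/-- Dependent choice with an invariant `P` and a step relation `Q`; it concatenates the phases
below. -/
theorem exists_seq_of_forall_exists {α : Type*} {P : ℕ → α → Prop} {Q : ℕ → α → α → Prop} {a : α}
    (ha : P 0 a) (h : ∀ n a, P n a → ∃ b, P (n + 1) b ∧ Q n a b) :
    ∃ f : ℕ → α, f 0 = a ∧ (∀ n, P n (f n)) ∧ ∀ n, Q n (f n) (f (n + 1)) := by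
  choose g hg using h
  let F : ∀ n, {a // P n a} := fun n =>
    Nat.rec ⟨a, ha⟩ (fun n x => ⟨g n x.1 x.2, (hg n x.1 x.2).1⟩) n
  exact ⟨fun n => (F n).1, rfl, fun n => (F n).2, fun n => (hg n (F n).1 (F n).2).2⟩

/-! ### Cyclic paths with bounded error in each phase -/

section CyclicPaths

variable {N : ℕ} {S : Fin N → Type v} {u : Profile S → Fin N → ℝ} {K : ℕ} {c : ZMod K → Profile S}
  [∀ i, Fintype (S i)]

/-- A path in payoff space that stays, up to bounded errors in each period, close to the path of
payoffs when the profiles `c 0, c 1, …` are played, with switching times `θ`. -/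
structure IsCyclicPath (u : Profile S → Fin N → ℝ) (c : ZMod K → Profile S) (κ E : ℝ)
    (w : ℝ → Vec S) (θ : ℕ → ℝ) : Prop where
  zero : θ 0 = 0
  grow : ∀ n, κ * (1 + θ n) ≤ θ (n + 1) - θ n
  isMaxAt : ∀ n : ℕ, IsMaxAt (c n) (w (θ n))
  isMaxAt_succ : ∀ n : ℕ, IsMaxAt (c n) (w (θ (n + 1)))
  norm_le : ∀ n : ℕ, ∀ t ∈ Icc (θ n) (θ (n + 1)),
    ‖w t - w (θ n) - (t - θ n) • payoffVec u (c n)‖ ≤ E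

namespace IsCyclicPath

variable {κ E : ℝ} {w : ℝ → Vec S} {θ : ℕ → ℝ}

theorem le_apply (h : IsCyclicPath u c κ E w θ) (hκ : 0 < κ) (n : ℕ) :
    κ * n ≤ θ n ∧ 0 ≤ θ n := by
  induction n with
  | zero => simp [h.zero]
  | succ n ih =>
    have := h.grow n
    have := mul_nonneg hκ.le ih.2
    push_cast
    constructor <;> nlinarith

theorem strictMono (h : IsCyclicPath u c κ E w θ) (hκ : 0 < κ) : StrictMono θ := by
  refine strictMono_nat_of_lt_succ fun n => ?_
  have := h.grow n
  have := mul_nonneg hκ.le (h.le_apply hκ n).2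
  linarith

theorem tendsto (h : IsCyclicPath u c κ E w θ) (hκ : 0 < κ) : Tendsto θ atTop atTop :=
  tendsto_atTop_mono (fun n => (h.le_apply hκ n).1)
    (tendsto_natCast_atTop_atTop.const_mul_atTop hκ)

end IsCyclicPath

/-- Weights off `p` are at most `exp B` times a sum of two exponentials decaying away from the ends
of the phase. Their integral is at most `2 / r`, whatever the length of the phase. -/
theorem IsSoftPlay.norm_sub_le {T : ℝ} {w : ℝ → Vec S} (hw : IsSoftPlay u T w) {a b r B : ℝ}
    (ha : 0 ≤ a) (hb : b ≤ T) (hr : 0 < r) {p : Profile S}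
    (h : ∀ t ∈ Icc a b, ∀ i s, s ≠ p i →
      w t i s - w t i (p i) ≤ B - min (r * (t - a)) (r * (b - t))) :
    ∀ t ∈ Icc a b, ‖w t - w a - (t - a) • payoffVec u p‖ ≤
      2 * Fintype.card (Profile S) * payoffBound u * Real.exp B * (2 / r) := by
  intro t ht
  set C := 2 * Fintype.card (Profile S) * payoffBound u * Real.exp B with hC
  have hP := payoffBound_nonneg u
  have hC0 : 0 ≤ C := by positivity
  -- Bounds for all functionals give the norm bound by duality; applying the one-sided bound to `-L`
  -- gives the other side.
  have key : ∀ L : Vec S →L[ℝ] ℝ,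
      -(C * (2 / r) * ‖L‖) ≤ L (w t - w a - (t - a) • payoffVec u p) := by
    intro L
    set φ : ℝ → ℝ := fun τ => Real.exp (-(r * (τ - a))) + Real.exp (-(r * (b - τ))) with hφ
    have h1 := hw.integral_le ha ht.1 (ht.2.trans hb) L
      (g := fun τ => L (payoffVec u p) - C * ‖L‖ * φ τ)
      (Continuous.intervalIntegrable (by fun_prop) _ _) (fun τ hτ y hy hsoft => by
        have hτ' : τ ∈ Icc a b := ⟨hτ.1, hτ.2.trans ht.2⟩
        have := le_apply_stratUtility u hy (A := fun i => {p i}) (ε := Real.exp B * φ τ)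
          (by positivity) (fun i s hs => by
            refine (hsoft i s (p i)).trans ((Real.exp_le_exp.2 (h τ hτ' i s hs)).trans ?_)
            rw [sub_eq_add_neg, Real.exp_add]
            refine mul_le_mul_of_nonneg_left ?_ (Real.exp_pos _).le
            rcases min_choice (r * (τ - a)) (r * (b - τ)) with h | h <;> rw [h] <;> simp only [hφ]
            · linarith [Real.exp_pos (-(r * (b - τ)))]
            · linarith [Real.exp_pos (-(r * (τ - a)))]) L (r := L (payoffVec u p))
          (fun q hq => by
            have : q = p := funext hq
            rw [this]) ⟨p, fun i => rfl⟩
        refine le_trans (le_of_eq ?_) this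
        simp only [hC]; ring)
    have hΦ : ∀ τ ∈ uIcc a t, HasDerivAt
        (fun τ => (τ - a) * L (payoffVec u p) - C * ‖L‖ * ((Real.exp (-(r * (b - τ))) -
          Real.exp (-(r * (τ - a)))) / r)) (L (payoffVec u p) - C * ‖L‖ * φ τ) τ := by
      intro τ _
      have e1 : HasDerivAt (fun τ => Real.exp (-(r * (b - τ))))
          (Real.exp (-(r * (b - τ))) * -(r * -1)) τ :=
        (((hasDerivAt_id τ).const_sub b).const_mul r).neg.exp
      have e2 : HasDerivAt (fun τ => Real.exp (-(r * (τ - a))))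
          (Real.exp (-(r * (τ - a))) * -(r * 1)) τ :=
        (((hasDerivAt_id τ).sub_const a).const_mul r).neg.exp
      have e3 : HasDerivAt (fun τ => (τ - a) * L (payoffVec u p)) (1 * L (payoffVec u p)) τ :=
        ((hasDerivAt_id τ).sub_const a).mul_const _
      refine (e3.sub (((e1.sub e2).div_const r).const_mul (C * ‖L‖))).congr_deriv ?_
      simp only [hφ]
      field_simp
      ring
    rw [intervalIntegral.integral_eq_sub_of_hasDerivAt hΦ
      (Continuous.intervalIntegrable (by fun_prop) _ _)] at h1
    have hexp : ∀ z : ℝ, 0 ≤ z → Real.exp (-(r * z)) ≤ 1 := fun z hz => by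
      rw [Real.exp_le_one_iff]
      have := mul_nonneg hr.le hz
      linarith
    have b1 := hexp (b - t) (sub_nonneg.2 ht.2)
    have b2 := Real.exp_pos (-(r * (t - a)))
    have b3 := Real.exp_pos (-(r * (b - a)))
    simp only [sub_self, mul_zero, neg_zero, Real.exp_zero, zero_mul] at h1
    have b4 : (Real.exp (-(r * (b - t))) - Real.exp (-(r * (t - a)))) / r -
        (Real.exp (-(r * (b - a))) - 1) / r ≤ 2 / r := by
      rw [← sub_div]
      exact div_le_div_of_nonneg_right (by linarith) hr.le
    have b5 := mul_le_mul_of_nonneg_left b4 (mul_nonneg hC0 (norm_nonneg L))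
    simp only [map_sub, map_smul, smul_eq_mul]
    linarith
  refine NormedSpace.norm_le_dual_bound ℝ _ (by positivity) fun L => ?_
  have h1 := key L
  have h2 := key (-L)
  rw [norm_neg, neg_apply] at h2
  rw [Real.norm_eq_abs, abs_le]
  constructor <;> linarith

/-- The waiting time for the next move is at least proportional to the time. -/
theorem IsEdgePlay.exists_grow {hc : IsSinkCycle u c} [NeZero K] {r B δ m : ℝ} {w : ℝ → Vec S}
    (hw : IsEdgePlay hc r B δ m w) : ∃ κ > 0, ∀ k a b, 0 ≤ a → a ≤ b →
      δ * (m + a) ≤ hc.moveGap k (w a) → hc.moveGap k (w b) = 0 → κ * (1 + a) ≤ b - a := by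
  -- A common bound for the speed of all `moveGap`s: a gap of size `δ * (m + a)` needs a time
  -- proportional to `1 + a` to close.
  set C := (∑ k, ‖hc.moveGap k‖) * payoffBound u + 1
  have hP := payoffBound_nonneg u
  have hC : 0 < C := add_pos_of_nonneg_of_pos
    (mul_nonneg (Finset.sum_nonneg fun _ _ => norm_nonneg _) hP) one_pos
  have hδ : 0 < δ := hw.r_pos.trans_le hw.r_le
  have hm : 0 < m := (mul_pos_iff_of_pos_left hδ).1 (hw.B_pos.trans hw.lt)
  refine ⟨δ * min m 1 / C, by positivity, fun k a b ha hab hmove h0 => ?_⟩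
  have h6 := (abs_le.1 ((hw.soft b (ha.trans hab)).abs_sub_le ha hab le_rfl (hc.moveGap k))).1
  have h7 : ‖hc.moveGap k‖ * payoffBound u ≤ C := by
    have := Finset.single_le_sum (f := fun k => ‖hc.moveGap k‖)
      (fun _ _ => norm_nonneg _) (Finset.mem_univ k)
    have := mul_le_mul_of_nonneg_right this hP
    simp only [C]; linarith
  have h8 := mul_le_mul_of_nonneg_right h7 (sub_nonneg.2 hab)
  rw [div_mul_eq_mul_div, div_le_iff₀ hC]
  have h9 : δ * min m 1 * (1 + a) ≤ δ * (m + a) := by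
    rw [mul_assoc]
    refine mul_le_mul_of_nonneg_left ?_ hδ.le
    have := min_le_left m 1
    have := mul_le_mul_of_nonneg_right (min_le_right m 1) ha
    linarith
  linarith

theorem IsEdgePlay.exists_isCyclicPath {hc : IsSinkCycle u c} [NeZero K] {r B δ m : ℝ}
    {w : ℝ → Vec S}
    (hw : IsEdgePlay hc r B δ m w) (hmax : IsMaxAt (c 0) (w 0))
    (hmove : δ * m ≤ hc.moveGap (-1) (w 0)) :
    FollowsPlay c w ∧ ∃ κ > 0, ∃ E θ, IsCyclicPath u c κ E w θ := by
  set E := 2 * Fintype.card (Profile S) * payoffBound u * Real.exp B * (2 / r)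
  obtain ⟨κ, hκ, hgrow⟩ := hw.exists_grow
  obtain ⟨θ, h0, hP, hQ⟩ := exists_seq_of_forall_exists (a := (0 : ℝ))
    (P := fun n a => 0 ≤ a ∧ IsMaxAt (c n) (w a) ∧ δ * (m + a) ≤ hc.moveGap (n - 1) (w a))
    (Q := fun n a b => κ * (1 + a) ≤ b - a ∧ IsMaxAt (c n) (w b) ∧
      (∀ t ∈ Ioo a b, ∀ i s, s ≠ c n i → w t i s < w t i (c n i)) ∧
      ∀ t ∈ Icc a b, ‖w t - w a - (t - a) • payoffVec u (c n)‖ ≤ E)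
    (by simpa using ⟨hmax, hmove⟩) (by
      rintro n a ⟨ha, hmax, hmove⟩
      obtain ⟨k, hk⟩ : ∃ k : ZMod K, k + 1 = n := ⟨n - 1, by ring⟩
      rw [← hk, add_sub_cancel_right] at hmove
      rw [← hk] at hmax
      obtain ⟨b, hab, h1, h2, h3, h4, h5⟩ := hw.exists_phase ha hmax hmove
      rw [Nat.cast_succ, ← hk, add_sub_cancel_right]
      have hb : 0 ≤ b := ha.trans hab.le
      refine ⟨b, ⟨hb, h2, ?_⟩, ?_, h1, h4, (hw.soft b hb).norm_sub_le ha le_rfl hw.r_pos h5⟩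
      · obtain ⟨l, hl⟩ := hw.near b hb
        exact hc.le_moveGap_of_isMaxAt hw.two_lt (hw.B_pos.trans (hw.lt' hb)) hl h1 h2
      · exact hgrow k a b ha hab.le hmove h3)
  have hpath : IsCyclicPath u c κ E w θ :=
    ⟨h0, fun n => (hQ n).1, fun n => (hP n).2.1, fun n => (hQ n).2.1, fun n => (hQ n).2.2.2⟩
  refine ⟨⟨θ, h0, hpath.strictMono hκ, hpath.tendsto hκ, fun n t ht i => ?_⟩, _, hκ, E, θ, hpath⟩
  ext s
  simp only [argmaxSet, mem_ofPred_eq, mem_singleton_iff]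
  constructor
  · intro hs
    by_contra hne
    exact absurd (hs (c n i)) (not_le.2 ((hQ n).2.2.1 t ht i s hne))
  · rintro rfl r
    by_cases hr : r = c n i
    · rw [hr]
    · exact ((hQ n).2.2.1 t ht i r hr).le

end CyclicPaths

/-! ### Convergence of averaging sequences and perturbed linear recurrences -/

section Averages

/-- Sequences in which every term is, up to a summable error, an average of the preceding
`K + 1` terms. -/
structure IsAveraging (K : ℕ) (p : ℕ → ℕ → ℝ) (e r : ℕ → ℝ) : Prop where
  nonneg : ∀ n d, 0 ≤ p n d
  sum_eq : ∀ n, ∑ d ∈ Finset.range (K + 1), p n d = 1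
  summable : Summable e
  abs_sub_le : ∀ n, |r (n + (K + 1)) - ∑ d ∈ Finset.range (K + 1), p n d * r (n + d)| ≤ e n

namespace IsAveraging

variable {K : ℕ} {p : ℕ → ℕ → ℝ} {e r : ℕ → ℝ}

theorem neg (h : IsAveraging K p e r) : IsAveraging K p e (-r) := by
  refine ⟨h.nonneg, h.sum_eq, h.summable, fun n => ?_⟩
  rw [← abs_neg]
  convert h.abs_sub_le n using 2
  simp only [Pi.neg_apply, mul_neg, Finset.sum_neg_distrib]
  ring

theorem error_nonneg (h : IsAveraging K p e r) (n : ℕ) : 0 ≤ e n :=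
  (abs_nonneg _).trans (h.abs_sub_le n)

/-- An average is not below the minimum of its window, so a lower bound on one window propagates
forward and loses only the accumulated errors. -/
theorem le_of_window (h : IsAveraging K p e r) {n : ℕ} {b : ℝ} (hb : ∀ d ≤ K, b ≤ r (n + d)) :
    ∀ j, b - ∑ i ∈ Finset.range (j - K), e (i + n) ≤ r (n + j) := by
  intro j
  induction j using Nat.strong_induction_on with
  | _ j ih =>
    by_cases hj : j ≤ K
    · simpa [Nat.sub_eq_zero_of_le hj] using hb j hj
    · obtain ⟨j', rfl⟩ : ∃ j', j = j' + (K + 1) := ⟨j - (K + 1), by omega⟩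
      have h1 := (abs_le.1 (h.abs_sub_le (n + j'))).1
      have h2 : ∑ d ∈ Finset.range (K + 1), p (n + j') d *
          (b - ∑ i ∈ Finset.range j', e (i + n)) ≤
          ∑ d ∈ Finset.range (K + 1), p (n + j') d * r (n + j' + d) := by
        refine Finset.sum_le_sum fun d hd => mul_le_mul_of_nonneg_left ?_ (h.nonneg _ _)
        rw [Finset.mem_range] at hd
        rw [add_assoc]
        refine le_trans (sub_le_sub_left ?_ _) (ih (j' + d) (by omega))
        exact Finset.sum_le_sum_of_subset_of_nonneg (Finset.range_mono (by omega))
          fun _ _ _ => h.error_nonneg _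
      rw [← Finset.sum_mul, h.sum_eq, one_mul] at h2
      rw [show j' + (K + 1) - K = j' + 1 by omega, Finset.sum_range_succ, ← add_assoc n,
        add_comm j' n]
      linarith

theorem le_of_window' (h : IsAveraging K p e r) {n : ℕ} {b : ℝ} (hb : ∀ d ≤ K, b ≤ r (n + d))
    {j : ℕ} (hj : n ≤ j) : b - ∑' i, e (i + n) ≤ r j := by
  obtain ⟨j, rfl⟩ := Nat.exists_eq_add_of_le hj
  refine le_trans (sub_le_sub_left ?_ _) (h.le_of_window hb j)
  exact ((summable_nat_add_iff n).2 h.summable).sum_le_tsum _ fun _ _ => h.error_nonneg _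

theorem exists_lower_bound (h : IsAveraging K p e r) : ∃ b, ∀ n, b ≤ r n := by
  have hb : ∀ d ≤ K, -(∑ d ∈ Finset.range (K + 1), |r d|) ≤ r (0 + d) := fun d hd => by
    have h1 := Finset.single_le_sum (f := fun d => |r d|) (fun _ _ => abs_nonneg _)
      (Finset.mem_range.2 (Nat.lt_succ_of_le hd))
    have h2 := neg_abs_le (r d)
    rw [zero_add]
    linarith
  exact ⟨_, fun n => h.le_of_window' hb n.zero_le⟩

/-- If the weight of the latest term is bounded from below, the sequence converges. -/
theorem exists_tendsto (h : IsAveraging K p e r) {p₀ : ℝ} (hp₀ : 0 < p₀) (hp : ∀ n, p₀ ≤ p n K) :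
    ∃ ρ, Tendsto r atTop (𝓝 ρ) := by
  obtain ⟨b, hb⟩ := h.exists_lower_bound
  obtain ⟨b', hb'⟩ := h.neg.exists_lower_bound
  have hbd : IsBoundedUnder (· ≤ ·) atTop r :=
    isBoundedUnder_of ⟨-b', fun n => by have := hb' n; simp only [Pi.neg_apply] at this; linarith⟩
  have hbd' : IsBoundedUnder (· ≥ ·) atTop r := isBoundedUnder_of ⟨b, hb⟩
  set L := limsup r atTop
  -- If a term lies within `C d * ε` of the upper bound `L + ε`, then so does the average producing
  -- it, up to one more `ε`. Its latest entry has weight at least `p₀`, and hence lies within `(C d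
  -- + 1) / p₀ * ε`.
  let C : ℕ → ℝ := fun d => Nat.rec 2 (fun _ x => (x + 1) / p₀) d
  have hC : ∀ d, 0 ≤ C d := fun d => by
    induction d with
    | zero => exact zero_le_two
    | succ d ih => exact div_nonneg (by linarith) hp₀.le
  set A := ∑ d ∈ Finset.range (K + 1), C d
  have hA : 0 ≤ A := Finset.sum_nonneg fun d _ => hC d
  have main : ∀ ε > 0, ∀ᶠ n in atTop, L - A * ε ≤ r n := by
    intro ε hε
    have h1 : ∀ᶠ n in atTop, r n < L + ε := eventually_lt_of_limsup_lt (by linarith)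
    have h2 : ∀ᶠ n in atTop, e n < ε := h.summable.tendsto_atTop_zero.eventually_lt_const hε
    have h3 : ∀ᶠ n in atTop, ∑' i, e (i + n) < ε :=
      (tendsto_sum_nat_add e).eventually_lt_const hε
    obtain ⟨n₀, hn₀⟩ := eventually_atTop.1 (h1.and (h2.and h3))
    have h4 : ∃ᶠ n in atTop, L - ε < r n := frequently_lt_of_lt_limsup hbd'.isCoboundedUnder_le
      (by linarith)
    -- From a term close to the limsup, go back through a whole window that must be close as well;
    -- the margin keeps all indices beyond `n₀`. The window then bounds all later terms from below.
    obtain ⟨j, hj, hLj⟩ := (frequently_atTop.1 h4) (n₀ + (2 * K + 2))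
    have h5 : ∀ d ≤ K, L + ε - r (j - d) ≤ C d * ε := by
      intro d hd
      induction d with
      | zero =>
        have : C 0 = 2 := rfl
        rw [this, Nat.sub_zero]
        linarith
      | succ d ih =>
        have ih := ih (by omega)
        obtain ⟨n, hn⟩ : ∃ n, j - d = n + (K + 1) := ⟨j - d - (K + 1), by omega⟩
        have hn' : j - (d + 1) = n + K := by omega
        rw [hn] at ih
        rw [hn']
        have h6 := (abs_le.1 (h.abs_sub_le n)).2
        have h7 : ∑ d ∈ Finset.range (K + 1), p n d * r (n + d) ≤
            L + ε - p₀ * (L + ε - r (n + K)) := by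
          have h8 : ∑ d ∈ Finset.range K, p n d * r (n + d) ≤
              ∑ d ∈ Finset.range K, p n d * (L + ε) :=
            Finset.sum_le_sum fun d _ => mul_le_mul_of_nonneg_left
              (hn₀ (n + d) (by omega)).1.le (h.nonneg _ _)
          rw [← Finset.sum_mul] at h8
          have h9 := h.sum_eq n
          rw [Finset.sum_range_succ] at h9 ⊢
          have h10 := (hn₀ (n + K) (by omega)).1
          have h11 := mul_le_mul_of_nonneg_right (hp n) (sub_nonneg.2 h10.le)
          have h12 : ∑ d ∈ Finset.range K, p n d = 1 - p n K := by linarith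
          rw [h12] at h8
          linarith
        have h13 := (hn₀ n (by omega)).2.1
        have h14 : C (d + 1) = (C d + 1) / p₀ := rfl
        rw [h14, div_mul_eq_mul_div, le_div_iff₀ hp₀]
        linarith
    have h15 : ∀ d ≤ K, L + ε - A * ε ≤ r (j - K + d) := by
      intro d hd
      have h16 := h5 (K - d) (by omega)
      rw [show j - (K - d) = j - K + d by omega] at h16
      have h17 : C (K - d) ≤ A := Finset.single_le_sum (f := C) (fun d _ => hC d)
        (Finset.mem_range.2 (by omega))
      have := mul_le_mul_of_nonneg_right h17 hε.le
      linarith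
    filter_upwards [eventually_ge_atTop (j - K)] with n hn
    have h18 := h.le_of_window' h15 hn
    have h19 := (hn₀ (j - K) (by omega)).2.2
    linarith
  refine ⟨L, tendsto_order.2 ⟨fun a ha => ?_, fun a ha => eventually_lt_of_limsup_lt ha⟩⟩
  have hpos : 0 < (L - a) / (A + 1) := div_pos (by linarith) (by linarith)
  filter_upwards [main _ hpos] with n hn
  have : A * ((L - a) / (A + 1)) < L - a := by
    rw [mul_div_assoc', div_lt_iff₀ (by linarith)]
    nlinarith
  linarith

end IsAveraging

/-- Solutions of a linear recurrence with nonnegative coefficients and bounded inhomogeneity that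
tend to infinity are asymptotically proportional to a given geometrically growing solution of the
homogeneous recurrence. -/
theorem exists_tendsto_div_of_recurrence {K : ℕ} {β : ℕ → ℕ → ℝ} {T V θ : ℕ → ℝ}
    {E κ C β₀ : ℝ} (hβ : ∀ n d, 0 ≤ β n d) (hβ₀ : 0 < β₀) (hβK : ∀ n, β₀ ≤ β n K) (hκ : 0 < κ)
    (hθ : 0 ≤ θ 0) (hV : ∀ n, V n = θ (n + 1) - θ n)
    (hlow : ∀ n, κ * (1 + θ n) ≤ V n) (hup : ∀ n, V n ≤ C * (1 + θ n))
    (hVrec : ∀ n, V (n + (K + 1)) = ∑ d ∈ Finset.range (K + 1), β n d * V (n + d))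
    (hTrec : ∀ n, |T (n + (K + 1)) - ∑ d ∈ Finset.range (K + 1), β n d * T (n + d)| ≤ E)
    (hT : Tendsto T atTop atTop) : ∃ ρ > 0, Tendsto (fun n => T n / V n) atTop (𝓝 ρ) := by
  have hΘ : ∀ n, 1 ≤ 1 + θ n := by
    intro n
    induction n with
    | zero => linarith
    | succ n ih =>
      have h1 := hlow n
      have h2 := mul_pos hκ (zero_lt_one.trans_le ih)
      have := hV n
      linarith
  have hΘ0 : ∀ n, 0 < 1 + θ n := fun n => zero_lt_one.trans_le (hΘ n)
  have hV0 : ∀ n, 0 < V n := fun n => (mul_pos hκ (hΘ0 n)).trans_le (hlow n)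
  have hC : 0 < C := (mul_pos_iff_of_pos_right (hΘ0 0)).1 ((hV0 0).trans_le (hup 0))
  have hE : 0 ≤ E := (abs_nonneg _).trans (hTrec 0)
  have hgrow : ∀ n i, (1 + κ) ^ i * (1 + θ n) ≤ 1 + θ (n + i) := by
    intro n i
    induction i with
    | zero => simp
    | succ i ih =>
      have h1 := hlow (n + i)
      have h2 := hV (n + i)
      have h3 := mul_le_mul_of_nonneg_left ih (by linarith : 0 ≤ 1 + κ)
      rw [pow_succ', mul_assoc, ← add_assoc]
      linarith
  have hgrow' : ∀ n i, 1 + θ (n + i) ≤ (1 + C) ^ i * (1 + θ n) := by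
    intro n i
    induction i with
    | zero => simp
    | succ i ih =>
      have h1 := hup (n + i)
      have h2 := hV (n + i)
      have h3 := mul_le_mul_of_nonneg_left ih (by linarith : 0 ≤ 1 + C)
      rw [pow_succ', mul_assoc, ← add_assoc]
      linarith
  set r : ℕ → ℝ := fun n => T n / V n with hr
  set e : ℕ → ℝ := fun n => E / V (n + (K + 1)) with he
  -- Dividing the perturbed recurrence by the exact one turns the coefficients into probabilities.
  -- The errors `E / V` are summable because `V` grows geometrically.
  set p : ℕ → ℕ → ℝ := fun n d => β n d * V (n + d) / V (n + (K + 1)) with hp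
  have hgeom : Summable fun i : ℕ => ((1 + κ)⁻¹) ^ i :=
    summable_geometric_of_lt_one (by positivity) (inv_lt_one_of_one_lt₀ (by linarith))
  have he_le : ∀ n i, e (i + n) ≤ E / (κ * (1 + θ n)) * ((1 + κ)⁻¹) ^ i := by
    intro n i
    have h1 : (1 + κ) ^ i * (1 + θ n) ≤ 1 + θ (i + n + (K + 1)) := by
      rw [show i + n + (K + 1) = n + (i + (K + 1)) by ring]
      refine le_trans ?_ (hgrow n (i + (K + 1)))
      exact mul_le_mul_of_nonneg_right
        (pow_le_pow_right₀ (by linarith) (by omega)) (hΘ0 n).le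
    have h2 := (mul_le_mul_of_nonneg_left h1 hκ.le).trans (hlow _)
    have h3 : 0 < (1 + κ) ^ i := by positivity
    rw [inv_pow, ← div_eq_mul_inv, div_div]
    refine div_le_div_of_nonneg_left hE (by have := hΘ0 n; positivity) ?_
    linarith
  have hav : IsAveraging K p e r := by
    refine ⟨fun n d => ?_, fun n => ?_, ?_, fun n => ?_⟩
    · exact div_nonneg (mul_nonneg (hβ _ _) (hV0 _).le) (hV0 _).le
    · simp only [hp]
      rw [← Finset.sum_div, ← hVrec, div_self (hV0 _).ne']
    · refine Summable.of_nonneg_of_le (fun n => div_nonneg hE (hV0 _).le) (fun n => ?_)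
        (hgeom.mul_left (E / (κ * (1 + θ 0))))
      simpa using he_le 0 n
    · have h1 : r (n + (K + 1)) - ∑ d ∈ Finset.range (K + 1), p n d * r (n + d) =
          (T (n + (K + 1)) - ∑ d ∈ Finset.range (K + 1), β n d * T (n + d)) / V (n + (K + 1)) := by
        rw [sub_div, Finset.sum_div]
        congr 1
        refine Finset.sum_congr rfl fun d _ => ?_
        simp only [hp, hr]
        have := (hV0 (n + d)).ne'
        field_simp
      rw [h1, abs_div, abs_of_pos (hV0 _)]
      exact div_le_div_of_nonneg_right (hTrec n) (hV0 _).le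
  obtain ⟨ρ, hρ⟩ := hav.exists_tendsto (p₀ := β₀ / (C * (κ⁻¹ + 1))) (by positivity) fun n => by
    have h1 : V (n + (K + 1)) ≤ C * (κ⁻¹ + 1) * V (n + K) := by
      refine (hup _).trans ?_
      rw [mul_assoc]
      refine mul_le_mul_of_nonneg_left ?_ hC.le
      have h2 := hV (n + K)
      have h3 : 1 + θ (n + K) ≤ κ⁻¹ * V (n + K) := by
        rw [inv_mul_eq_div, le_div_iff₀ hκ]; linarith [hlow (n + K)]
      rw [← add_assoc]
      linarith
    rw [hp, div_le_div_iff₀ (by positivity) (hV0 _)]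
    have h4 := mul_le_mul_of_nonneg_left h1 hβ₀.le
    have h5 := mul_le_mul_of_nonneg_right (hβK n)
      (mul_nonneg (by positivity : 0 ≤ C * (κ⁻¹ + 1)) (hV0 (n + K)).le)
    linarith
  refine ⟨ρ, ?_, hρ⟩
  -- The errors after `n` add up to at most `G / (1 + θ n)`. As `T` tends to infinity, some window
  -- of ratios is at least `(G + 1) / (1 + θ n)`, so the limit stays positive.
  set G := E / κ * ∑' i : ℕ, ((1 + κ)⁻¹) ^ i with hG
  have hG0 : 0 ≤ G := mul_nonneg (by positivity) (tsum_nonneg fun i => by positivity)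
  obtain ⟨n, hn⟩ := eventually_atTop.1 (hT.eventually_ge_atTop (C * (1 + C) ^ K * (G + 1)))
  have htail : ∑' i, e (i + n) ≤ G / (1 + θ n) := by
    have h1 := (((summable_nat_add_iff n).2 hav.summable).tsum_le_tsum (he_le n)
      (hgeom.mul_left _))
    rw [tsum_mul_left] at h1
    refine h1.trans (le_of_eq ?_)
    rw [hG, ← div_div]
    ring
  have hwin : ∀ d ≤ K, (G + 1) / (1 + θ n) ≤ r (n + d) := by
    intro d hd
    have h1 : V (n + d) ≤ C * (1 + C) ^ K * (1 + θ n) := by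
      refine (hup _).trans ?_
      rw [mul_assoc]
      refine mul_le_mul_of_nonneg_left ((hgrow' n d).trans ?_) hC.le
      exact mul_le_mul_of_nonneg_right (pow_le_pow_right₀ (by linarith) hd) (hΘ0 n).le
    have h2 := hn (n + d) (by omega)
    simp only [hr]
    rw [div_le_div_iff₀ (hΘ0 n) (hV0 _)]
    have h3 := mul_le_mul_of_nonneg_left h1 (by linarith : 0 ≤ G + 1)
    have h4 := mul_le_mul_of_nonneg_right h2 (hΘ0 n).le
    linarith
  have hlim : (G + 1) / (1 + θ n) - ∑' i, e (i + n) ≤ ρ :=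
    ge_of_tendsto hρ ((eventually_ge_atTop n).mono fun j hj => hav.le_of_window' hwin hj)
  have : 0 < (G + 1) / (1 + θ n) - G / (1 + θ n) := by
    rw [← sub_div]
    exact div_pos (by linarith) (hΘ0 n)
  linarith

end Averages

/-! ### Limit sets: reparametrization and normalization -/

section LimitSets

theorem mapClusterPt_congr_of_tendsto_dist {α X : Type*} [PseudoMetricSpace X] {l : Filter α}
    {f g : α → X} (h : Tendsto (fun t => dist (f t) (g t)) l (𝓝 0)) (y : X) :
    MapClusterPt y l f ↔ MapClusterPt y l g := by
  have key : ∀ {f g : α → X}, Tendsto (fun t => dist (f t) (g t)) l (𝓝 0) →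
      MapClusterPt y l f → MapClusterPt y l g := by
    intro f g h hf
    obtain ⟨U, hU, hUf⟩ := mapClusterPt_iff_ultrafilter.1 hf
    exact mapClusterPt_iff_ultrafilter.2 ⟨U, hU, hUf.congr_dist (h.mono_left hU)⟩
  exact ⟨key h, key (by simpa only [dist_comm] using h)⟩

/-- The piecewise linear function with values `θ n` at the natural numbers `n`. -/
noncomputable def interpolate (θ : ℕ → ℝ) (τ : ℝ) : ℝ :=
  θ ⌊τ⌋₊ + (τ - ⌊τ⌋₊) * (θ (⌊τ⌋₊ + 1) - θ ⌊τ⌋₊)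

theorem interpolate_mem {θ : ℕ → ℝ} (hθ : StrictMono θ) {τ : ℝ} (hτ : 0 ≤ τ) :
    interpolate θ τ ∈ Icc (θ ⌊τ⌋₊) (θ (⌊τ⌋₊ + 1)) := by
  have h1 := sub_pos.2 (hθ (Nat.lt_succ_self ⌊τ⌋₊))
  have h2 := sub_nonneg.2 (Nat.floor_le hτ)
  have h3 := Nat.lt_floor_add_one τ
  rw [Nat.succ_eq_add_one] at h1
  unfold interpolate
  constructor <;> nlinarith

theorem exists_mem_Ico_of_tendsto {θ : ℕ → ℝ} (hθ : Tendsto θ atTop atTop) {t : ℝ}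
    (ht : θ 0 ≤ t) : ∃ n, t ∈ Ico (θ n) (θ (n + 1)) := by
  classical
  have h : ∃ n, t < θ (n + 1) :=
    ((tendsto_add_atTop_iff_nat 1).2 hθ).eventually_gt_atTop t |>.exists
  refine ⟨Nat.find h, ?_, Nat.find_spec h⟩
  rcases Nat.eq_zero_or_pos (Nat.find h) with h0 | h0
  · rwa [h0]
  · obtain ⟨n, hn⟩ := Nat.exists_eq_add_of_lt h0
    have := Nat.find_min h (m := n) (by omega)
    rw [show Nat.find h = n + 1 by omega]
    exact not_lt.1 this

/-- Equality of filters, and not only convergence, is needed so that measuring time in phases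
neither creates nor destroys cluster points. -/
theorem map_interpolate_atTop {θ : ℕ → ℝ} (hθ : StrictMono θ) (hθ' : Tendsto θ atTop atTop) :
    map (interpolate θ) atTop = atTop := by
  refine le_antisymm ?_ fun s hs => ?_
  · refine tendsto_atTop_mono' _ ?_ (hθ'.comp tendsto_nat_floor_atTop)
    filter_upwards [eventually_ge_atTop 0] with τ hτ
    exact (interpolate_mem hθ hτ).1
  · obtain ⟨a, ha⟩ := mem_atTop_sets.1 (mem_map.1 hs)
    refine mem_atTop_sets.2 ⟨θ ⌈a⌉₊, fun t ht => ?_⟩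
    obtain ⟨n, hn⟩ := exists_mem_Ico_of_tendsto hθ' ((hθ.monotone (Nat.zero_le _)).trans ht)
    have hna : ⌈a⌉₊ ≤ n := by
      have := hθ.lt_iff_lt.1 (ht.trans_lt hn.2)
      omega
    have hd := sub_pos.2 (hθ (Nat.lt_succ_self n))
    rw [Nat.succ_eq_add_one] at hd
    set z := (t - θ n) / (θ (n + 1) - θ n) with hz
    have hz0 : 0 ≤ z := div_nonneg (sub_nonneg.2 hn.1) hd.le
    have hz1 : z < 1 := (div_lt_one hd).2 (by linarith [hn.2])
    have hfl : ⌊(n : ℝ) + z⌋₊ = n := by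
      rw [Nat.floor_eq_iff (by positivity)]
      constructor <;> linarith
    have hmem := ha (n + z) (by
      have : (⌈a⌉₊ : ℝ) ≤ n := Nat.cast_le.2 hna
      linarith [Nat.le_ceil a])
    rw [mem_preimage, interpolate, hfl, add_sub_cancel_left, hz, div_mul_cancel₀ _ hd.ne',
      add_sub_cancel] at hmem
    exact hmem

variable {N : ℕ} {S : Fin N → Type v} [∀ i, Fintype (S i)]

/-- Normalization with respect to the Euclidean norm. -/
noncomputable def normalize (v : Vec S) : Vec S := (Real.sqrt (∑ i, ∑ s, v i s ^ 2))⁻¹ • v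

theorem normalize_smul {a : ℝ} (ha : 0 < a) (v : Vec S) : normalize (a • v) = normalize v := by
  unfold normalize
  have : ∑ i, ∑ s, (a • v) i s ^ 2 = a ^ 2 * ∑ i, ∑ s, v i s ^ 2 := by
    simp only [Finset.mul_sum, Pi.smul_apply, smul_eq_mul, mul_pow]
  rw [this, Real.sqrt_mul (sq_nonneg a), Real.sqrt_sq ha.le, smul_smul, mul_inv, mul_right_comm,
    inv_mul_cancel₀ ha.ne', one_mul]

theorem continuousOn_normalize : ContinuousOn (normalize : Vec S → Vec S) {v | v ≠ 0} := by
  unfold normalize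
  have hcont : Continuous fun v : Vec S => Real.sqrt (∑ i, ∑ s, v i s ^ 2) := by fun_prop
  refine ContinuousOn.smul (hcont.continuousOn.inv₀ fun v hv => ?_) continuousOn_id
  refine (Real.sqrt_pos.2 ?_).ne'
  obtain ⟨i, hi⟩ := Function.ne_iff.1 hv
  obtain ⟨s, hs⟩ := Function.ne_iff.1 hi
  have h1 : 0 < v i s ^ 2 := sq_pos_of_ne_zero hs
  have h2 : ∀ i, 0 ≤ ∑ s, v i s ^ 2 := fun i => Finset.sum_nonneg fun s _ => sq_nonneg _
  exact h1.trans_le ((Finset.single_le_sum (f := fun s => v i s ^ 2) (fun s _ => sq_nonneg _)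
    (Finset.mem_univ s)).trans (Finset.single_le_sum (f := fun i => ∑ s, v i s ^ 2)
    (fun i _ => h2 i) (Finset.mem_univ i)))

theorem normalizedLimitSet_eq (w : ℝ → Vec S) {φ : ℝ → ℝ} (hφ : map φ atTop = atTop) :
    normalizedLimitSet w = {y | MapClusterPt y atTop fun τ => normalize (w (φ τ))} := by
  ext y
  simp only [normalizedLimitSet, mem_ofPred_eq]
  conv_lhs => rw [← hφ]
  rfl

/-- Normalization is uniformly continuous on a compact shell around the origin, which eventually
contains both paths. -/
theorem tendsto_dist_normalize {a b : ℝ → Vec S} {δ C : ℝ} (hδ : 0 < δ)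
    (hb : ∀ᶠ t in atTop, δ ≤ ‖b t‖ ∧ ‖b t‖ ≤ C)
    (hab : Tendsto (fun t => ‖a t - b t‖) atTop (𝓝 0)) :
    Tendsto (fun t => dist (normalize (a t)) (normalize (b t))) atTop (𝓝 0) := by
  set A : Set (Vec S) := Metric.closedBall 0 (C + 1) ∩ {v | δ / 2 ≤ ‖v‖}
  have hA : IsCompact A := (isCompact_closedBall _ _).inter_right
    (isClosed_le continuous_const continuous_norm)
  have hu : UniformContinuousOn normalize A :=
    hA.uniformContinuousOn_of_continuous (continuousOn_normalize.mono fun v hv h => by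
      have h2 : δ / 2 ≤ ‖v‖ := hv.2
      rw [h, norm_zero] at h2
      linarith)
  rw [Metric.tendsto_nhds]
  intro ε hε
  obtain ⟨η, hη, H⟩ := Metric.uniformContinuousOn_iff.1 hu ε hε
  filter_upwards [hb, hab.eventually_lt_const (lt_min (half_pos hδ) (lt_min one_pos hη))]
    with t ht h2
  rw [lt_min_iff, lt_min_iff] at h2
  rw [dist_zero_right, Real.norm_of_nonneg dist_nonneg]
  have h3 := norm_sub_norm_le (b t) (a t)
  have h4 := norm_sub_norm_le (a t) (b t)
  rw [norm_sub_rev] at h3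
  refine H _ ⟨?_, ?_⟩ _ ⟨?_, ?_⟩ (by rw [dist_eq_norm]; exact h2.2.2)
  · rw [mem_closedBall_zero_iff]; linarith
  · show δ / 2 ≤ ‖a t‖; linarith
  · rw [mem_closedBall_zero_iff]; linarith
  · show δ / 2 ≤ ‖b t‖; linarith

end LimitSets

/-! ### The linear recurrence for the phase durations -/

section Recurrence

variable {N : ℕ} {S : Fin N → Type v} {u : Profile S → Fin N → ℝ} {K : ℕ} {c : ZMod K → Profile S}

theorem IsSinkCycle.exists_last_use (hc : IsSinkCycle u c) (hK : 2 < K) (k : ZMod K) :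
    ∃ D : ℕ, D + 1 < K ∧ c (k + D) (hc.mover k) = c (k + 1) (hc.mover k) ∧
      ∀ d, D < d → d < K → c (k + d) (hc.mover k) ≠ c (k + 1) (hc.mover k) := by
  classical
  set P : ℕ → Prop := fun d => c (k + d) (hc.mover k) = c (k + 1) (hc.mover k)
  have h1 : P 1 := by simp [P]
  have hlast : ¬ P (K - 1) := by
    have h2 := hc.ne_of_succ_mover hK (k - 1)
    rw [sub_add_cancel] at h2
    have h3 : k + ((K - 1 : ℕ) : ZMod K) = k - 1 := by
      rw [Nat.cast_sub (by omega)]; simp [sub_eq_add_neg]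
    simp only [P, h3]
    exact h2.symm
  have hD := Nat.findGreatest_spec (P := P) (n := K - 1) (by omega) h1
  refine ⟨Nat.findGreatest P (K - 1), ?_, hD, fun d hd hdK => ?_⟩
  · have h2 := Nat.findGreatest_le (P := P) (K - 1)
    have h3 : Nat.findGreatest P (K - 1) ≠ K - 1 := fun h => by rw [h] at hD; exact hlast hD
    omega
  · exact Nat.findGreatest_is_greatest hd (by omega)

variable [∀ i, Fintype (S i)]

/-- The change of a gap while a profile is played. -/
theorem IsCyclicPath.abs_gap_sub_le {κ E : ℝ} {w : ℝ → Vec S} {θ : ℕ → ℝ}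
    (h : IsCyclicPath u c κ E w θ) (hκ : 0 < κ) (i : Fin N) (q : S i) (n : ℕ) :
    |gap i (c (n + 1 : ℕ) i) q (w (θ (n + 1))) - gap i (c n i) q (w (θ n)) -
      (θ (n + 1) - θ n) * loss u (c n) i q| ≤ 2 * E := by
  have h1 := h.norm_le n (θ (n + 1)) ⟨(h.strictMono hκ (Nat.lt_succ_self n)).le, le_rfl⟩
  have h2 : w (θ (n + 1)) i (c (n + 1 : ℕ) i) = w (θ (n + 1)) i (c n i) :=
    le_antisymm (h.isMaxAt_succ n _ _) (h.isMaxAt (n + 1) _ _)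
  have h3 : ∀ s, |w (θ (n + 1)) i s - w (θ n) i s - (θ (n + 1) - θ n) * payoffVec u (c n) i s| ≤ E :=
    fun s => (norm_le_pi_norm ((w (θ (n + 1)) - w (θ n) -
      (θ (n + 1) - θ n) • payoffVec u (c n)) i) s).trans ((norm_le_pi_norm _ i).trans h1)
  have h4 := abs_le.1 (h3 (c n i))
  have h5 := abs_le.1 (h3 q)
  have h6 := IsSinkCycle.gap_payoffVec_self u (c n) i q
  simp only [gap_apply] at h6 ⊢
  rw [h2, ← h6, abs_le]
  constructor <;> linarith

theorem IsCyclicPath.abs_sum_le {κ E : ℝ} {w : ℝ → Vec S} {θ : ℕ → ℝ}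
    (h : IsCyclicPath u c κ E w θ) (hκ : 0 < κ) (i : Fin N) (q : S i) (n j : ℕ) :
    |gap i (c (n + j : ℕ) i) q (w (θ (n + j))) - gap i (c n i) q (w (θ n)) -
      ∑ d ∈ Finset.range j, (θ (n + d + 1) - θ (n + d)) * loss u (c (n + d : ℕ)) i q| ≤
      j * (2 * E) := by
  induction j with
  | zero => simp
  | succ j ih =>
    have h1 := abs_le.1 (h.abs_gap_sub_le hκ i q (n + j))
    have h2 := abs_le.1 ih
    rw [Finset.sum_range_succ, ← add_assoc, abs_le]
    push_cast at *
    constructor <;> linarith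

/-- The durations of play satisfy a linear recurrence with nonnegative coefficients, up to
bounded errors. -/
theorem IsSinkCycle.exists_recurrence {K : ℕ} {c : ZMod (K + 1) → Profile S}
    (hc : IsSinkCycle u c) (hK : 2 < K + 1) :
    ∃ β : ℕ → ℕ → ℝ, (∀ n d, 0 ≤ β n d) ∧ (∃ β₀ > 0, ∀ n, β₀ ≤ β n K) ∧ ∃ C,
      ∀ κ > 0, ∀ E w θ, IsCyclicPath u c κ E w θ → ∀ n,
        |(θ (n + (K + 1) + 1) - θ (n + (K + 1))) -
          ∑ d ∈ Finset.range (K + 1), β n d * (θ (n + d + 1) - θ (n + d))| ≤ C * E := by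
  choose D hD₁ hD₂ hD₃ using hc.exists_last_use hK
  -- The strategy adopted at `c k` is last used at index `k + D k`. It then loses ground until it is
  -- about to be adopted again one period later, where it recovers at rate `gain k`. Balancing the
  -- two gives the coefficients.
  set b : ZMod (K + 1) → ℕ → ℝ := fun k d => if D k < d ∧ d < K + 1 then
    loss u (c (k + d)) (hc.mover k) (c (k + 1) (hc.mover k)) / hc.gain k else 0 with hb
  have hgain := hc.gain_pos hK
  have hbpos : ∀ k d, D k < d → d < K + 1 → 0 < b k d := by
    intro k d h1 h2
    simp only [hb, h1, h2, and_self, if_true]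
    refine div_pos (hc.loss_pos (hD₃ k d h1 h2).symm ?_) (hgain k)
    by_cases hd : d + 1 < K + 1
    · have := hD₃ k (d + 1) (by omega) hd
      rw [Nat.cast_succ, ← add_assoc] at this
      exact this.symm
    · have hd' : d = K := by omega
      subst hd'
      have h3 : k + (d : ZMod (d + 1)) + 1 = k := by
        rw [add_assoc, ← Nat.cast_succ, Nat.succ_eq_add_one, ZMod.natCast_self, add_zero]
      rw [h3]
      exact hc.succ_mover_ne k
  have hK' : ∀ k, 0 < b k K := fun k => hbpos k K (by have := hD₁ k; omega) (by omega)
  refine ⟨fun n d => b n d, fun n d => ?_, ?_, ?_⟩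
  · by_cases h : D n < d ∧ d < K + 1
    · exact (hbpos _ _ h.1 h.2).le
    · simp only [hb, if_neg h, le_refl]
  · obtain ⟨k₀, hk₀⟩ := Finite.exists_min fun k => b k K
    exact ⟨b k₀ K, hK' k₀, fun n => hk₀ n⟩
  · obtain ⟨k₀, hk₀⟩ := Finite.exists_min fun k => hc.gain k
    refine ⟨(K + 2) * 2 / hc.gain k₀, fun κ hκ E w θ h n => ?_⟩
    have hE : 0 ≤ E := (norm_nonneg _).trans
      (h.norm_le 0 (θ 0) ⟨le_rfl, (h.strictMono hκ (Nat.lt_succ_self 0)).le⟩)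
    set k : ZMod (K + 1) := (n : ZMod (K + 1)) with hk
    set i := hc.mover k
    set q := c (k + 1) i
    obtain ⟨j, hj⟩ : ∃ j, K = D k + j + 1 := ⟨K - D k - 1, by have := hD₁ k; omega⟩
    -- The sum runs from the last use through the end of the phase in which the strategy catches up.
    -- The gap is zero at both ends, since `q` belongs to the profile there; the first phase
    -- contributes nothing and the last contributes `-gain`.
    have h1 := h.abs_sum_le hκ i q (n + D k) (j + 3)
    have hcastK : ((n + (K + 1) : ℕ) : ZMod (K + 1)) = k := by
      rw [Nat.cast_add, ZMod.natCast_self, add_zero]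
    have hcastD : ((n + D k : ℕ) : ZMod (K + 1)) = k + D k := by push_cast; rfl
    have hidx : n + D k + (j + 3) = n + (K + 1) + 1 := by omega
    rw [hidx, Nat.cast_succ, hcastK, hcastD, hD₂ k] at h1
    simp only [gap_apply, q, i, sub_self] at h1
    rw [zero_sub, abs_neg, Finset.sum_range_succ, Finset.sum_range_succ',
      show n + D k + (j + 2) = n + (K + 1) by omega, hcastK, hc.loss_mover, add_zero, hcastD,
      ← hD₂ k] at h1
    have hloss : loss u (c (k + D k)) (hc.mover k) (c (k + D k) (hc.mover k)) = 0 := by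
      rw [loss, Function.update_eq_self, sub_self]
    rw [hloss, mul_zero, add_zero, hD₂ k] at h1
    have hsum : ∑ d ∈ Finset.range (K + 1), b k d * (θ (n + d + 1) - θ (n + d)) =
        (∑ d ∈ Finset.range (j + 1), (θ (n + D k + (d + 1) + 1) - θ (n + D k + (d + 1))) *
          loss u (c (n + D k + (d + 1) : ℕ)) (hc.mover k) (c (k + 1) (hc.mover k))) / hc.gain k := by
      have hr : Finset.range (K + 1) = Finset.range ((D k + 1) + (j + 1)) :=
        congrArg _ (by omega)
      rw [hr, Finset.sum_range_add, Finset.sum_div]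
      rw [Finset.sum_eq_zero (fun d hd => ?_), zero_add]
      · refine Finset.sum_congr rfl fun d hd => ?_
        rw [Finset.mem_range] at hd
        have h2 : D k < D k + 1 + d ∧ D k + 1 + d < K + 1 := by omega
        have h3 : ((n + D k + (d + 1) : ℕ) : ZMod (K + 1)) = k + ((D k + 1 + d : ℕ)) := by
          push_cast; rw [← hk]; ring
        have h4 : n + D k + (d + 1) = n + (D k + 1 + d) := by ring
        rw [h3, h4]
        simp only [hb, if_pos h2]
        ring
      · rw [Finset.mem_range] at hd
        have h2 : ¬ (D k < d ∧ d < K + 1) := by omega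
        simp only [hb, if_neg h2, zero_mul]
    rw [hsum]
    have hg := hgain k
    have h5 : ∀ X T : ℝ, T - X / hc.gain k = -((X + T * -hc.gain k) / hc.gain k) := by
      intro X T; field_simp; ring
    rw [h5, abs_neg, abs_div, abs_of_pos hg, div_le_iff₀ hg]
    refine h1.trans ?_
    have h6 : ((j + 3 : ℕ) : ℝ) ≤ K + 2 := by exact_mod_cast (by omega : j + 3 ≤ K + 2)
    have h7 : (K + 2) * 2 * E ≤ (K + 2) * 2 / hc.gain k₀ * E * hc.gain k := by
      rw [div_mul_eq_mul_div, div_mul_eq_mul_div, le_div_iff₀ (hgain k₀)]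
      exact mul_le_mul_of_nonneg_left (hk₀ k) (by positivity)
    have h8 := mul_le_mul_of_nonneg_right h6 (by positivity : 0 ≤ 2 * E)
    linarith

end Recurrence

/-! ### Comparison with an exact best-response path -/

section Comparison

variable {N : ℕ} {S : Fin N → Type v} {u : Profile S → Fin N → ℝ} {K : ℕ} {c : ZMod K → Profile S}
  [∀ i, Fintype (S i)]

namespace IsCyclicPath

variable {κ κ' E : ℝ} {w w' : ℝ → Vec S} {θ θ' : ℕ → ℝ}

theorem tendsto_sub (h : IsCyclicPath u c κ E w θ) (hκ : 0 < κ) :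
    Tendsto (fun n => θ (n + 1) - θ n) atTop atTop :=
  tendsto_atTop_mono h.grow ((tendsto_const_nhds.add_atTop (h.tendsto hκ)).const_mul_atTop hκ)

/-- The next target gains at a rate bounded below, and by linear growth of the payoffs the gap to be
closed is at most of order `1 + θ n`. -/
theorem sub_le (hc : IsSinkCycle u c) (hK : 2 < K) [NeZero K] (h : IsCyclicPath u c κ 0 w θ)
    (hκ : 0 < κ) {C : ℝ} (hw : ∀ t, 0 ≤ t → ‖w t‖ ≤ C * (1 + t)) :
    ∃ C', ∀ n, θ (n + 1) - θ n ≤ C' * (1 + θ n) := by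
  obtain ⟨k₀, hk₀⟩ := Finite.exists_min fun k => hc.gain k
  have hg := hc.gain_pos hK
  refine ⟨2 * C / hc.gain k₀, fun n => ?_⟩
  set i := hc.mover n with hi
  have h1 := h.abs_gap_sub_le hκ i (c (n + 1) i) n
  have hθ := h.le_apply hκ n
  have h2 : ∀ s, |w (θ n) i s| ≤ C * (1 + θ n) := fun s =>
    (norm_le_pi_norm (w (θ n) i) s).trans ((norm_le_pi_norm _ i).trans (hw _ hθ.2))
  rw [hi, hc.loss_mover] at h1
  simp only [gap_apply, Nat.cast_succ, sub_self] at h1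
  have h3 := (abs_le.1 h1).2
  have h4 := (abs_le.1 (h2 (c n i))).2
  have h5 := (abs_le.1 (h2 (c (n + 1) i))).1
  have h6 := sub_pos.2 (h.strictMono hκ (Nat.lt_succ_self n))
  rw [Nat.succ_eq_add_one] at h6
  rw [div_mul_eq_mul_div, le_div_iff₀ (hg k₀)]
  have h7 := mul_le_mul_of_nonneg_left (hk₀ n) h6.le
  linarith

/-- The durations of play along two cyclic paths are asymptotically proportional. -/
theorem exists_tendsto_ratio (hc : IsSinkCycle u c) (hK : 2 < K)
    (h : IsCyclicPath u c κ E w θ) (hκ : 0 < κ) (h' : IsCyclicPath u c κ' 0 w' θ') (hκ' : 0 < κ')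
    {C : ℝ} (hup : ∀ n, θ' (n + 1) - θ' n ≤ C * (1 + θ' n)) :
    ∃ ρ > 0, Tendsto (fun n => (θ (n + 1) - θ n) / (θ' (n + 1) - θ' n)) atTop (𝓝 ρ) := by
  obtain ⟨K, rfl⟩ : ∃ K', K = K' + 1 := ⟨K - 1, by omega⟩
  obtain ⟨β, hβ, ⟨β₀, hβ₀, hβK⟩, C', hrec⟩ := hc.exists_recurrence hK
  refine exists_tendsto_div_of_recurrence (T := fun n => θ (n + 1) - θ n)
    (V := fun n => θ' (n + 1) - θ' n) hβ hβ₀ hβK hκ' h'.zero.ge (fun _ => rfl) h'.grow hup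
    (fun n => ?_) (hrec κ hκ E w θ h) (h.tendsto_sub hκ)
  have := hrec κ' hκ' 0 w' θ' h' n
  rw [mul_zero] at this
  exact sub_eq_zero.1 (abs_nonpos_iff.1 this)

theorem interpolate_sub_le (h : IsCyclicPath u c κ E w θ) (hκ : 0 < κ)
    (h' : IsCyclicPath u c κ' 0 w' θ') (hκ' : 0 < κ') (ρ : ℝ) {τ : ℝ} (hτ : 0 ≤ τ) {n : ℕ}
    (hn : n = ⌊τ⌋₊) :
    ‖w (interpolate θ τ) - ρ • w' (interpolate θ' τ)‖ ≤ ‖w (θ n) - ρ • w' (θ' n)‖ +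
      |(θ (n + 1) - θ n) - ρ * (θ' (n + 1) - θ' n)| * payoffBound u + E := by
  have h1 := h.norm_le n _ (by rw [hn]; exact interpolate_mem (h.strictMono hκ) hτ)
  have h2 := h'.norm_le n _ (by rw [hn]; exact interpolate_mem (h'.strictMono hκ') hτ)
  rw [norm_le_zero_iff, sub_eq_zero] at h2
  have hz0 : 0 ≤ τ - n := by rw [hn]; exact sub_nonneg.2 (Nat.floor_le hτ)
  have hz1 : τ - n ≤ 1 := by rw [hn]; linarith [Nat.lt_floor_add_one τ]
  have e1 : interpolate θ τ - θ n = (τ - n) * (θ (n + 1) - θ n) := by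
    rw [interpolate, ← hn]; ring
  have e2 : interpolate θ' τ - θ' n = (τ - n) * (θ' (n + 1) - θ' n) := by
    rw [interpolate, ← hn]; ring
  rw [e1] at h1
  rw [e2] at h2
  have e3 : w (interpolate θ τ) - ρ • w' (interpolate θ' τ) = (w (θ n) - ρ • w' (θ' n)) +
      ((τ - n) * ((θ (n + 1) - θ n) - ρ * (θ' (n + 1) - θ' n))) • payoffVec u (c n) +
      (w (interpolate θ τ) - w (θ n) - ((τ - n) * (θ (n + 1) - θ n)) • payoffVec u (c n)) := by
    rw [eq_add_of_sub_eq h2]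
    module
  rw [e3]
  refine (norm_add_le _ _).trans (add_le_add ((norm_add_le _ _).trans (add_le_add_right ?_ _)) h1)
  rw [norm_smul, Real.norm_eq_abs, abs_mul, abs_of_nonneg hz0]
  refine mul_le_mul ?_ (norm_payoffVec_le u _) (norm_nonneg _) (abs_nonneg _)
  exact mul_le_of_le_one_left (abs_nonneg _) hz1

/-- Along asymptotically proportional cyclic paths, the payoffs are asymptotically
proportional. -/
theorem isLittleO_sub (h : IsCyclicPath u c κ E w θ) (hκ : 0 < κ)
    (h' : IsCyclicPath u c κ' 0 w' θ') (hκ' : 0 < κ') {ρ : ℝ}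
    (hρ : Tendsto (fun n => (θ (n + 1) - θ n) / (θ' (n + 1) - θ' n)) atTop (𝓝 ρ)) :
    Tendsto (fun n => ‖w (θ n) - ρ • w' (θ' n)‖ / (1 + θ' n)) atTop (𝓝 0) := by
  set x : ℕ → Vec S := fun n => w (θ n) - ρ • w' (θ' n) with hx
  set V : ℕ → ℝ := fun n => θ' (n + 1) - θ' n with hV
  have hV0 : ∀ n, 0 < V n := fun n => sub_pos.2 (h'.strictMono hκ' (Nat.lt_succ_self n))
  have hstep : ∀ n, ‖x (n + 1) - x n‖ ≤
      (|(θ (n + 1) - θ n) / V n - ρ| * payoffBound u + E / V n) * V n := by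
    intro n
    have h1 := h.norm_le n _ ⟨(h.strictMono hκ (Nat.lt_succ_self n)).le, le_rfl⟩
    have h2 := h'.norm_le n _ ⟨(h'.strictMono hκ' (Nat.lt_succ_self n)).le, le_rfl⟩
    rw [norm_le_zero_iff] at h2
    have e : x (n + 1) - x n = (((θ (n + 1) - θ n) / V n - ρ) * V n) • payoffVec u (c n) +
        (w (θ (n + 1)) - w (θ n) - (θ (n + 1) - θ n) • payoffVec u (c n)) := by
      rw [sub_mul, div_mul_cancel₀ _ (hV0 n).ne']
      have h3 : w' (θ' (n + 1)) = w' (θ' n) + V n • payoffVec u (c n) := by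
        rw [sub_sub, sub_eq_zero] at h2; exact h2
      simp only [hx, h3]
      module
    rw [e, add_mul, div_mul_cancel₀ _ (hV0 n).ne']
    refine (norm_add_le _ _).trans (add_le_add ?_ h1)
    rw [norm_smul, Real.norm_eq_abs, abs_mul, abs_of_pos (hV0 n), mul_right_comm]
    exact mul_le_mul_of_nonneg_right
      (mul_le_mul_of_nonneg_left (norm_payoffVec_le u _) (abs_nonneg _)) (hV0 n).le
  have hlim : Tendsto (fun n => |(θ (n + 1) - θ n) / V n - ρ| * payoffBound u + E / V n)
      atTop (𝓝 0) := by
    have h1 : Tendsto (fun n => |(θ (n + 1) - θ n) / V n - ρ|) atTop (𝓝 |ρ - ρ|) :=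
      (hρ.sub_const ρ).abs
    have h2 := (h1.mul_const (payoffBound u)).add ((h'.tendsto_sub hκ').const_div_atTop E)
    simpa using h2
  -- Increments small relative to `V` sum to something small relative to the sum of `V`, which is
  -- `θ'`.
  have hlo : (fun n => x (n + 1) - x n) =o[atTop] V := by
    rw [Asymptotics.isLittleO_iff]
    intro ε hε
    filter_upwards [hlim.eventually_lt_const hε] with n hn
    rw [Real.norm_of_nonneg (hV0 n).le]
    exact (hstep n).trans (mul_le_mul_of_nonneg_right hn.le (hV0 n).le)
  have hsumV : ∀ n, ∑ i ∈ Finset.range n, V i = θ' n := fun n => by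
    rw [Finset.sum_range_sub, h'.zero, sub_zero]
  have hsum := hlo.sum_range (fun n => (hV0 n).le) (by
    simp only [hsumV]; exact h'.tendsto hκ')
  simp only [hsumV, Finset.sum_range_sub] at hsum
  have hΘ : Tendsto (fun n => 1 + θ' n) atTop atTop := tendsto_const_nhds.add_atTop (h'.tendsto hκ')
  have hθ0 : ∀ n, 0 < 1 + θ' n := fun n => by linarith [(h'.le_apply hκ' n).2]
  have h3 : x =o[atTop] fun n => 1 + θ' n := by
    have h4 : (fun n => x n - x 0) =o[atTop] fun n => 1 + θ' n :=
      hsum.trans_le fun n => by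
        rw [Real.norm_of_nonneg (h'.le_apply hκ' n).2, Real.norm_of_nonneg (hθ0 n).le]
        linarith
    have h5 : (fun _ : ℕ => x 0) =o[atTop] fun n => 1 + θ' n :=
      Asymptotics.isLittleO_const_left.2 (.inr (tendsto_norm_atTop_atTop.comp hΘ))
    simpa using h4.add h5
  exact h3.norm_left.tendsto_div_nhds_zero

/-- With time measured in phases, `w / ρ` and `w'` differ by `o(1 + θ')`, while `w'` has exact
linear order. After division by `1 + θ'` both lie in a compact shell, and normalization ignores the
positive factors. -/
theorem normalizedLimitSet_eq (hc : IsSinkCycle u c) (hK : 2 < K)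
    (h : IsCyclicPath u c κ E w θ) (hκ : 0 < κ) (h' : IsCyclicPath u c κ' 0 w' θ') (hκ' : 0 < κ')
    {δ C : ℝ} (hδ : 0 < δ) (hw' : ∀ t, 0 ≤ t → δ * (1 + t) ≤ ‖w' t‖ ∧ ‖w' t‖ ≤ C * (1 + t)) :
    normalizedLimitSet w = normalizedLimitSet w' := by
  have : NeZero K := ⟨by omega⟩
  obtain ⟨C', hC'⟩ := h'.sub_le hc hK hκ' fun t ht => (hw' t ht).2
  obtain ⟨ρ, hρ0, hρ⟩ := h.exists_tendsto_ratio hc hK hκ h' hκ' hC'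
  have hm := h.strictMono hκ
  have hm' := h'.strictMono hκ'
  have hθ0 : ∀ n, 0 < 1 + θ' n := fun n => by linarith [(h'.le_apply hκ' n).2]
  have hΘ : Tendsto (fun n => 1 + θ' n) atTop atTop := tendsto_const_nhds.add_atTop (h'.tendsto hκ')
  rw [NGame.normalizedLimitSet_eq w (map_interpolate_atTop hm (h.tendsto hκ)),
    NGame.normalizedLimitSet_eq w' (map_interpolate_atTop hm' (h'.tendsto hκ'))]
  have hpos : ∀ τ, 0 ≤ τ → 0 < 1 + interpolate θ' τ ∧ θ' ⌊τ⌋₊ ≤ interpolate θ' τ := fun τ hτ => by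
    have h1 := (interpolate_mem hm' hτ).1
    exact ⟨by linarith [hθ0 ⌊τ⌋₊], h1⟩
  have hb : Tendsto (fun n : ℕ => (‖w (θ n) - ρ • w' (θ' n)‖ +
      |(θ (n + 1) - θ n) - ρ * (θ' (n + 1) - θ' n)| * payoffBound u + E) / (1 + θ' n))
      atTop (𝓝 0) := by
    have h1 := h.isLittleO_sub hκ h' hκ' hρ
    have h2 : Tendsto (fun n => |(θ (n + 1) - θ n) - ρ * (θ' (n + 1) - θ' n)| / (1 + θ' n))
        atTop (𝓝 0) := by
      have h3 : Tendsto (fun n => |(θ (n + 1) - θ n) / (θ' (n + 1) - θ' n) - ρ| * C') atTop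
          (𝓝 0) := by
        have := ((hρ.sub_const ρ).abs.mul_const C')
        simpa using this
      refine squeeze_zero (fun n => div_nonneg (abs_nonneg _) (hθ0 n).le) (fun n => ?_) h3
      have hV := sub_pos.2 (hm' (Nat.lt_succ_self n))
      rw [Nat.succ_eq_add_one] at hV
      rw [div_le_iff₀ (hθ0 n), mul_assoc]
      have e : (θ (n + 1) - θ n) - ρ * (θ' (n + 1) - θ' n) =
          ((θ (n + 1) - θ n) / (θ' (n + 1) - θ' n) - ρ) * (θ' (n + 1) - θ' n) := by
        rw [sub_mul, div_mul_cancel₀ _ hV.ne']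
      rw [e, abs_mul, abs_of_pos hV]
      exact mul_le_mul_of_nonneg_left (hC' n) (abs_nonneg _)
    have h4 := (h1.add (h2.mul_const (payoffBound u))).add (hΘ.const_div_atTop E)
    simp only [zero_mul, add_zero] at h4
    refine h4.congr fun n => ?_
    ring
  have hab : Tendsto (fun τ => ‖(ρ⁻¹ * (1 + interpolate θ' τ)⁻¹) • w (interpolate θ τ) -
      (1 + interpolate θ' τ)⁻¹ • w' (interpolate θ' τ)‖) atTop (𝓝 0) := by
    have h5 := (hb.comp (tendsto_nat_floor_atTop (α := ℝ))).const_mul ρ⁻¹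
    rw [mul_zero] at h5
    refine squeeze_zero' (Eventually.of_forall fun _ => norm_nonneg _) ?_ h5
    filter_upwards [eventually_ge_atTop 0] with τ hτ
    have h6 := h.interpolate_sub_le hκ h' hκ' ρ hτ rfl
    obtain ⟨h7, h8⟩ := hpos τ hτ
    have e : (ρ⁻¹ * (1 + interpolate θ' τ)⁻¹) • w (interpolate θ τ) -
        (1 + interpolate θ' τ)⁻¹ • w' (interpolate θ' τ) =
        (ρ⁻¹ * (1 + interpolate θ' τ)⁻¹) •
          (w (interpolate θ τ) - ρ • w' (interpolate θ' τ)) := by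
      rw [smul_sub, smul_smul]
      congr 2
      field_simp
    rw [e, norm_smul, Real.norm_of_nonneg (by positivity), mul_assoc]
    refine mul_le_mul_of_nonneg_left ?_ (by positivity)
    rw [inv_mul_eq_div]
    exact div_le_div₀ ((norm_nonneg _).trans h6) h6 (hθ0 _) (by linarith)
  have hbd : ∀ᶠ τ in atTop, δ ≤ ‖(1 + interpolate θ' τ)⁻¹ • w' (interpolate θ' τ)‖ ∧
      ‖(1 + interpolate θ' τ)⁻¹ • w' (interpolate θ' τ)‖ ≤ C := by
    filter_upwards [eventually_ge_atTop 0] with τ hτ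
    obtain ⟨h7, h8⟩ := hpos τ hτ
    have h9 := hw' (interpolate θ' τ) ((h'.le_apply hκ' _).2.trans h8)
    rw [norm_smul, norm_inv, Real.norm_of_nonneg h7.le, inv_mul_eq_div, le_div_iff₀ h7,
      div_le_iff₀ h7]
    exact h9
  have hmain := tendsto_dist_normalize hδ hbd hab
  ext y
  refine mapClusterPt_congr_of_tendsto_dist (hmain.congr' ?_) y
  filter_upwards [eventually_ge_atTop 0] with τ hτ
  have h7 := inv_pos.2 (hpos τ hτ).1
  rw [normalize_smul (mul_pos (inv_pos.2 hρ0) h7), normalize_smul h7]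

end IsCyclicPath

end Comparison

/-! ### Construction of exact best-response paths -/

section BestResponse

variable {N : ℕ} {S : Fin N → Type v} {u : Profile S → Fin N → ℝ} {K : ℕ} {c : ZMod K → Profile S}

namespace IsSinkCycle

/-- The piece of a best-response path along which one profile of the cycle is played. -/
theorem LevelSystem.exists_step {hc : IsSinkCycle u c} (Λ : hc.LevelSystem) (hK : 2 < K)
    {k : ZMod K} {m : ℝ} {w : Vec S} (hm : 0 < m) (hmax : IsMaxAt (c (k + 1)) w)
    (hlev : HasLevel (Λ.I k) m w) (hmove : Λ.δ * m ≤ hc.moveGap k w) :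
    ∃ T, Λ.δ * m ≤ T * hc.gain (k + 1) ∧
      hc.moveGap k (w + T • payoffVec u (c (k + 1))) = 0 ∧
      IsMaxAt (c (k + 1)) (w + T • payoffVec u (c (k + 1))) ∧
      IsMaxAt (c (k + 1 + 1)) (w + T • payoffVec u (c (k + 1))) ∧
      HasLevel (Λ.I (k + 1)) m (w + T • payoffVec u (c (k + 1))) ∧
      Λ.δ * m ≤ hc.moveGap (k + 1) (w + T • payoffVec u (c (k + 1))) := by
  have hg := hc.gain_pos hK (k + 1)
  have hδm : 0 < Λ.δ * m := mul_pos Λ.δ_pos hm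
  -- Playing `c (k + 1)` lowers `moveGap` at rate `gain`, so this is the time of the next tie.
  set T := hc.moveGap k w / hc.gain (k + 1) with hT
  have hT0 : 0 < T := div_pos (hδm.trans_le hmove) hg
  have hTg : T * hc.gain (k + 1) = hc.moveGap k w := div_mul_cancel₀ _ hg.ne'
  set w' := w + T • payoffVec u (c (k + 1)) with hw'
  have h0 : hc.moveGap k w' = 0 := by
    rw [hw', map_add, map_smul, hc.moveGap_payoffVec_self, smul_eq_mul]
    linarith
  have hmax' : IsMaxAt (c (k + 1)) w' := by
    intro i s
    by_cases hs₁ : s = c (k + 1) i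
    · rw [hs₁]
    by_cases hs₂ : s = c (k + 1 + 1) i
    · subst hs₂
      obtain rfl := hc.eq_mover hs₁
      rw [moveGap, gap_apply] at h0
      linarith
    · have h1 := mul_pos hT0 (hc.loss_pos hs₁ hs₂)
      rw [← gap_payoffVec_self, gap_apply] at h1
      have h2 := hmax i s
      simp only [hw', Pi.add_apply, Pi.smul_apply, smul_eq_mul]
      linarith
  have htie : w' (hc.mover (k + 1)) (c (k + 1) (hc.mover (k + 1))) =
      w' (hc.mover (k + 1)) (c (k + 1 + 1) (hc.mover (k + 1))) := by
    rw [moveGap, gap_apply] at h0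
    linarith
  have hlev' : HasLevel (Λ.I (k + 1)) m w' := by
    have h1 : HasLevel (Λ.I k) m w' := fun x hx => by
      have h2 := hlev x hx
      have h3 := mul_pos hT0 (Λ.rate_pos k x hx).2
      rw [hw', map_add, map_smul, smul_eq_mul]
      linarith
    refine (Λ.step k m w' hm h1 (by rwa [h0])).mono (Λ.nonneg _) ?_
    have := mul_pos Λ.δ_pos hm
    linarith
  exact ⟨T, by rwa [hTg], h0, hmax', hc.isMaxAt_of_tie hmax' htie, hlev',
    Λ.moveGap_of_level _ m w' hm hlev' htie.symm⟩

end IsSinkCycle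

variable [∀ i, Fintype (S i)]

/-- Concatenations of pieces of best-response paths are solutions. -/
theorem isPayoffBRDSolution_of_pieces {w : ℝ → Vec S} {p : ℕ → Profile S} {θ : ℕ → ℝ}
    (h0 : θ 0 = 0) (hθ : StrictMono θ) (hθ' : Tendsto θ atTop atTop)
    (hw : ∀ n, ∀ t ∈ Icc (θ n) (θ (n + 1)), w t = w (θ n) + (t - θ n) • payoffVec u (p n))
    (hmax : ∀ n, IsMaxAt (p n) (w (θ n)) ∧ IsMaxAt (p n) (w (θ (n + 1)))) :
    IsPayoffBRDSolution u w := by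
  have hlt : ∀ n, θ n < θ (n + 1) := fun n => hθ (Nat.lt_succ_self n)
  have hP := payoffBound_nonneg u
  have hlip : ∀ n, ∀ s t, 0 ≤ s → s ≤ t → t ≤ θ n → ‖w t - w s‖ ≤ payoffBound u * (t - s) := by
    have hseg : ∀ n s t, θ n ≤ s → s ≤ t → t ≤ θ (n + 1) →
        ‖w t - w s‖ ≤ payoffBound u * (t - s) := by
      intro n s t hs hst ht
      rw [hw n t ⟨hs.trans hst, ht⟩, hw n s ⟨hs, hst.trans ht⟩]
      have : w (θ n) + (t - θ n) • payoffVec u (p n) - (w (θ n) + (s - θ n) • payoffVec u (p n)) =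
          (t - s) • payoffVec u (p n) := by module
      rw [this, norm_smul, Real.norm_of_nonneg (sub_nonneg.2 hst), mul_comm]
      exact mul_le_mul_of_nonneg_right (norm_payoffVec_le u _) (sub_nonneg.2 hst)
    intro n
    induction n with
    | zero =>
      intro s t hs hst ht
      rw [h0] at ht
      obtain rfl : t = s := by linarith
      simp
    | succ n ih =>
      intro s t hs hst ht
      rcases le_total t (θ n) with h | h
      · exact ih s t hs hst h
      rcases le_total (θ n) s with h' | h'
      · exact hseg n s t h' hst ht
      have h1 := ih s (θ n) hs h' le_rfl
      have h2 := hseg n (θ n) t le_rfl h ht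
      have h3 := norm_add_le (w t - w (θ n)) (w (θ n) - w s)
      rw [sub_add_sub_cancel] at h3
      linarith
  refine ⟨fun T hT => ?_, ?_⟩
  · obtain ⟨n, hn⟩ := exists_mem_Ico_of_tendsto hθ' (h0.trans_le hT)
    refine LipschitzOnWith.absolutelyContinuousOnInterval (K := ⟨payoffBound u, hP⟩) ?_
    rw [uIcc_of_le hT]
    refine LipschitzOnWith.of_dist_le_mul fun x hx y hy => ?_
    change dist (w x) (w y) ≤ payoffBound u * dist x y
    rcases le_total x y with h | h
    · rw [dist_comm, dist_comm x, dist_eq_norm, Real.dist_eq, abs_of_nonneg (sub_nonneg.2 h)]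
      exact hlip (n + 1) x y hx.1 h (hy.2.trans hn.2.le)
    · rw [dist_eq_norm, Real.dist_eq, abs_of_nonneg (sub_nonneg.2 h)]
      exact hlip (n + 1) y x hy.1 h (hx.2.trans hn.2.le)
  · rw [ae_restrict_iff' measurableSet_Ici]
    filter_upwards [(countable_range θ).ae_notMem volume] with t ht ht0
    obtain ⟨n, hn⟩ := exists_mem_Ico_of_tendsto hθ' (h0.trans_le ht0)
    have hn' : θ n < t := lt_of_le_of_ne hn.1 fun h => ht ⟨n, h⟩
    refine ⟨pureVec (p n), pureVec_mem fun i => ?_, fun i s => ?_⟩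
    · intro s
      have hz : 0 ≤ (t - θ n) / (θ (n + 1) - θ n) :=
        div_nonneg (by linarith) (sub_pos.2 (hlt n)).le
      have hz1 : (t - θ n) / (θ (n + 1) - θ n) ≤ 1 :=
        (div_le_one (sub_pos.2 (hlt n))).2 (by linarith [hn.2])
      have h1 : ∀ r, w t i r = w (θ n) i r + (t - θ n) / (θ (n + 1) - θ n) *
          (w (θ (n + 1)) i r - w (θ n) i r) := fun r => by
        rw [hw n t ⟨hn.1, hn.2.le⟩, hw n (θ (n + 1)) ⟨(hlt n).le, le_rfl⟩]
        simp only [Pi.add_apply, Pi.smul_apply, smul_eq_mul, add_sub_cancel_left]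
        rw [← mul_assoc, div_mul_cancel₀ _ (sub_pos.2 (hlt n)).ne']
      rw [h1, h1]
      have h2 := mul_le_mul_of_nonneg_left ((hmax n).2 i s) hz
      have h3 := mul_le_mul_of_nonneg_left ((hmax n).1 i s) (sub_nonneg.2 hz1)
      linarith
    · rw [stratUtility_pureVec]
      have h1 : HasDerivAt (fun τ => w (θ n) i s + (τ - θ n) * payoffVec u (p n) i s)
          (1 * payoffVec u (p n) i s) t :=
        (((hasDerivAt_id t).sub_const (θ n)).mul_const _).const_add _
      rw [one_mul] at h1
      refine h1.congr_of_eventuallyEq ?_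
      filter_upwards [Ioo_mem_nhds hn' hn.2] with τ hτ
      rw [hw n τ (Ioo_subset_Icc_self hτ)]
      simp

/-- Best-response paths along which the profiles of the cycle are played in turn. -/
theorem IsSinkCycle.LevelSystem.exists_path [NeZero K] {hc : IsSinkCycle u c} (Λ : hc.LevelSystem)
    (hK : 2 < K) {m : ℝ} {w₀ : Vec S} (hm : 0 < m) (hmax : IsMaxAt (c 0) w₀)
    (hlev : HasLevel (Λ.I (-1)) m w₀) (hmove : Λ.δ * m ≤ hc.moveGap (-1) w₀) :
    ∃ w θ, w 0 = w₀ ∧ IsPayoffBRDSolution u w ∧ θ 0 = 0 ∧ StrictMono θ ∧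
      ∀ n : ℕ, IsMaxAt (c n) (w (θ n)) ∧ IsMaxAt (c n) (w (θ (n + 1))) ∧
        hc.moveGap (n - 1) (w (θ (n + 1))) = 0 ∧
        ∀ t ∈ Icc (θ n) (θ (n + 1)), w t = w (θ n) + (t - θ n) • payoffVec u (c n) := by
  -- The maximal gain bounds all phase durations from below by a common constant, so the switching
  -- times tend to infinity.
  obtain ⟨k₀, hk₀⟩ := Finite.exists_max fun k => hc.gain k
  have hg₀ := hc.gain_pos hK k₀
  have hη : 0 < Λ.δ * m / hc.gain k₀ := div_pos (mul_pos Λ.δ_pos hm) hg₀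
  obtain ⟨f, hf0, hP, hQ⟩ := exists_seq_of_forall_exists (a := ((0 : ℝ), w₀))
    (P := fun n x => IsMaxAt (c n) x.2 ∧ HasLevel (Λ.I (n - 1)) m x.2 ∧
      Λ.δ * m ≤ hc.moveGap (n - 1) x.2)
    (Q := fun n x y => Λ.δ * m / hc.gain k₀ ≤ y.1 - x.1 ∧ IsMaxAt (c n) y.2 ∧
      hc.moveGap (n - 1) y.2 = 0 ∧ y.2 = x.2 + (y.1 - x.1) • payoffVec u (c n))
    (by simpa using ⟨hmax, hlev, hmove⟩) (by
      rintro n ⟨a, w⟩ ⟨h1, h2, h3⟩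
      obtain ⟨k, hk⟩ : ∃ k : ZMod K, k + 1 = n := ⟨n - 1, by ring⟩
      rw [← hk, add_sub_cancel_right] at h2 h3
      rw [← hk] at h1
      obtain ⟨T, hT, e1, e2, e3, e4, e5⟩ := Λ.exists_step hK hm h1 h2 h3
      rw [Nat.cast_succ, ← hk, add_sub_cancel_right, add_sub_cancel_right]
      refine ⟨(a + T, w + T • payoffVec u (c (k + 1))), ⟨e3, e4, e5⟩, ?_, e2, e1, ?_⟩
      · rw [div_le_iff₀ hg₀]
        have hT0 : 0 < T := (mul_pos_iff_of_pos_right (hc.gain_pos hK (k + 1))).1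
          ((mul_pos Λ.δ_pos hm).trans_le hT)
        have := mul_le_mul_of_nonneg_left (hk₀ (k + 1)) hT0.le
        simp only [add_sub_cancel_left]
        linarith
      · simp)
  set θ : ℕ → ℝ := fun n => (f n).1 with hθdef
  have hθ0 : θ 0 = 0 := by simp [hθdef, hf0]
  have hθ : StrictMono θ := strictMono_nat_of_lt_succ fun n => by
    have := (hQ n).1
    simp only [hθdef]; linarith
  have hθ' : Tendsto θ atTop atTop := by
    have : ∀ n : ℕ, Λ.δ * m / hc.gain k₀ * n ≤ θ n := fun n => by
      induction n with
      | zero => simp [hθ0]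
      | succ n ih =>
        have := (hQ n).1
        push_cast
        simp only [hθdef] at *
        linarith
    exact tendsto_atTop_mono this (tendsto_natCast_atTop_atTop.const_mul_atTop hη)
  have hex : ∀ t, ∃ n, 0 ≤ t → t ∈ Ico (θ n) (θ (n + 1)) := fun t => by
    by_cases ht : 0 ≤ t
    · obtain ⟨n, hn⟩ := exists_mem_Ico_of_tendsto hθ' (hθ0.trans_le ht)
      exact ⟨n, fun _ => hn⟩
    · exact ⟨0, fun h => absurd h ht⟩
  choose ν hν using hex
  have hθn : ∀ n, 0 ≤ θ n := fun n => hθ0.symm.le.trans (hθ.monotone n.zero_le)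
  have hνeq : ∀ n, ∀ t ∈ Ico (θ n) (θ (n + 1)), ν t = n := fun n t ht => by
    have h1 := hν t ((hθn n).trans ht.1)
    have h2 := hθ.lt_iff_lt.1 (h1.1.trans_lt ht.2)
    have h3 := hθ.lt_iff_lt.1 (ht.1.trans_lt h1.2)
    omega
  set w : ℝ → Vec S := fun t => (f (ν t)).2 + (t - θ (ν t)) • payoffVec u (c (ν t)) with hw
  have hwn : ∀ n, w (θ n) = (f n).2 := fun n => by
    simp only [hw]
    rw [hνeq n (θ n) ⟨le_rfl, hθ (Nat.lt_succ_self n)⟩]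
    simp
  have hpiece : ∀ n, ∀ t ∈ Icc (θ n) (θ (n + 1)),
      w t = w (θ n) + (t - θ n) • payoffVec u (c n) := by
    intro n t ht
    rcases ht.2.lt_or_eq with h | rfl
    · rw [hwn]
      simp only [hw]
      rw [hνeq n t ⟨ht.1, h⟩]
    · rw [hwn, hwn]
      exact (hQ n).2.2.2
  refine ⟨w, θ, ?_, ?_, hθ0, hθ, fun n => ⟨?_, ?_, ?_, hpiece n⟩⟩
  · rw [← hθ0, hwn, hf0]
  · refine isPayoffBRDSolution_of_pieces (p := fun n => c n) hθ0 hθ hθ' hpiece fun n => ?_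
    rw [hwn, hwn]
    exact ⟨(hP n).1, (hQ n).2.1⟩
  · rw [hwn]; exact (hP n).1
  · rw [hwn]; exact (hQ n).2.1
  · rw [hwn]; exact (hQ n).2.2.1

end BestResponse

/-! ### Solutions of both dynamics are soft play -/

section Solutions

variable {N : ℕ} {S : Fin N → Type v} [∀ i, Fintype (S i)] {u : Profile S → Fin N → ℝ}

theorem isSoftPlay_of_hasDerivWithinAt {w y : ℝ → Vec S} {T : ℝ} (hT : 0 ≤ T)
    (hy : ∀ t, 0 ≤ t → y t ∈ strategySpace S)
    (hw : ∀ t, 0 ≤ t → ∀ i s,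
      HasDerivWithinAt (fun τ => w τ i s) (stratUtility u (y t) i s) (Ici 0) t)
    (hsoft : ∀ t ∈ Icc 0 T, ∀ i s r, y t i s ≤ Real.exp (w t i s - w t i r)) :
    IsSoftPlay u T w := by
  have hd : ∀ t, 0 ≤ t → HasDerivWithinAt w (stratUtility u (y t)) (Ici 0) t := fun t ht =>
    hasDerivWithinAt_pi.2 fun i => hasDerivWithinAt_pi.2 fun s => hw t ht i s
  refine ⟨?_, ?_⟩
  · refine LipschitzOnWith.absolutelyContinuousOnInterval
      (K := ⟨payoffBound u, payoffBound_nonneg u⟩) ?_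
    rw [uIcc_of_le hT]
    refine (convex_Icc 0 T).lipschitzOnWith_of_nnnorm_hasDerivWithin_le
      (fun t ht => (hd t ht.1).mono Icc_subset_Ici_self) fun t ht => ?_
    exact norm_stratUtility_le u (hy t ht.1)
  · filter_upwards [(countable_singleton (0 : ℝ)).ae_notMem volume] with t ht htI
    have ht0 : 0 < t := lt_of_le_of_ne htI.1 fun h => ht h.symm
    exact ⟨y t, hy t htI.1, hsoft t htI, (hd t htI.1).hasDerivAt (Ici_mem_nhds ht0)⟩

theorem softmax_mem (w : Vec S) (hS : ∀ i, Nonempty (S i)) : softmax w ∈ strategySpace S := by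
  rw [softmax_eq]
  exact weightedSoftmax_mem (fun i => ⟨fun _ => zero_le_one, (hS i).some, one_pos⟩) w

theorem softmax_le (w : Vec S) (i : Fin N) (s r : S i) :
    softmax w i s ≤ Real.exp (w i s - w i r) := by
  rw [softmax, Real.exp_sub]
  exact div_le_div_of_nonneg_left (Real.exp_pos _).le (Real.exp_pos _)
    (Finset.single_le_sum (f := fun r => Real.exp (w i r)) (fun _ _ => (Real.exp_pos _).le)
      (Finset.mem_univ r))

theorem IsPayoffRDSolution.isSoftPlay (hS : ∀ i, Nonempty (S i)) {w : ℝ → Vec S}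
    (hw : IsPayoffRDSolution u w) {T : ℝ} (hT : 0 ≤ T) : IsSoftPlay u T w :=
  isSoftPlay_of_hasDerivWithinAt hT (fun t _ => softmax_mem (w t) hS) hw
    fun t _ => softmax_le (w t)

theorem exists_isPayoffRDSolution (u : Profile S → Fin N → ℝ) (hS : ∀ i, Nonempty (S i))
    (w₀ : Vec S) : ∃ w, IsPayoffRDSolution u w ∧ w 0 = w₀ := by
  obtain ⟨w, h0, hw⟩ := exists_payoff_solution u
    (b := fun _ _ => 1) (fun i => ⟨fun _ => zero_le_one, (hS i).some, one_pos⟩) w₀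
  refine ⟨w, fun t _ i s => ?_, h0⟩
  rw [softmax_eq]
  exact (hasDerivAt_pi.1 (hasDerivAt_pi.1 (hw t) i) s).hasDerivWithinAt

theorem IsPayoffBRDSolution.isSoftPlay {w : ℝ → Vec S} (hw : IsPayoffBRDSolution u w) {T : ℝ}
    (hT : 0 ≤ T) : IsSoftPlay u T w := by
  refine ⟨hw.1 T hT, ?_⟩
  have h := hw.2
  rw [ae_restrict_iff' measurableSet_Ici] at h
  filter_upwards [h] with t ht htI
  obtain ⟨y, hy, hd⟩ := ht htI.1
  have hy' := subgameSpace_subset _ hy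
  refine ⟨y, hy', fun i s r => ?_, hasDerivAt_pi.2 fun i => hasDerivAt_pi.2 fun s => hd i s⟩
  by_cases hs : s ∈ argmaxSet (w t) i
  · exact (le_one_of_mem hy' i s).trans (Real.one_le_exp (sub_nonneg.2 (hs r)))
  · rw [(hy i).2 s hs]
    exact (Real.exp_pos _).le

theorem IsSoftPlay.norm_sub_le_mul {T : ℝ} {w : ℝ → Vec S} (hw : IsSoftPlay u T w) (hT : 0 ≤ T) :
    ‖w T - w 0‖ ≤ payoffBound u * T := by
  refine NormedSpace.norm_le_dual_bound ℝ _ (mul_nonneg (payoffBound_nonneg u) hT) fun L => ?_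
  have := hw.abs_sub_le le_rfl hT le_rfl L
  rw [Real.norm_eq_abs, map_sub]
  linarith

end Solutions

/-! ### Stability in payoff space -/

section Stability

variable {N : ℕ} {S : Fin N → Type v} {u : Profile S → Fin N → ℝ} {K : ℕ} {c : ZMod K → Profile S}

/-- The points of payoff space at which the strategies in `p` are better than all other strategies
by more than `m`. -/
def gapRegion (p : Profile S) (m : ℝ) : Set (Vec S) :=
  {w | ∀ i s, s ≠ p i → m < w i (p i) - w i s}

theorem isMaxAt_of_mem_gapRegion {p : Profile S} {m : ℝ} (hm : 0 ≤ m) {w : Vec S}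
    (hw : w ∈ gapRegion p m) : IsMaxAt p w := by
  intro i s
  by_cases hs : s = p i
  · rw [hs]
  · linarith [hw i s hs]

theorem nonempty_gapRegion (p : Profile S) (m : ℝ) : (gapRegion p m).Nonempty := by
  classical
  refine ⟨fun i s => if s = p i then m + 1 else 0, fun i s hs => ?_⟩
  simp [hs]

theorem isOpen_gapRegion [∀ i, Finite (S i)] (p : Profile S) (m : ℝ) :
    IsOpen (gapRegion p m) := by
  have : gapRegion p m = ⋂ i, ⋂ s, ⋂ _ : s ≠ p i, {w | m < w i (p i) - w i s} := by
    ext w; simp [gapRegion]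
  rw [this]
  refine isOpen_iInter_of_finite fun i => isOpen_iInter_of_finite fun s =>
    isOpen_iInter_of_finite fun _ => ?_
  exact isOpen_lt continuous_const (by fun_prop)

theorem nearEdge_of_mem_gapRegion {k : ZMod K} {m : ℝ} {w : Vec S}
    (hw : w ∈ gapRegion (c k) m) : NearEdge c k m w := fun i s h₁ _ =>
  (hw i s h₁).le.trans (sub_le_sub_right (le_max_left _ _) _)

theorem IsSinkCycle.le_moveGap_of_mem_gapRegion (hc : IsSinkCycle u c) {m : ℝ} {w : Vec S}
    (hw : w ∈ gapRegion (c 0) m) : m ≤ hc.moveGap (-1) w := by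
  have h1 := hw (hc.mover 0) (c (0 + 1) (hc.mover 0)) (hc.succ_mover_ne 0)
  have h2 : hc.moveGap (-1) w =
      w (hc.mover 0) (c 0 (hc.mover 0)) - w (hc.mover 0) (c (0 + 1) (hc.mover 0)) := by
    rw [IsSinkCycle.moveGap, gap_apply, neg_add_cancel]
  linarith

variable [∀ i, Fintype (S i)]

namespace IsSinkCycle

/-- The constants are chosen in order: `B` and a rate from the edges, `δ` from linear growth, and
then `m` so large that `B < δ * m`. Shrinking the rate to at most `δ` keeps it valid. -/
theorem exists_isEdgePlay (hc : IsSinkCycle u c) (hK : 4 < K) :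
    ∃ r B δ m, 0 < m ∧ δ ≤ 1 ∧ ∀ w, (∀ T, 0 ≤ T → IsSoftPlay u T w) → ∀ l, NearEdge c l m (w 0) →
      IsEdgePlay hc r B δ m w := by
  have : NeZero K := ⟨by omega⟩
  have hK2 : 2 < K := by omega
  obtain ⟨r, hr, B, hB, hrate⟩ := hc.exists_stepGap_rate hK2
  obtain ⟨M, hM, δ, hδ, hgrow⟩ := hc.exists_growth hK
  set δ' := min δ 1 with hδ'
  have hδ'0 : 0 < δ' := lt_min hδ one_pos
  set m := max M (B / δ' + 1) with hm
  have hm0 : 0 < m := hM.trans_le (le_max_left _ _)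
  refine ⟨min r δ', B, δ', m, hm0, min_le_right _ _, fun w hw l hl => ?_⟩
  refine ⟨hK2, lt_min hr hδ'0, hB, min_le_right _ _, ?_, fun k w h y hy hs =>
    (min_le_left _ _).trans (hrate k w h y hy hs), hw, fun t ht => ?_⟩
  · have h1 : B / δ' < m := (lt_add_one _).trans_le (le_max_right _ _)
    rwa [div_lt_iff₀' hδ'0] at h1
  · obtain ⟨k, hk⟩ := hgrow t w (hw t ht) m (le_max_left _ _) l hl t ⟨ht, le_rfl⟩
    exact ⟨k, hk.mono (mul_le_mul_of_nonneg_right (min_le_left _ _) (by linarith))⟩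

end IsSinkCycle

theorem NearEdge.le_two_mul_norm {hc : IsSinkCycle u c} (hK : 2 < K) {k : ZMod K} {h : ℝ}
    {w : Vec S} (hw : NearEdge c k h w) : h ≤ 2 * ‖w‖ := by
  have h1 := hw (hc.mover (k + 1)) _ (hc.ne_of_succ_mover hK k) (hc.succ_mover_ne (k + 1))
  have h2 : ∀ i s, |w i s| ≤ ‖w‖ := fun i s =>
    (norm_le_pi_norm (w i) s).trans (norm_le_pi_norm w i)
  have h3 := max_le ((le_abs_self _).trans (h2 (hc.mover (k + 1)) (c k (hc.mover (k + 1)))))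
    ((le_abs_self _).trans (h2 (hc.mover (k + 1)) (c (k + 1) (hc.mover (k + 1)))))
  have h4 := (abs_le.1 (h2 (hc.mover (k + 1)) (c (k + 1 + 1) (hc.mover (k + 1))))).1
  linarith

theorem IsEdgePlay.norm_bounds {hc : IsSinkCycle u c} {r B δ m : ℝ} {w : ℝ → Vec S}
    (hw : IsEdgePlay hc r B δ m w) :
    ∃ δ' > 0, ∃ C, ∀ t, 0 ≤ t → δ' * (1 + t) ≤ ‖w t‖ ∧ ‖w t‖ ≤ C * (1 + t) := by
  have hδ : 0 < δ := hw.r_pos.trans_le hw.r_le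
  have hm : 0 < m := (mul_pos_iff_of_pos_left hδ).1 (hw.B_pos.trans hw.lt)
  have hP := payoffBound_nonneg u
  refine ⟨δ * min m 1 / 2, by positivity, ‖w 0‖ + payoffBound u, fun t ht => ⟨?_, ?_⟩⟩
  · obtain ⟨k, hk⟩ := hw.near t ht
    have h1 := hk.le_two_mul_norm (hc := hc) hw.two_lt
    have h2 := min_le_left m 1
    have h3 := mul_le_mul_of_nonneg_right (min_le_right m 1) ht
    have h4 : δ * (min m 1 * (1 + t)) ≤ δ * (m + t) :=
      mul_le_mul_of_nonneg_left (by linarith) hδ.le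
    linarith
  · have h1 := (hw.soft t ht).norm_sub_le_mul ht
    have h2 := norm_le_norm_add_norm_sub' (w t) (w 0)
    have h3 := mul_nonneg (norm_nonneg (w 0)) ht
    linarith

namespace IsSinkCycle

/-- From every point at which the strategies in `c 0` are better than all others by far, there is
an exact best-response path. -/
theorem exists_brd_path (hc : IsSinkCycle u c) (hK : 4 < K) {r B δ m : ℝ} (hm : 0 < m)
    (hδ1 : δ ≤ 1) (hplay : ∀ w, (∀ T, 0 ≤ T → IsSoftPlay u T w) → ∀ l, NearEdge c l m (w 0) →
      IsEdgePlay hc r B δ m w) {w₀ : Vec S} (hw₀ : w₀ ∈ gapRegion (c 0) m) :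
    ∃ w, w 0 = w₀ ∧ IsPayoffBRDSolution u w ∧ ∃ κ > 0, ∃ θ, IsCyclicPath u c κ 0 w θ := by
  have : NeZero K := ⟨by omega⟩
  have hK2 : 2 < K := by omega
  obtain ⟨Λ⟩ := hc.exists_levelSystem hK
  have hδ := Λ.δ_pos
  have hmove := hc.le_moveGap_of_mem_gapRegion hw₀
  -- The first entry ensures the level of the functionals, the second the bound on `moveGap`.
  set m' := min (Λ.δ * m) (m / Λ.δ) with hm'
  have hm'0 : 0 < m' := lt_min (mul_pos hδ hm) (div_pos hm hδ)
  have hmax := isMaxAt_of_mem_gapRegion hm.le hw₀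
  have hlev : HasLevel (Λ.I (-1)) m' w₀ := by
    refine (Λ.of_gaps (-1) m w₀ hm fun i s hs => ?_).mono (Λ.nonneg _) (min_le_left _ _)
    rw [neg_add_cancel] at hs ⊢
    exact (hw₀ i s hs).le
  have hmove' : Λ.δ * m' ≤ hc.moveGap (-1) w₀ := by
    have h1 : Λ.δ * m' ≤ Λ.δ * (m / Λ.δ) := mul_le_mul_of_nonneg_left (min_le_right _ _) hδ.le
    rw [mul_div_cancel₀ _ hδ.ne'] at h1
    linarith
  obtain ⟨w, θ, hw0, hsol, hθ0, hθ, hpieces⟩ := Λ.exists_path hK2 hm'0 hmax hlev hmove'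
  have hw := hplay w (fun T hT => hsol.isSoftPlay hT) 0 (by
    rw [hw0]; exact nearEdge_of_mem_gapRegion hw₀)
  obtain ⟨κ, hκ, hgrow⟩ := hw.exists_grow
  have hθn : ∀ n, 0 ≤ θ n := fun n => hθ0.symm.le.trans (hθ.monotone n.zero_le)
  refine ⟨w, hw0, hsol, κ, hκ, θ, hθ0, fun n => ?_, fun n => (hpieces n).1,
    fun n => (hpieces n).2.1, fun n t ht => ?_⟩
  · refine hgrow (n - 1) _ _ (hθn n) (hθ (Nat.lt_succ_self n)).le ?_ (hpieces n).2.2.1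
    cases n with
    | zero =>
      rw [hθ0, hw0, add_zero, Nat.cast_zero, zero_sub]
      have := mul_le_mul_of_nonneg_right hδ1 hm.le
      linarith
    | succ n =>
      obtain ⟨l, hl⟩ := hw.near _ (hθn (n + 1))
      rw [Nat.cast_succ, add_sub_cancel_right]
      have h1 := (hpieces (n + 1)).1
      rw [Nat.cast_succ] at h1
      exact hc.le_moveGap_of_isMaxAt hK2 (hw.B_pos.trans (hw.lt' (hθn (n + 1)))) hl
        (hpieces n).2.1 h1
  · rw [(hpieces n).2.2.2 t ht]
    simp

/-- Sink cycles of length greater than four are stable under both dynamics. -/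
theorem isStablePlay (hc : IsSinkCycle u c) (hK : 4 < K) :
    IsStablePlay (IsPayoffBRDSolution u) c ∧ IsStablePlay (IsPayoffRDSolution u) c := by
  have : NeZero K := ⟨by omega⟩
  have hK2 : 2 < K := by omega
  obtain ⟨r, B, δ, m, hm, hδ1, hplay⟩ := hc.exists_isEdgePlay hK
  obtain ⟨w₁, hw₁⟩ := nonempty_gapRegion (c 0) m
  obtain ⟨w', hw'0, hsol', κ', hκ', θ', hpath'⟩ := hc.exists_brd_path hK hm hδ1 hplay hw₁
  have hw' := hplay w' (fun T hT => hsol'.isSoftPlay hT) 0 (by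
    rw [hw'0]; exact nearEdge_of_mem_gapRegion hw₁)
  obtain ⟨δ', hδ', C, hnorm⟩ := hw'.norm_bounds
  have hS : ∀ i, Nonempty (S i) := fun i => ⟨c 0 i⟩
  -- Only softness and existence matter. All solutions of either dynamic are compared with the
  -- single exact path `w'`.
  have key : ∀ Sol : (ℝ → Vec S) → Prop, (∀ w, Sol w → ∀ T, 0 ≤ T → IsSoftPlay u T w) →
      (∀ w₀ ∈ gapRegion (c 0) m, ∃ w, Sol w ∧ w 0 = w₀) → IsStablePlay Sol c := by
    intro Sol hsoft hex
    have hcyc : ∀ w, Sol w → w 0 ∈ gapRegion (c 0) m → FollowsPlay c w ∧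
        ∃ κ > 0, ∃ E θ, IsCyclicPath u c κ E w θ := fun w hw hw0 =>
      (hplay w (hsoft w hw) 0 (nearEdge_of_mem_gapRegion hw0)).exists_isCyclicPath
        (isMaxAt_of_mem_gapRegion hm.le hw0) (by
          have := hc.le_moveGap_of_mem_gapRegion hw0
          have := mul_le_mul_of_nonneg_right hδ1 hm.le
          linarith)
    refine ⟨gapRegion (c 0) m, ⟨isOpen_gapRegion _ _, nonempty_gapRegion _ _, hex,
      fun w hw hw0 => (hcyc w hw hw0).1⟩, normalizedLimitSet w', fun w hw hw0 => ?_⟩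
    obtain ⟨κ, hκ, E, θ, hpath⟩ := (hcyc w hw hw0).2
    exact hpath.normalizedLimitSet_eq hc hK2 hκ hpath' hκ' hδ' hnorm
  constructor
  · refine key _ (fun w hw T hT => hw.isSoftPlay hT) fun w₀ hw₀ => ?_
    obtain ⟨w, h0, hsol, -⟩ := hc.exists_brd_path hK hm hδ1 hplay hw₀
    exact ⟨w, hsol, h0⟩
  · exact key _ (fun w hw T hT => hw.isSoftPlay hS hT) fun w₀ _ => exists_isPayoffRDSolution u hS w₀

end IsSinkCycle

end Stability

/-! ### Attractors that are unions of faces -/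

section Attractors

variable {N : ℕ} {S : Fin N → Type v} {u : Profile S → Fin N → ℝ}

/-- The mixed profile `x` puts at most `d` on every strategy outside of the sets `T i`. -/
def OffLe (T : ∀ i, Set (S i)) (d : ℝ) (x : Vec S) : Prop := ∀ i, ∀ s ∉ T i, x i s ≤ d

variable [∀ i, Fintype (S i)]

theorem isCompact_subgameSpace (T : ∀ i, Set (S i)) : IsCompact (subgameSpace T) := by
  have : subgameSpace T = univ.pi (fun i => stdSimplex ℝ (S i)) ∩
      ⋂ i, ⋂ s, ⋂ _ : s ∉ T i, {x | x i s = 0} := by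
    ext x
    simp only [subgameSpace, mem_ofPred_eq, mem_inter_iff, Set.mem_pi, mem_univ, true_imp_iff,
      mem_iInter, forall_and]
  rw [this]
  refine (isCompact_univ_pi fun i => isCompact_stdSimplex ℝ (S i)).inter_right ?_
  refine isClosed_iInter fun i => isClosed_iInter fun s => isClosed_iInter fun _ => ?_
  exact isClosed_eq (by fun_prop) continuous_const

/-- Move the small mass `q i` outside of `T i` onto one chosen strategy of `T i`. -/
theorem OffLe.exists_mem {T : ∀ i, Set (S i)} (hT : ∀ i, (T i).Nonempty) {d : ℝ} {x : Vec S}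
    (hx : x ∈ strategySpace S) (h : OffLe T d x) (hd : 0 ≤ d) :
    ∃ y ∈ subgameSpace T, dist x y ≤ (∑ i, (Fintype.card (S i) : ℝ)) * d := by
  classical
  choose r hr using hT
  have hx' := mem_strategySpace.1 hx
  set q : ∀ i, ℝ := fun i => ∑ s, if s ∈ T i then 0 else x i s with hq
  have hq0 : ∀ i, 0 ≤ q i := fun i => Finset.sum_nonneg fun s _ => by
    split_ifs
    · exact le_rfl
    · exact (hx' i).1 s
  have hC : ∀ i, (Fintype.card (S i) : ℝ) * d ≤ (∑ i, (Fintype.card (S i) : ℝ)) * d := fun i =>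
    mul_le_mul_of_nonneg_right (Finset.single_le_sum (f := fun i => (Fintype.card (S i) : ℝ))
      (fun _ _ => Nat.cast_nonneg _) (Finset.mem_univ i)) hd
  have hC0 : 0 ≤ (∑ i, (Fintype.card (S i) : ℝ)) * d :=
    mul_nonneg (Finset.sum_nonneg fun _ _ => Nat.cast_nonneg _) hd
  have hqC : ∀ i, q i ≤ (∑ i, (Fintype.card (S i) : ℝ)) * d := fun i => by
    refine le_trans ?_ (hC i)
    have : q i ≤ ∑ _s : S i, d := Finset.sum_le_sum fun s _ => by
      split_ifs with hs
      · exact hd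
      · exact h i s hs
    simpa using this
  have hle : ∀ i s, s ∉ T i → x i s ≤ q i := fun i s hs => by
    have := Finset.single_le_sum (f := fun s => if s ∈ T i then 0 else x i s) (fun s _ => by
      split_ifs
      · exact le_rfl
      · exact (hx' i).1 s) (Finset.mem_univ s)
    simpa [hs] using this
  refine ⟨fun i s => (if s ∈ T i then x i s else 0) + if s = r i then q i else 0,
    fun i => ⟨⟨fun s => ?_, ?_⟩, fun s hs => ?_⟩, ?_⟩
  · refine add_nonneg ?_ ?_
    · split_ifs
      · exact (hx' i).1 s
      · exact le_rfl
    · split_ifs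
      · exact hq0 i
      · exact le_rfl
  · rw [Finset.sum_add_distrib, Finset.sum_ite_eq' Finset.univ (r i), if_pos (Finset.mem_univ _),
      hq, ← Finset.sum_add_distrib, ← (hx' i).2]
    refine Finset.sum_congr rfl fun s _ => ?_
    split_ifs <;> simp
  · have : s ≠ r i := fun h => hs (h ▸ hr i)
    simp [hs, this]
  · refine (dist_pi_le_iff hC0).2 fun i => (dist_pi_le_iff hC0).2 fun s => ?_
    rw [Real.dist_eq]
    by_cases hs : s ∈ T i
    · by_cases hsr : s = r i
      · simp only [hsr, if_true, hr i, sub_add_cancel_left, abs_neg, abs_of_nonneg (hq0 i)]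
        exact hqC i
      · simpa [hs, hsr] using hC0
    · have : s ≠ r i := fun h => hs (h ▸ hr i)
      simp only [hs, this, if_false, add_zero, sub_zero, abs_of_nonneg ((hx' i).1 s)]
      exact (hle i s hs).trans (hqC i)

theorem exists_offLe_of_mem_thickening {ι : Type*} {T : ι → ∀ i, Set (S i)} {d : ℝ} {x : Vec S}
    (h : x ∈ Metric.thickening d (⋃ k, subgameSpace (T k))) : ∃ k, OffLe (T k) d x := by
  obtain ⟨y, hy, hxy⟩ := Metric.mem_thickening_iff.1 h
  obtain ⟨k, hk⟩ := mem_iUnion.1 hy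
  refine ⟨k, fun i s hs => ?_⟩
  have h1 := (dist_le_pi_dist (x i) (y i) s).trans ((dist_le_pi_dist x y i).trans hxy.le)
  rw [(hk i).2 s hs, Real.dist_eq, sub_zero] at h1
  exact (le_abs_self _).trans h1

theorem mem_thickening_of_offLe {ι : Type*} {T : ι → ∀ i, Set (S i)}
    (hT : ∀ k i, (T k i).Nonempty) {ε : ℝ} (hε : 0 < ε) :
    ∃ d > 0, ∀ x ∈ strategySpace S, (∃ k, OffLe (T k) d x) →
      x ∈ Metric.thickening ε (⋃ k, subgameSpace (T k)) := by
  set C := ∑ i, (Fintype.card (S i) : ℝ)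
  have hC : 0 ≤ C := Finset.sum_nonneg fun _ _ => Nat.cast_nonneg _
  have hd : 0 < ε / (C + 1) := by positivity
  refine ⟨ε / (C + 1), hd, fun x hx ⟨k, hk⟩ => ?_⟩
  obtain ⟨y, hy, hxy⟩ := hk.exists_mem (hT k) hx hd.le
  refine Metric.mem_thickening_iff.2 ⟨y, mem_iUnion.2 ⟨k, hy⟩, hxy.trans_lt ?_⟩
  rw [mul_div_assoc', div_lt_iff₀ (by positivity)]
  linarith

theorem subgameSpace_invariant (u : Profile S → Fin N → ℝ) (T : ∀ i, Set (S i)) {t : ℝ}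
    (ht : 0 ≤ t) : replicatorImage u t (subgameSpace T) = subgameSpace T := by
  refine Subset.antisymm ?_ fun y hy => ?_
  · rintro _ ⟨x, hx, hx0, rfl⟩
    exact fun i => ⟨(hx.mem ht i).1, fun s hs => hx.eq_zero ht ((hx0 i).2 s hs)⟩
  · obtain ⟨x, hx, hxt, h0⟩ := exists_replicator_orbit u (subgameSpace_subset T hy) t
    exact ⟨x, hx, fun i => ⟨(hx.mem le_rfl i).1, fun s hs => h0 0 i s ((hy i).2 s hs)⟩, hxt⟩

theorem isReplicatorAttractor_of_offLe {ι : Type*} [Finite ι] [Nonempty ι]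
    {T : ι → ∀ i, Set (S i)} (hT : ∀ k i, (T k i).Nonempty)
    (hstable : ∀ ε > 0, ∃ δ > 0, ∀ x, IsReplicatorSolution u x → (∃ k, OffLe (T k) δ (x 0)) →
      ∀ t, 0 ≤ t → ∃ k, OffLe (T k) ε (x t))
    (hattr : ∃ ρ > 0, ∀ ε > 0, ∃ t₀, 0 ≤ t₀ ∧ ∀ x, IsReplicatorSolution u x →
      (∃ k, OffLe (T k) ρ (x 0)) → ∀ t, t₀ ≤ t → ∃ k, OffLe (T k) ε (x t)) :
    IsReplicatorAttractor u (⋃ k, subgameSpace (T k)) where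
  nonempty := by
    choose p hp using hT
    obtain ⟨k⟩ := ‹Nonempty ι›
    exact ⟨pureVec (p k), mem_iUnion.2 ⟨k, pureVec_mem (hp k)⟩⟩
  compact := isCompact_iUnion fun k => isCompact_subgameSpace (T k)
  subset := iUnion_subset fun k => subgameSpace_subset (T k)
  invariant t ht := by
    have : replicatorImage u t (⋃ k, subgameSpace (T k)) =
        ⋃ k, replicatorImage u t (subgameSpace (T k)) := by
      ext y
      simp only [replicatorImage, mem_iUnion, mem_ofPred_eq]
      tauto
    rw [this]
    exact iUnion_congr fun k => subgameSpace_invariant u (T k) ht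
  lyapunov ε hε := by
    obtain ⟨d, hd, h₁⟩ := mem_thickening_of_offLe hT hε
    obtain ⟨δ, hδ, h₂⟩ := hstable d hd
    refine ⟨δ, hδ, fun t ht => ?_⟩
    rintro _ ⟨x, hx, hx0, rfl⟩
    exact h₁ _ (hx.mem ht) (h₂ x hx (exists_offLe_of_mem_thickening hx0) t ht)
  attracting := by
    obtain ⟨ρ, hρ, h⟩ := hattr
    refine ⟨Metric.thickening ρ (⋃ k, subgameSpace (T k)), Metric.isOpen_thickening,
      Metric.self_subset_thickening hρ _, fun y hy => ?_, fun ε hε => ?_⟩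
    · obtain ⟨x, hx, hx0, -⟩ := exists_replicator_orbit u hy.2 0
      exact ⟨x, hx, hx0⟩
    · obtain ⟨d, hd, h₁⟩ := mem_thickening_of_offLe hT hε
      obtain ⟨t₀, ht₀, h₂⟩ := h d hd
      refine ⟨t₀, ht₀, fun t ht => ?_⟩
      rintro _ ⟨x, hx, hx0, rfl⟩
      exact h₁ _ (hx.mem (ht₀.trans ht)) (h₂ x hx (exists_offLe_of_mem_thickening hx0) t ht)

end Attractors

/-! ### Dominating subgames attract -/

section Domination

variable {N : ℕ} {S : Fin N → Type v} [∀ i, Fintype (S i)] {u : Profile S → Fin N → ℝ}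

/-- The restriction of the game to the strategies in `T` makes all others strictly dominated. -/
def DominatesOff (u : Profile S → Fin N → ℝ) (T : ∀ i, Set (S i)) : Prop :=
  ∀ p : Profile S, (∀ i, p i ∈ T i) → ∀ i, ∀ r ∈ T i, ∀ s ∉ T i,
    payoffVec u p i s < payoffVec u p i r

theorem DominatesOff.exists_growthRate_le {T : ∀ i, Set (S i)} (hT : ∀ i, (T i).Nonempty)
    (h : DominatesOff u T) : ∃ η > 0, ∃ ρ > 0, ∀ x ∈ strategySpace S, OffLe T ρ x →
      ∀ i, ∀ s ∉ T i, growthRate u x i s ≤ -η := by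
  have h₁ : ∀ᶠ η in 𝓝[>] (0 : ℝ), ∀ p : Profile S, ∀ i, ∀ r s, (∀ i, p i ∈ T i) → r ∈ T i →
      s ∉ T i → 2 * η ≤ gap i r s (payoffVec u p) := by
    refine eventually_all.2 fun p => eventually_all.2 fun i => eventually_all.2 fun r =>
      eventually_all.2 fun s => ?_
    by_cases hc : (∀ i, p i ∈ T i) ∧ r ∈ T i ∧ s ∉ T i
    · have h2 : 0 < gap i r s (payoffVec u p) := sub_pos.2 (h p hc.1 i r hc.2.1 s hc.2.2)
      filter_upwards [nhdsWithin_le_nhds (eventually_lt_nhds (half_pos h2))] with η hη _ _ _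
      linarith
    · exact Eventually.of_forall fun η a b d => absurd ⟨a, b, d⟩ hc
  obtain ⟨η, hη, hη0⟩ := (h₁.and self_mem_nhdsWithin).exists
  replace hη0 : 0 < η := hη0
  choose q hq using hT
  have hP := payoffBound_nonneg u
  set C := ∑ i, ∑ r, ∑ s, 2 * Fintype.card (Profile S) * ‖gap (S := S) i r s‖ * payoffBound u
  have hC : ∀ i r s, 2 * Fintype.card (Profile S) * ‖gap (S := S) i r s‖ * payoffBound u ≤ C := by
    intro i r s
    have h0 : ∀ i (r s : S i),
        0 ≤ 2 * Fintype.card (Profile S) * ‖gap (S := S) i r s‖ * payoffBound u :=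
      fun i r s => by positivity
    have h0' : ∀ i (r : S i), 0 ≤ ∑ s, 2 * Fintype.card (Profile S) * ‖gap (S := S) i r s‖ *
      payoffBound u := fun i r => Finset.sum_nonneg fun s _ => h0 i r s
    exact (Finset.single_le_sum (fun s _ => h0 i r s) (Finset.mem_univ s)).trans
      ((Finset.single_le_sum (fun r _ => h0' i r) (Finset.mem_univ r)).trans
      (Finset.single_le_sum (f := fun i => ∑ r, ∑ s, 2 * Fintype.card (Profile S) *
        ‖gap (S := S) i r s‖ * payoffBound u)
        (fun i _ => Finset.sum_nonneg fun r _ => h0' i r) (Finset.mem_univ i)))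
  have hC0 : 0 ≤ C := Finset.sum_nonneg fun i _ => Finset.sum_nonneg fun r _ =>
    Finset.sum_nonneg fun s _ => by positivity
  set M := ∑ i, (Fintype.card (S i) : ℝ)
  have hM : 0 ≤ M := Finset.sum_nonneg fun _ _ => Nat.cast_nonneg _
  set D := 2 * payoffBound u + 2 * η with hD
  have hD0 : 0 < D := by positivity
  set ρ := η / (C + M * D + 1) with hρ
  have hρ0 : 0 < ρ := by positivity
  have hρη : C * ρ + M * (ρ * D) ≤ η := by
    have : ρ * (C + M * D + 1) = η := div_mul_cancel₀ _ (by positivity)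
    linarith
  refine ⟨η, hη0, ρ, hρ0, fun x hx hoff i s hs => ?_⟩
  have hx' := mem_strategySpace.1 hx i
  have hU : ∀ r, |stratUtility u x i r| ≤ payoffBound u := fun r =>
    (norm_le_pi_norm (stratUtility u x i) r).trans ((norm_le_pi_norm _ i).trans
      (norm_stratUtility_le u hx))
  -- Averaging these advantages over `r` gives minus the growth rate of `s`. Strategies in `T` have
  -- an advantage of nearly `2 * η`, and the others carry too little mass to matter.
  have key : ∀ r, x i r * (2 * η - C * ρ) - ρ * D ≤
      x i r * (stratUtility u x i r - stratUtility u x i s) := by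
    intro r
    by_cases hr : r ∈ T i
    · have h2 := le_apply_stratUtility u hx (A := T) hρ0.le hoff (gap i r s) (r := 2 * η)
        (fun p hp => hη p i r s hp hr hs) ⟨q, hq⟩
      rw [gap_apply] at h2
      have h3 := mul_le_mul_of_nonneg_right (hC i r s) hρ0.le
      have h4 := mul_le_mul_of_nonneg_left (h2.trans' (sub_le_sub_left h3 _)) (hx'.1 r)
      have := mul_pos hρ0 hD0
      linarith
    · have h2 := hoff i r hr
      have h3 := (abs_le.1 (hU r)).1
      have h4 := (abs_le.1 (hU s)).2
      have h5 : -(2 * payoffBound u) ≤ stratUtility u x i r - stratUtility u x i s := by linarith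
      have h6 := mul_le_mul_of_nonneg_left h5 (hx'.1 r)
      have h7 := mul_le_mul_of_nonneg_right h2 hD0.le
      have h8 := mul_nonneg (hx'.1 r) (mul_nonneg hC0 hρ0.le)
      rw [hD] at h7 ⊢
      linarith
  have hsum := Finset.sum_le_sum fun r (_ : r ∈ Finset.univ) => key r
  rw [Finset.sum_sub_distrib, ← Finset.sum_mul, hx'.2, Finset.sum_const, Finset.card_univ,
    nsmul_eq_mul] at hsum
  have h9 : ∑ r, x i r * (stratUtility u x i r - stratUtility u x i s) = -growthRate u x i s := by
    simp only [mul_sub, Finset.sum_sub_distrib, ← Finset.sum_mul, hx'.2, growthRate]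
    ring
  have h10 : (Fintype.card (S i) : ℝ) * (ρ * D) ≤ M * (ρ * D) :=
    mul_le_mul_of_nonneg_right (Finset.single_le_sum (f := fun i => (Fintype.card (S i) : ℝ))
      (fun _ _ => Nat.cast_nonneg _) (Finset.mem_univ i)) (by positivity)
  rw [h9] at hsum
  linarith

theorem DominatesOff.exists_decay {T : ∀ i, Set (S i)} (hT : ∀ i, (T i).Nonempty)
    (h : DominatesOff u T) : ∃ η > 0, ∃ ρ > 0, ∀ x, IsReplicatorSolution u x → ∀ d, 0 ≤ d → d ≤ ρ →
      OffLe T d (x 0) → ∀ t, 0 ≤ t → OffLe T (d * Real.exp (-(η * t))) (x t) := by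
  obtain ⟨η, hη, ρ, hρ, hrate⟩ := h.exists_growthRate_le hT
  -- Halving `ρ` keeps the outside coordinates strictly below the bound under which the rates hold,
  -- which leaves room for the continuous induction.
  refine ⟨η, hη, ρ / 2, half_pos hρ, fun x hx d hd0 hd hoff t ht => ?_⟩
  have hprim : ∀ i s, ∃ A : ℝ → ℝ, A 0 = 0 ∧
      ∀ t, 0 ≤ t → HasDerivWithinAt A (growthRate u (x t) i s) (Ici 0) t := fun i s =>
    exists_primitive ((hx.continuousOn_stratUtility i s).sub (hx.continuousOn_average i))
  choose A hA0 hA using hprim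
  have hAc : ∀ i s, ContinuousOn (A i s) (Ici 0) := fun i s t ht => (hA i s t ht).continuousWithinAt
  have hoffA : ∀ t, 0 ≤ t → (∀ i, ∀ s ∉ T i, A i s t ≤ -(η * t)) →
      OffLe T (d * Real.exp (-(η * t))) (x t) := by
    intro t ht h i s hs
    rw [hx.eq_mul_exp ht i s (hA i s) (hA0 i s)]
    exact mul_le_mul (hoff i s hs) (Real.exp_le_exp.2 (h i s hs)) (Real.exp_pos _).le hd0
  have main : Icc 0 t ⊆ {t | ∀ i, ∀ s ∉ T i, A i s t ≤ -(η * t)} := by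
    refine IsClosed.Icc_subset_of_forall_exists_gt ?_ (fun i s _ => by simp [hA0]) ?_
    · have : {t | ∀ i, ∀ s ∉ T i, A i s t ≤ -(η * t)} ∩ Icc 0 t =
          Icc 0 t ∩ ⋂ i, ⋂ s, ⋂ _ : s ∉ T i, {τ ∈ Icc 0 t | A i s τ ≤ -(η * τ)} := by
        ext τ
        simp only [mem_inter_iff, mem_ofPred_eq, mem_iInter]
        exact ⟨fun h => ⟨h.2, fun i s hs => ⟨h.2, h.1 i s hs⟩⟩,
          fun h => ⟨fun i s hs => (h.2 i s hs).2, h.1⟩⟩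
      rw [this]
      refine isClosed_Icc.inter <| isClosed_iInter fun i => isClosed_iInter fun s =>
        isClosed_iInter fun _ => isClosed_Icc.isClosed_le ((hAc i s).mono fun τ hτ => hτ.1)
          (by fun_prop)
    · rintro a ⟨ha, haI⟩ b hb
      have ha0 := haI.1
      have hoffa := hoffA a ha0 ha
      have hev : ∀ᶠ τ in 𝓝[≥] a, OffLe T ρ (x τ) := by
        have : ∀ i, ∀ s, ∀ᶠ τ in 𝓝[≥] a, s ∉ T i → x τ i s ≤ ρ := fun i s => by
          by_cases hs : s ∈ T i
          · exact Eventually.of_forall fun _ h => absurd hs h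
          have hc : ContinuousWithinAt (fun τ => x τ i s) (Ici a) a :=
            ((hx.hasDerivWithinAt ha0 i s).continuousWithinAt).mono (Ici_subset_Ici.2 ha0)
          have h1 : x a i s < ρ := by
            have h2 : Real.exp (-(η * a)) ≤ 1 := by
              rw [Real.exp_le_one_iff]; linarith [mul_nonneg hη.le ha0]
            have h3 := mul_le_mul_of_nonneg_left h2 hd0
            have h4 := hoffa i s hs
            linarith
          filter_upwards [hc.eventually (eventually_lt_nhds h1)] with τ hτ _
          exact hτ.le
        filter_upwards [eventually_all.2 fun i => eventually_all.2 (this i)] with τ hτ i s hs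
        exact hτ i s hs
      obtain ⟨v, hv, hsub⟩ := mem_nhdsGE_iff_exists_Icc_subset.1 hev
      refine ⟨min v b, fun i s hs => ?_, lt_min hv hb, min_le_right _ _⟩
      have hd' : ∀ τ ∈ Ico a (min v b), HasDerivWithinAt (A i s) (growthRate u (x τ) i s)
          (Ici τ) τ := fun τ hτ =>
        (hA i s τ (ha0.trans hτ.1)).mono (Ici_subset_Ici.2 (ha0.trans hτ.1))
      refine image_le_of_deriv_right_le_deriv_boundary (B := fun τ => -(η * τ))
        (B' := fun _ => -(η * 1)) ((hAc i s).mono fun τ hτ => ha0.trans hτ.1) hd'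
        (ha i s hs) (by fun_prop) (fun τ _ => ?_) (fun τ hτ => ?_)
        ⟨(lt_min hv hb).le, le_rfl⟩
      · exact (((hasDerivAt_id τ).const_mul η).neg).hasDerivWithinAt
      · rw [mul_one]
        exact hrate _ (hx.mem (ha0.trans hτ.1))
          (hsub ⟨hτ.1, hτ.2.le.trans (min_le_left _ _)⟩) i s hs
  exact hoffA t ht (main ⟨ht, le_rfl⟩)

/-- Subgames that dominate all other strategies are attractors of the replicator dynamic. -/
theorem DominatesOff.isReplicatorAttractor {T : ∀ i, Set (S i)} (hT : ∀ i, (T i).Nonempty)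
    (h : DominatesOff u T) : IsReplicatorAttractor u (subgameSpace T) := by
  obtain ⟨η, hη, ρ, hρ, hdecay⟩ := h.exists_decay hT
  have := isReplicatorAttractor_of_offLe (u := u) (ι := Unit) (T := fun _ => T) (fun _ => hT)
    (fun ε hε => ⟨min ε ρ, lt_min hε hρ, fun x hx ⟨_, h0⟩ t ht => ⟨(), fun i s hs => ?_⟩⟩)
    ⟨ρ, hρ, fun ε hε => ?_⟩
  · rwa [iUnion_const] at this
  · refine (hdecay x hx _ (lt_min hε hρ).le (min_le_right _ _) h0 t ht i s hs).trans ?_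
    refine (mul_le_of_le_one_right (lt_min hε hρ).le ?_).trans (min_le_left _ _)
    rw [Real.exp_le_one_iff]
    linarith [mul_nonneg hη.le ht]
  · have hlim : Tendsto (fun t => ρ * Real.exp (-(η * t))) atTop (𝓝 (ρ * 0)) :=
      (Real.tendsto_exp_neg_atTop_nhds_zero.comp (tendsto_id.const_mul_atTop hη)).const_mul ρ
    rw [mul_zero] at hlim
    obtain ⟨t₀, ht₀⟩ := eventually_atTop.1 (hlim.eventually_lt_const hε)
    refine ⟨max t₀ 0, le_max_right _ _, fun x hx ⟨_, h0⟩ t ht => ⟨(), fun i s hs => ?_⟩⟩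
    exact (hdecay x hx ρ hρ.le le_rfl h0 t ((le_max_right _ _).trans ht) i s hs).trans
      (ht₀ t ((le_max_left _ _).trans ht)).le

theorem IsSinkCycle.isReplicatorAttractor_spannedSubgame {c : ZMod 4 → Profile S}
    (hc : IsSinkCycle u c) : IsReplicatorAttractor u (spannedSubgame c) :=
  DominatesOff.isReplicatorAttractor (fun i => ⟨c 0 i, mem_range_self 0⟩)
    fun _ hp _ _ hr _ hs => hc.lt_of_notMem_range hp hr hs

end Domination

/-! ### The edges of a long cycle attract -/

section EdgeAttractor

variable {N : ℕ} {S : Fin N → Type v} [∀ i, Fintype (S i)] {u : Profile S → Fin N → ℝ}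

/-- The coordinates of a replicator solution on a bounded interval are bounded by those of soft
play; absent strategies start with low payoffs. -/
theorem IsReplicatorSolution.exists_isSoftPlay {x : ℝ → Vec S} (hx : IsReplicatorSolution u x)
    {T : ℝ} (hT : 0 ≤ T) (l : ℝ) : ∃ w, IsSoftPlay u T w ∧
      (∀ t ∈ Icc 0 T, ∀ i s r, x t i s ≤ Real.exp (w t i s - w t i r)) ∧
      ∀ i s, (0 < x 0 i s → w 0 i s = Real.log (x 0 i s)) ∧ (x 0 i s = 0 → w 0 i s ≤ l) := by
  choose P hP0 hP using fun i s => exists_primitive (hx.continuousOn_stratUtility i s)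
  choose Q hQ0 hQ using fun i => exists_primitive (hx.continuousOn_average i)
  have hd : ∀ i s t, 0 ≤ t → HasDerivWithinAt (fun τ => P i s τ - Q i τ)
      (growthRate u (x t) i s) (Ici 0) t := fun i s t ht => (hP i s t ht).sub (hQ i t ht)
  have hbd : ∀ i s, ∃ C, ∀ t ∈ Icc 0 T, P i s t - Q i t ≤ C := fun i s => by
    have hc : ContinuousOn (fun τ => P i s τ - Q i τ) (Icc 0 T) := fun t ht =>
      ((hd i s t ht.1).continuousWithinAt).mono Icc_subset_Ici_self
    obtain ⟨C, hC⟩ := (isCompact_Icc.image_of_continuousOn hc).bddAbove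
    exact ⟨C, fun t ht => hC (mem_image_of_mem _ ht)⟩
  choose C hC using hbd
  classical
  -- For present strategies this is `log x` plus the integrated average payoff `Q`. Absent
  -- strategies start so low that `w ≤ Q` on all of `[0, T]`, which gives the softness bound against
  -- every competitor.
  set w : ℝ → Vec S := fun t i s =>
    (if x 0 i s = 0 then min l (-C i s) else Real.log (x 0 i s)) + P i s t with hw
  have hpos : ∀ i s, x 0 i s ≠ 0 → 0 < x 0 i s := fun i s h =>
    lt_of_le_of_ne ((mem_strategySpace.1 (hx.mem le_rfl) i).1 s) h.symm
  have hexp : ∀ t, 0 ≤ t → ∀ i s, x 0 i s ≠ 0 → x t i s = Real.exp (w t i s - Q i t) := by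
    intro t ht i s h
    rw [hx.eq_mul_exp ht i s (hd i s) (by simp [hP0, hQ0])]
    simp only [hw, if_neg h]
    rw [add_sub_assoc, Real.exp_add, Real.exp_log (hpos i s h)]
  have hle : ∀ t ∈ Icc 0 T, ∀ i r, w t i r ≤ Q i t := by
    intro t ht i r
    by_cases h : x 0 i r = 0
    · simp only [hw, if_pos h]
      linarith [hC i r t ht, min_le_right l (-C i r)]
    · have h1 := le_one_of_mem (hx.mem ht.1) i r
      rw [hexp t ht.1 i r h, Real.exp_le_one_iff] at h1
      linarith
  have hsoft : ∀ t ∈ Icc 0 T, ∀ i s r, x t i s ≤ Real.exp (w t i s - w t i r) := by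
    intro t ht i s r
    by_cases h : x 0 i s = 0
    · rw [hx.eq_zero ht.1 h]
      exact (Real.exp_pos _).le
    · rw [hexp t ht.1 i s h]
      exact Real.exp_le_exp.2 (sub_le_sub_left (hle t ht i r) _)
  refine ⟨w, isSoftPlay_of_hasDerivWithinAt hT (fun t ht => hx.mem ht)
    (fun t ht i s => (hP i s t ht).const_add _) hsoft, hsoft, fun i s => ⟨fun h => ?_, fun h => ?_⟩⟩
  · simp [hw, h.ne', hP0]
  · simp [hw, h, hP0]

variable {K : ℕ} {c : ZMod K → Profile S}

theorem OffLe.exists_le {a b : Profile S} {d : ℝ} {x : Vec S} (hx : x ∈ strategySpace S)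
    (h : OffLe (fun i => {a i, b i}) d x) (hd : 0 ≤ d)
    (hd' : (∑ i, (Fintype.card (S i) : ℝ)) * d ≤ 1 / 4) (i : Fin N) :
    1 / 4 ≤ x i (a i) ∨ 1 / 4 ≤ x i (b i) := by
  classical
  by_contra! hlt
  have h1 : ∑ s, x i s ≤ ∑ s, (d + ((if s = a i then 1 / 4 else 0) +
      if s = b i then 1 / 4 else 0)) := Finset.sum_le_sum fun s _ => by
    by_cases ha : s = a i
    · subst ha
      have : (0 : ℝ) ≤ if a i = b i then 1 / 4 else 0 := by split_ifs <;> norm_num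
      rw [if_pos rfl]
      linarith [hlt.1]
    · by_cases hb : s = b i
      · subst hb
        rw [if_pos rfl, if_neg ha]
        linarith [hlt.2]
      · rw [if_neg ha, if_neg hb]
        simpa using h i s (by simp [ha, hb])
  rw [(mem_strategySpace.1 hx i).2, Finset.sum_add_distrib, Finset.sum_add_distrib,
    Finset.sum_ite_eq' Finset.univ (a i), Finset.sum_ite_eq' Finset.univ (b i),
    if_pos (Finset.mem_univ _), if_pos (Finset.mem_univ _), Finset.sum_const, Finset.card_univ,
    nsmul_eq_mul] at h1
  have h2 := mul_le_mul_of_nonneg_right (Finset.single_le_sum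
    (f := fun i => (Fintype.card (S i) : ℝ)) (fun _ _ => Nat.cast_nonneg _)
    (Finset.mem_univ i)) hd
  linarith

namespace IsSinkCycle

/-- Mass at most `exp (-m) / 4` off an edge means distance at least `m` in logarithmic coordinates:
for each player one of the edge strategies has probability at least `1 / 4`, which cancels the
factor. Linear growth of the distance then becomes exponential decay of the mass. -/
theorem exists_decay (hc : IsSinkCycle u c) (hK : 4 < K) :
    ∃ M > 0, ∃ δ > 0, ∀ x, IsReplicatorSolution u x → ∀ m, M ≤ m →
      (∃ k, OffLe (fun i => {c k i, c (k + 1) i}) (Real.exp (-m) / 4) (x 0)) → ∀ t, 0 ≤ t →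
      ∃ k, OffLe (fun i => {c k i, c (k + 1) i}) (Real.exp (-(δ * (m + t)))) (x t) := by
  obtain ⟨M, hM, δ, hδ, hgrow⟩ := hc.exists_growth hK
  set D := ∑ i, (Fintype.card (S i) : ℝ)
  refine ⟨max M D, lt_max_of_lt_left hM, δ, hδ, ?_⟩
  rintro x hx m hm ⟨k, hk⟩ t ht
  set d := Real.exp (-m) / 4 with hd
  have hd0 : 0 < d := by positivity
  have hDd : D * d ≤ 1 / 4 := by
    have h1 := Real.add_one_le_exp m
    have h2 : D ≤ Real.exp m := by linarith [(le_max_right M D).trans hm]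
    rw [hd, mul_div_assoc', div_le_div_iff_of_pos_right (by norm_num), Real.exp_neg]
    rw [← div_eq_mul_inv, div_le_one (Real.exp_pos m)]
    exact h2
  obtain ⟨w, hw, hsoft, hw0⟩ := hx.exists_isSoftPlay ht (Real.log d)
  have hlogd : Real.log d = -m - Real.log 4 := by
    rw [hd, Real.log_div (Real.exp_pos _).ne' (by norm_num), Real.log_exp]
  have hbig : ∀ i s, 1 / 4 ≤ x 0 i s → -Real.log 4 ≤ w 0 i s := fun i s h => by
    rw [(hw0 i s).1 (by linarith), ← Real.log_inv]
    exact Real.log_le_log (by norm_num) (by linarith)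
  have hnear : NearEdge c k m (w 0) := by
    intro i s h₁ h₂
    have h3 : -Real.log 4 ≤ max (w 0 i (c k i)) (w 0 i (c (k + 1) i)) := by
      rcases hk.exists_le (hx.mem le_rfl) hd0.le hDd i with h | h
      · exact (hbig _ _ h).trans (le_max_left _ _)
      · exact (hbig _ _ h).trans (le_max_right _ _)
    have h4 : w 0 i s ≤ Real.log d := by
      rcases ((mem_strategySpace.1 (hx.mem le_rfl) i).1 s).eq_or_lt with h | h
      · exact (hw0 i s).2 h.symm
      · rw [(hw0 i s).1 h]
        exact Real.log_le_log h (hk i s (by simp [h₁, h₂]))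
    linarith
  obtain ⟨l, hl⟩ := hgrow t w hw m ((le_max_left _ _).trans hm) k hnear t ⟨ht, le_rfl⟩
  refine ⟨l, fun i s hs => ?_⟩
  simp only [mem_insert_iff, mem_singleton_iff, not_or] at hs
  have h5 := hl i s hs.1 hs.2
  rcases max_choice (w t i (c l i)) (w t i (c (l + 1) i)) with h | h <;> rw [h] at h5
  · exact (hsoft t ⟨ht, le_rfl⟩ i s (c l i)).trans (Real.exp_le_exp.2 (by linarith))
  · exact (hsoft t ⟨ht, le_rfl⟩ i s (c (l + 1) i)).trans (Real.exp_le_exp.2 (by linarith))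

/-- The edges of a sink cycle of length greater than four form an attractor of the replicator
dynamic. -/
theorem isReplicatorAttractor_edgeUnion (hc : IsSinkCycle u c) (hK : 4 < K) :
    IsReplicatorAttractor u (edgeUnion c) := by
  have : NeZero K := ⟨by omega⟩
  obtain ⟨M, hM, δ, hδ, hdecay⟩ := hc.exists_decay hK
  have hlim : Tendsto (fun t => Real.exp (-(δ * t))) atTop (𝓝 0) :=
    Real.tendsto_exp_neg_atTop_nhds_zero.comp (tendsto_id.const_mul_atTop hδ)
  refine isReplicatorAttractor_of_offLe (T := fun k i => {c k i, c (k + 1) i})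
    (fun k i => ⟨c k i, by simp⟩) (fun ε hε => ?_)
    ⟨Real.exp (-M) / 4, by positivity, fun ε hε => ?_⟩
  · obtain ⟨m, hm, hmM⟩ := ((hlim.eventually_lt_const hε).and (eventually_ge_atTop M)).exists
    refine ⟨Real.exp (-m) / 4, by positivity, fun x hx h0 t ht => ?_⟩
    obtain ⟨k, hk⟩ := hdecay x hx m hmM h0 t ht
    refine ⟨k, fun i s hs => (hk i s hs).trans (le_trans (Real.exp_le_exp.2 ?_) hm.le)⟩
    have := mul_nonneg hδ.le ht
    linarith
  · obtain ⟨t₀, ht₀⟩ := eventually_atTop.1 (hlim.eventually_lt_const hε)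
    refine ⟨max t₀ 0, le_max_right _ _, fun x hx h0 t ht => ?_⟩
    obtain ⟨k, hk⟩ := hdecay x hx M le_rfl h0 t ((le_max_right _ _).trans ht)
    refine ⟨k, fun i s hs => (hk i s hs).trans (le_trans (Real.exp_le_exp.2 ?_)
      (ht₀ t ((le_max_left _ _).trans ht)).le)⟩
    have := mul_pos hδ hM
    linarith

end IsSinkCycle

end EdgeAttractor

end NGame

theorem mainTheorem3 {N : ℕ} {S : Fin N → Type*} [∀ i, Fintype (S i)]
    (u : NGame.Profile S → Fin N → ℝ) {K : ℕ} (c : ZMod K → NGame.Profile S)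
    (hc : NGame.IsSinkCycle u c) :
    (4 < K →
      NGame.IsStablePlay (NGame.IsPayoffBRDSolution u) c ∧
      NGame.IsStablePlay (NGame.IsPayoffRDSolution u) c ∧
      NGame.IsReplicatorAttractor u (NGame.edgeUnion c)) ∧
    (K = 4 → NGame.IsReplicatorAttractor u (NGame.spannedSubgame c)) := by
  refine ⟨fun hK => ?_, ?_⟩
  · obtain ⟨h₁, h₂⟩ := hc.isStablePlay hK
    exact ⟨h₁, h₂, hc.isReplicatorAttractor_edgeUnion hK⟩
  · rintro rfl
    exact hc.isReplicatorAttractor_spannedSubgame
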